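/- Let $E$ be a locally compact, second-countable Hausdorff space, and let $X$ be a (conservative) Feller Markov process with state space $E$, with law $\mathbb P^x$ on the Skorokhod space $D=D(\mathbb R_+,E)$ of càdlàg paths when it is started from $x\in E$. Assume that for all $t_0>0$ and $x'\in E$, $$\lim_{x''\to x'}(\mathbb P^{x'}\otimes\mathbb P^{x''})\{X'_t=X''_t\text{ for some }t\in[0,t_0]\}=1 .$$ Let $N\in\{1,2,\dots\}\cup\{\infty\}$, and let $[N]=\{1,\dots,N\}$ if $N<\infty$, $[N]=\{1,2,\dots\}$ if $N=\infty$. For $\mathbf x=(x_i)_{i\in[N]}\in E^N$ let $\mathbb P^{\mathbf x}=\bigotimes_{i}\mathbb P^{x_i}$. Given free paths $\xi=(\xi_i)_{i\in[N]}\in D^N$, define the coalescing paths $\zeta_i$ inductively by $\zeta_1=\xi_1$ and, for $i>1$, $\tau_i=\inf\{t\ge 0:\xi_i(t)\in\{\zeta_1(t),\dots,\zeta_{i-1}(t)\}\}$ (with $\inf\emptyset=\infty$), $J_i=\min\{j<i:\xi_i(\tau_i)=\zeta_j(\tau_i)\}$ if $\tau_i<\infty$, and $\zeta_i(t)=\xi_i(t)$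 for $t<\tau_i$, $\zeta_i(t)=\zeta_{J_i}(t)$ for $t\ge\tau_i$. Let $\Xi_t$ be the closure in $E$ of $\{\zeta_i(t):i\in[N]\}$; this is an element of the space $\mathcal C(E)$ of nonempty closed subsets of $E$, which carries the topology of the Hausdorff metric on the closures of its elements in the one-point compactification of $E$, the corresponding Borel $\sigma$-algebra, and, on $\mathcal C(E)^{\mathbb R_+}$, the product $\sigma$-algebra. Then $(\Xi_t)_{t\ge0}$ is a strong Markov process with respect to the filtration $\mathcal F_t=\bigcap_{\varepsilon>0}\sigma\{\xi_i(s):s\le t+\varepsilon,\ i\in[N]\}$. That is, there is a Markov kernel $Q$ from $\mathcal C(E)$ to $\mathcal C(E)^{\mathbb R_+}$ such that: 1. for every $\mathbf x\in E^N$, the law of $\Xi$ under $\mathbb P^{\mathbf x}$ is $Q_A$ with $A=\overline{\{x_i:i\in[N]\}}$; 2. for every $\mathbf x\in E^N$ and all random paths $\xi_i$, $i\in[N]$, defined on a common probability space, independent, and with laws $\mathbb P^{x_i}$: each $\Xi_t$ is almost surely equal to an $\mathcal F_t$-measurable random variable, and for every $(\mathcal F_t)$-stopping time $S$ with values in $[0,\infty]$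 and every bounded measurable $f:\mathcal C(E)^{\mathbb R_+}\to\mathbb R$, $$\mathbb E\big[f\big((\Xi_{S+t})_{t\ge 0}\big)\,\big|\,\mathcal F_S\big]=\int f\,dQ_{\Xi_S}\qquad\text{almost surely on }\{S<\infty\}.$$ (No completion of the filtration is taken; measurability of functionals of $\Xi$ is understood up to null sets.) -/

import Mathlib

open MeasureTheory ProbabilityTheory Filter Topology TopologicalSpace
open scoped NNReal ENNReal ZeroAtInfty

noncomputable section

namespace Coalescing

/-! ### Càdlàg paths -/

/-- A path is càdlàg if it is right-continuous at every time and has a left limit (in `E`) at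
every time.  (At time `0` the left limit is a void condition.) -/
def IsCadlag {E : Type*} [TopologicalSpace E] (w : ℝ≥0 → E) : Prop :=
  ∀ t, ContinuousWithinAt w (Set.Ici t) t ∧ ∃ l, Tendsto w (𝓝[<] t) (𝓝 l)

/-- The Skorokhod space `D(ℝ₊, E)`. -/
def CadlagPath (E : Type*) [TopologicalSpace E] : Type _ := {w : ℝ≥0 → E // IsCadlag w}

instance {E : Type*} [TopologicalSpace E] : CoeFun (CadlagPath E) (fun _ => ℝ≥0 → E) where
  coe := Subtype.val

/-- The σ-algebra of the Skorokhod space, generated by the coordinate maps `w ↦ w t`. -/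
instance {E : Type*} [TopologicalSpace E] [MeasurableSpace E] :
    MeasurableSpace (CadlagPath E) :=
  ⨆ t : ℝ≥0, MeasurableSpace.comap (fun w : CadlagPath E => w t) inferInstance

/-- The σ-algebra on the Skorokhod space generated by the path up to time `s`. -/
abbrev pathPast (E : Type*) [TopologicalSpace E] [MeasurableSpace E] (s : ℝ≥0) :
    MeasurableSpace (CadlagPath E) :=
  ⨆ u : ℝ≥0, ⨆ _ : u ≤ s, MeasurableSpace.comap (fun w : CadlagPath E => w u) inferInstance

/-! ### Feller processes -/

/-- A (conservative) Feller semigroup: a semigroup of Markov kernels which maps `C₀(E)` to itself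
and is strongly continuous there at time `0`. -/
structure IsFellerSemigroup {E : Type*} [TopologicalSpace E] [MeasurableSpace E]
    (P : ℝ≥0 → Kernel E E) : Prop where
  markov : ∀ t, IsMarkovKernel (P t)
  zero : P 0 = Kernel.id
  add : ∀ s t, P (s + t) = P t ∘ₖ P s
  map_zeroAtInfty : ∀ (t : ℝ≥0) (f : C₀(E, ℝ)), ∃ g : C₀(E, ℝ), ∀ x, g x = ∫ y, f y ∂(P t x)
  strongly_continuous : ∀ f : C₀(E, ℝ),
    TendstoUniformly (fun (t : ℝ≥0) x => ∫ y, f y ∂(P t x)) f (𝓝[>] 0)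

/-- A Feller Markov process with state space `E`: a Feller semigroup, together with the laws, on
the Skorokhod space, of the càdlàg Markov process with this semigroup started from each `x`. -/
structure FellerProcess (E : Type*) [TopologicalSpace E] [MeasurableSpace E] where
  semigroup : ℝ≥0 → Kernel E E
  isFeller : IsFellerSemigroup semigroup
  law : Kernel E (CadlagPath E)
  isMarkovKernel_law : IsMarkovKernel law
  start : ∀ x, ∀ᵐ w ∂(law x), w 0 = x
  markov_property : ∀ (x : E) (s t : ℝ≥0) (A : Set (CadlagPath E)) (B : Set E),
    MeasurableSet[pathPast E s] A → MeasurableSet B →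
      law x (A ∩ {w | w (s + t) ∈ B}) = ∫⁻ w in A, semigroup t (w s) B ∂(law x)

/-- The immediate-collision assumption: for all `t₀ > 0` and `x'`, two independent copies of the
process started from `x'` and `x''` meet during `[0, t₀]` with a probability that tends to `1` as
`x'' → x'`. -/
def FellerProcess.ImmediateCollision {E : Type*} [TopologicalSpace E] [MeasurableSpace E]
    (X : FellerProcess E) : Prop :=
  ∀ t₀ : ℝ≥0, 0 < t₀ → ∀ x' : E,
    Tendsto (fun x'' => ((X.law x').prod (X.law x''))
      {p : CadlagPath E × CadlagPath E | ∃ t ≤ t₀, p.1 t = p.2 t}) (𝓝 x') (𝓝 1)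

/-! ### The collision rule -/

/-- The first time at which the free path `x` is at the position of one of the paths `ζ j`
(`∞` if there is no such time). -/
def collisionTime {ι E : Type*} (x : ℝ≥0 → E) (ζ : ι → ℝ≥0 → E) : ℝ≥0∞ :=
  ⨅ t ∈ {t : ℝ≥0 | ∃ j, x t = ζ j t}, (t : ℝ≥0∞)

/-- The path that follows `x` strictly before its collision time `τ` with the paths `ζ j`, and from
time `τ` on follows `ζ J`, where `J` is the least `j` such that `x τ = ζ j τ`. -/
def follow {ι E : Type*} [LinearOrder ι] (x : ℝ≥0 → E) (ζ : ι → ℝ≥0 → E) : ℝ≥0 → E :=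
  open Classical in
  fun t =>
    if h : collisionTime x ζ ≤ t ∧
        ∃ J, IsLeast {j | x (collisionTime x ζ).toNNReal = ζ j (collisionTime x ζ).toNNReal} J
    then ζ h.2.choose t
    else x t

/-- The index set `[N]`, for a finite or infinite number `N` of particles (indices start at
`0`). -/
abbrev Idx (N : ℕ∞) : Type := {i : ℕ // (i : ℕ∞) < N}

/-- The collision rule `Λ`, which makes a vector of coalescing paths `ζ = Λ ξ` from a vector of free
paths `ξ`: the path `ζ i` follows `ξ i` until this meets one of the `ζ j` with `j < i`. -/
def coalesce {E : Type*} {N : ℕ∞} (ξ : Idx N → ℝ≥0 → E) (i : Idx N) : ℝ≥0 → E :=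
  follow (ξ i) (fun j : {j : Idx N // j < i} => coalesce ξ j.1)
termination_by i.1
decreasing_by exact j.2

/-! ### The set-valued coalescing process -/

/-- The nonempty closed subsets of `E`. -/
def ClosedSubset (E : Type*) [TopologicalSpace E] : Type _ := {A : Set E // IsClosed A ∧ A.Nonempty}

/-- The identification of a nonempty closed subset of `E` with its closure in the one-point
compactification of `E`. -/
def ClosedSubset.compactify {E : Type*} [TopologicalSpace E] (A : ClosedSubset E) :
    NonemptyCompacts (OnePoint E) :=
  ⟨⟨closure ((fun x : E => (x : OnePoint E)) '' A.1), isClosed_closure.isCompact⟩,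
    (A.2.2.image _).closure⟩

/-- The topology on nonempty closed subsets of `E` that comes from the Hausdorff metric (that is,
from the Vietoris topology) on the nonempty compact subsets of the one-point compactification.
If `E` is compact, it is the topology of the Hausdorff metric on the nonempty compact subsets
of `E`. -/
instance {E : Type*} [TopologicalSpace E] : TopologicalSpace (ClosedSubset E) :=
  TopologicalSpace.induced ClosedSubset.compactify inferInstance

instance {E : Type*} [TopologicalSpace E] : MeasurableSpace (ClosedSubset E) :=
  borel (ClosedSubset E)

instance (N : ℕ∞) [NeZero N] : Nonempty (Idx N) :=
  ⟨⟨0, by simpa using pos_iff_ne_zero.mpr (NeZero.ne N)⟩⟩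

/-- The closure in `E` of the set of entries of a vector. -/
def closureRange {E : Type*} [TopologicalSpace E] {N : ℕ∞} [NeZero N] (x : Idx N → E) :
    ClosedSubset E :=
  ⟨closure (Set.range x), isClosed_closure, (Set.range_nonempty x).closure⟩

/-- The set-valued coalescing process `Ξ` made from a vector of free paths: `Ξ t` is the closure of
the set of the positions of the coalescing paths at time `t`. -/
def setValued {E : Type*} [TopologicalSpace E] {N : ℕ∞} [NeZero N]
    (ξ : Idx N → CadlagPath E) (t : ℝ≥0) : ClosedSubset E :=
  closureRange (fun i => coalesce (fun j => (ξ j : ℝ≥0 → E)) i t)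

/-! ### Systems of independent particles, their filtration, and the strong Markov property -/

/-- Under `μ`, the free paths `ξ i` are independent copies of the Feller process `X`, started from
the points `x i`. -/
structure IsFreeSystem {E : Type*} [TopologicalSpace E] [MeasurableSpace E]
    (X : FellerProcess E) {N : ℕ∞} (x : Idx N → E) {Ω : Type*} [MeasurableSpace Ω]
    (μ : Measure Ω) (ξ : Idx N → Ω → CadlagPath E) : Prop where
  measurable : ∀ i, Measurable (ξ i)
  map_eq : ∀ i, μ.map (ξ i) = X.law (x i)
  indep : iIndepFun ξ μ

/-- The law `ℙˣ`, on `D(ℝ₊, E)^N`, of a vector of independent copies of `X` started from the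
entries of `x`. -/
def FellerProcess.vectorLaw {E : Type*} [TopologicalSpace E] [MeasurableSpace E]
    (X : FellerProcess E) {N : ℕ∞} (x : Idx N → E) : Measure (Idx N → CadlagPath E) :=
  Measure.infinitePi (fun i => X.law (x i))

/-- The right-continuous filtration generated by the free particles:
`𝓕 t = ⋂_{ε > 0} σ{ξ i s : s ≤ t + ε, i ∈ [N]}`. -/
def freeFiltration {E : Type*} [TopologicalSpace E] [MeasurableSpace E] {N : ℕ∞}
    {Ω : Type*} [m : MeasurableSpace Ω] (ξ : Idx N → Ω → CadlagPath E)
    (hξ : ∀ i, Measurable (ξ i)) : Filtration ℝ≥0 m where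
  seq t := ⨅ ε : ℝ≥0, ⨅ _ : 0 < ε, ⨆ i : Idx N, ⨆ s : ℝ≥0, ⨆ _ : s ≤ t + ε,
    MeasurableSpace.comap (fun ω => ξ i ω s) inferInstance
  mono' := by
    intro t t' h
    refine iInf₂_mono fun ε _ => iSup_mono fun i => iSup_mono fun s => ?_
    exact iSup_mono' fun hs => ⟨hs.trans (by gcongr), le_rfl⟩
  le' := by
    intro t
    refine iInf₂_le_of_le 1 one_pos (iSup_le fun i => iSup_le fun s => iSup_le fun _ => ?_)
    refine Measurable.comap_le (Measurable.comp (g := fun w : CadlagPath E => w s) ?_ (hξ i))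
    exact Measurable.mono (comap_measurable _)
      (le_iSup (fun t : ℝ≥0 =>
        MeasurableSpace.comap (fun w : CadlagPath E => w t) inferInstance) s) le_rfl

/-- The process shifted by a random time: `(θ_τ Y) s = Y (τ + s)` (and, by convention,
`τ` is replaced by `0` where it is infinite). -/
def shiftedPath {Ω S : Type*} (Y : ℝ≥0 → Ω → S) (τ : Ω → WithTop ℝ≥0) (ω : Ω) : ℝ≥0 → S :=
  fun s => Y ((τ ω).untopD 0 + s) ω

/-- Under `μ`, the process `Y` is strong Markov with respect to the filtration `𝓕`, where `Q a` is
the law, on path space, of the process started from the state `a`.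
The process is adapted, up to null sets, its shifts by stopping times are random elements of the
path space, up to null sets, and for each stopping time `τ` and each bounded measurable
functional `f`, one has `𝔼[f (θ_τ Y) | 𝓕_τ] = ∫ f ∂(Q (Y_τ))` almost surely on `{τ < ∞}`. -/
structure IsStrongMarkov {Ω S : Type*} [m : MeasurableSpace Ω] [MeasurableSpace S]
    (μ : Measure Ω) (𝓕 : Filtration ℝ≥0 m) (Q : Kernel S (ℝ≥0 → S)) (Y : ℝ≥0 → Ω → S) :
    Prop where
  adapted : ∀ t, ∃ Z : Ω → S, Measurable[𝓕 t] Z ∧ Y t =ᵐ[μ] Z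
  aemeasurable_shiftedPath : ∀ τ : Ω → WithTop ℝ≥0, IsStoppingTime 𝓕 τ →
    AEMeasurable (shiftedPath Y τ) μ
  condExp_shiftedPath : ∀ (τ : Ω → WithTop ℝ≥0) (hτ : IsStoppingTime 𝓕 τ) (f : (ℝ≥0 → S) → ℝ),
    Measurable f → (∃ C, ∀ w, |f w| ≤ C) →
      μ[{ω | τ ω < ⊤}.indicator (fun ω => f (shiftedPath Y τ ω)) | hτ.measurableSpace]
        =ᵐ[μ] {ω | τ ω < ⊤}.indicator (fun ω => ∫ w, f w ∂(Q (shiftedPath Y τ ω 0)))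

end Coalescing

end

open MeasureTheory ProbabilityTheory Filter Topology TopologicalSpace
open scoped NNReal ENNReal ZeroAtInfty

set_option linter.unusedSectionVars false

noncomputable section

/-! A law on set-valued paths is determined by its values on events "at each time `t` of a finite
list, the state meets the open set `U`" (`measure_ext_of_hitEvent`). So everything is reduced to
`hitProb H L`, the probability that finitely many coalescing particles started from the list `L`
make all the hits in `H`. Three facts about it carry the proof.

Monotonicity: a later particle does not influence the earlier ones, so adding it can only help
(`hitProb_le_cons`).

Symmetry: the order of the particles is irrelevant in law (`hitProb_perm`). For two neighbours in
the order, if one of them meets an earlier particle no later than the two meet, the order is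
irrelevant path by path. Otherwise, exchanging the two free paths after they meet turns one order
into the other, and this exchange preserves the law by the strong Markov property (`swap_of_late`,
`swap_of_early`, `FellerProcess.map_swapAfter`).

Continuity: let `t₀` be below all positive times in `H`. Adding a particle at `a` to a list that
contains a nearby `b` raises `hitProb` by at most the probability that copies started from `a` and
`b` do not meet by `t₀`. By symmetry `b` may be ranked first and `a` last, and after a meeting the
particle from `a` adds no new position. By immediate collision this error is small
(`hitProb_le_iSup`).

Hence the supremum of `hitProb H L` over finite lists in a closed set is already reached along any
increasing lists whose union is dense in it (`hitSup_eq_iSup`). The law of the set-valued process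
therefore depends on the starting points only through their closure, which gives the kernel `Q`.

For the strong Markov property at `S`, the coalescing paths after `S` are the coalescing paths of
the shifted free paths of those particles that have not been absorbed by `S`
(`shift_image_coalSet`). Which these are is known at time `S`, they restart as independent copies,
and their positions are dense in the state at `S`.

Since the filtration is not completed, first meeting times need versions. The supremum over `n` of
the first times at distance less than `1/(n+1)` is a stopping time of the right-continuous
filtration, and by quasi-left-continuity it is almost surely a meeting time
(`exists_version_and_stoppingTime`). -/

namespace Coalescing

/-! ### Operations on càdlàg paths and evaluation at random times -/

section Paths

variable {E : Type*} [TopologicalSpace E]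

theorem CadlagPath.rightCont (w : CadlagPath E) (t : ℝ≥0) :
    ContinuousWithinAt w (Set.Ici t) t := (w.2 t).1

theorem CadlagPath.leftLim (w : CadlagPath E) (t : ℝ≥0) : ∃ l, Tendsto w (𝓝[<] t) (𝓝 l) :=
  (w.2 t).2

@[ext] theorem CadlagPath.ext {w w' : CadlagPath E} (h : ∀ t, w t = w' t) : w = w' :=
  Subtype.ext (funext h)

/-- The path shifted by the time `s`. -/
def CadlagPath.shift (s : ℝ≥0) (w : CadlagPath E) : CadlagPath E :=
  ⟨fun t => w (s + t), by
    intro t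
    constructor
    · refine (w.rightCont (s + t)).comp (by fun_prop) ?_
      intro u hu
      exact add_le_add_right hu s
    · obtain ⟨l, hl⟩ := w.leftLim (s + t)
      refine ⟨l, hl.comp ?_⟩
      refine tendsto_nhdsWithin_iff.2 ⟨?_, ?_⟩
      · exact (Continuous.tendsto (by fun_prop) t).mono_left nhdsWithin_le_nhds
      · filter_upwards [self_mem_nhdsWithin] with u hu
        exact add_lt_add_right hu s⟩

/-- The path stopped at the time `s`. -/
def CadlagPath.stopAt (s : ℝ≥0) (w : CadlagPath E) : CadlagPath E :=
  ⟨fun t => w (min t s), by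
    intro t
    rcases lt_or_ge t s with h | h
    · have h1 : (fun t => w (min t s)) =ᶠ[𝓝 t] w := by
        filter_upwards [Iio_mem_nhds h] with u hu
        rw [min_eq_left hu.le]
      constructor
      · exact (w.rightCont t).congr_of_eventuallyEq (h1.filter_mono nhdsWithin_le_nhds)
          h1.self_of_nhds
      · obtain ⟨l, hl⟩ := w.leftLim t
        exact ⟨l, hl.congr' (h1.symm.filter_mono nhdsWithin_le_nhds)⟩
    · constructor
      · refine (continuousWithinAt_const (b := w s)).congr ?_ ?_
        · intro u hu
          rw [min_eq_right (h.trans hu)]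
        · rw [min_eq_right h]
      · rcases h.eq_or_lt with rfl | h
        · obtain ⟨l, hl⟩ := w.leftLim s
          refine ⟨l, hl.congr' ?_⟩
          filter_upwards [self_mem_nhdsWithin] with u hu
          rw [min_eq_left (le_of_lt hu)]
        · refine ⟨w s, tendsto_const_nhds.congr' ?_⟩
          filter_upwards [mem_nhdsWithin_of_mem_nhds (Ioi_mem_nhds h)] with u hu
          rw [min_eq_right (le_of_lt hu)]⟩

open Classical in
/-- The path that follows `x` before the time `T` and `z` from the time `T` on. -/
def CadlagPath.cat (x : CadlagPath E) (T : WithTop ℝ≥0) (z : CadlagPath E) : CadlagPath E :=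
  ⟨fun t => if (t : WithTop ℝ≥0) < T then x t else z t, by
    intro t
    have hc : Continuous (fun t : ℝ≥0 => (t : WithTop ℝ≥0)) := WithTop.continuous_coe
    rcases lt_trichotomy (t : WithTop ℝ≥0) T with h | h | h
    · have h1 : (fun t : ℝ≥0 => if (t : WithTop ℝ≥0) < T then x t else z t) =ᶠ[𝓝 t] x := by
        filter_upwards [hc.continuousAt.preimage_mem_nhds (Iio_mem_nhds h)] with u hu
        exact if_pos hu
      constructor
      · exact (x.rightCont t).congr_of_eventuallyEq (h1.filter_mono nhdsWithin_le_nhds)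
          h1.self_of_nhds
      · obtain ⟨l, hl⟩ := x.leftLim t
        exact ⟨l, hl.congr' (h1.symm.filter_mono nhdsWithin_le_nhds)⟩
    · subst h
      constructor
      · refine (z.rightCont t).congr ?_ ?_
        · intro u hu
          exact if_neg (not_lt_of_ge (WithTop.coe_le_coe.2 hu))
        · exact if_neg (lt_irrefl _)
      · obtain ⟨l, hl⟩ := x.leftLim t
        refine ⟨l, hl.congr' ?_⟩
        filter_upwards [self_mem_nhdsWithin] with u hu
        exact (if_pos (WithTop.coe_lt_coe.2 hu)).symm
    · have h1 : (fun t : ℝ≥0 => if (t : WithTop ℝ≥0) < T then x t else z t) =ᶠ[𝓝 t] z := by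
        filter_upwards [hc.continuousAt.preimage_mem_nhds (Ioi_mem_nhds h)] with u hu
        exact if_neg (not_lt_of_gt hu)
      constructor
      · exact (z.rightCont t).congr_of_eventuallyEq (h1.filter_mono nhdsWithin_le_nhds)
          h1.self_of_nhds
      · obtain ⟨l, hl⟩ := z.leftLim t
        exact ⟨l, hl.congr' (h1.symm.filter_mono nhdsWithin_le_nhds)⟩⟩

theorem CadlagPath.cat_of_lt {x z : CadlagPath E} {T : WithTop ℝ≥0} {t : ℝ≥0} (h : (t : WithTop ℝ≥0) < T) :
    x.cat T z t = x t := if_pos h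

theorem CadlagPath.cat_of_ge {x z : CadlagPath E} {T : WithTop ℝ≥0} {t : ℝ≥0} (h : T ≤ t) :
    x.cat T z t = z t := if_neg (not_lt_of_ge h)

/-- The path that takes the value `x t` for `t < s` and `z (t - s)` for `t ≥ s`. -/
def CadlagPath.graft (x : CadlagPath E) (s : ℝ≥0) (z : CadlagPath E) : CadlagPath E :=
  x.cat s ⟨fun t => z (t - s), by
    intro t
    constructor
    · refine (z.rightCont (t - s)).comp (f := fun u : ℝ≥0 => u - s)
        ((continuous_id.sub continuous_const).continuousWithinAt) ?_
      intro u hu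
      exact tsub_le_tsub_right hu s
    -- Truncated subtraction makes this auxiliary path constantly `z 0` up to time `s`, so it has
    -- left limits there; `cat` discards the values before `s`.
    · rcases le_or_gt t s with h | h
      · refine ⟨z 0, tendsto_const_nhds.congr' ?_⟩
        filter_upwards [self_mem_nhdsWithin] with u hu
        rw [tsub_eq_zero_of_le (le_of_lt (lt_of_lt_of_le hu h))]
      · obtain ⟨l, hl⟩ := z.leftLim (t - s)
        refine ⟨l, Tendsto.comp (f := fun u : ℝ≥0 => u - s) hl ?_⟩
        refine tendsto_nhdsWithin_iff.2 ⟨?_, ?_⟩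
        · exact ((continuous_id.sub continuous_const).tendsto t).mono_left nhdsWithin_le_nhds
        · filter_upwards [self_mem_nhdsWithin] with u hu
          exact tsub_lt_tsub_right_of_lt' hu h⟩
where
  tsub_lt_tsub_right_of_lt' {u t s : ℝ≥0} (hu : u < t) (h : s < t) : u - s < t - s := by
    rcases le_or_gt s u with h' | h'
    · exact tsub_lt_tsub_right_of_le h' hu
    · rw [tsub_eq_zero_of_le h'.le]; exact tsub_pos_of_lt h

theorem CadlagPath.graft_of_lt {x z : CadlagPath E} {s t : ℝ≥0} (h : t < s) :
    x.graft s z t = x t := CadlagPath.cat_of_lt (by exact_mod_cast h)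

theorem CadlagPath.graft_of_ge {x z : CadlagPath E} {s t : ℝ≥0} (h : s ≤ t) :
    x.graft s z t = z (t - s) :=
  (CadlagPath.cat_of_ge (by exact_mod_cast h) : _)

variable [MeasurableSpace E]

theorem CadlagPath.measurable_apply (t : ℝ≥0) : Measurable fun w : CadlagPath E => w t :=
  Measurable.mono (comap_measurable _) (le_iSup (fun t : ℝ≥0 =>
    MeasurableSpace.comap (fun w : CadlagPath E => w t) inferInstance) t) le_rfl

theorem CadlagPath.measurable_of_apply {Ω : Type*} {m : MeasurableSpace Ω} {f : Ω → CadlagPath E}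
    (h : ∀ t, Measurable fun ω => f ω t) : Measurable f := by
  refine Measurable.of_comap_le ?_
  change MeasurableSpace.comap f (⨆ t : ℝ≥0, _) ≤ m
  rw [MeasurableSpace.comap_iSup]
  refine iSup_le fun t => ?_
  rw [MeasurableSpace.comap_comp]
  exact (h t).comap_le

theorem CadlagPath.measurable_shift (s : ℝ≥0) :
    Measurable (CadlagPath.shift s : CadlagPath E → CadlagPath E) :=
  CadlagPath.measurable_of_apply fun t => CadlagPath.measurable_apply (s + t)

/-- A sequence of times that decreases to `s` from above and takes countably many values. -/
def gridAbove (n : ℕ) (s : ℝ≥0) : ℝ≥0 := ((⌊((n : ℝ≥0) + 1) * s⌋₊ : ℝ≥0) + 1) / ((n : ℝ≥0) + 1)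

/-- The strict inequality, due to the added one in the numerator, is what lets the raw past at the
grid time contain the right-continuous past at `s`. -/
theorem lt_gridAbove (n : ℕ) (s : ℝ≥0) : s < gridAbove n s := by
  have hn : (0 : ℝ≥0) < (n : ℝ≥0) + 1 := by positivity
  rw [gridAbove, lt_div_iff₀ hn, mul_comm]
  exact Nat.lt_floor_add_one _

theorem gridAbove_le (n : ℕ) (s : ℝ≥0) : gridAbove n s ≤ s + 1 / ((n : ℝ≥0) + 1) := by
  have hn : (0 : ℝ≥0) < (n : ℝ≥0) + 1 := by positivity
  rw [gridAbove, div_le_iff₀ hn, add_mul s, one_div, inv_mul_cancel₀ hn.ne', mul_comm s]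
  gcongr
  exact Nat.floor_le (by positivity)

theorem tendsto_one_div_nnreal : Tendsto (fun n : ℕ => 1 / ((n : ℝ≥0) + 1)) atTop (𝓝 0) := by
  rw [← NNReal.tendsto_coe]
  simpa using tendsto_one_div_add_atTop_nhds_zero_nat (𝕜 := ℝ)

theorem tendsto_gridAbove (s : ℝ≥0) :
    Tendsto (fun n => gridAbove n s) atTop (𝓝[≥] s) := by
  refine tendsto_nhdsWithin_iff.2 ⟨?_, Eventually.of_forall fun n => (lt_gridAbove n s).le⟩
  refine tendsto_of_tendsto_of_tendsto_of_le_of_le tendsto_const_nhds ?_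
    (fun n => (lt_gridAbove n s).le) (fun n => gridAbove_le n s)
  simpa using tendsto_one_div_nnreal.const_add s

/-- By right-continuity, evaluation is the limit of evaluations at grid times, and each of these is
a countable patchwork of coordinate maps. -/
theorem CadlagPath.measurable_eval [PseudoMetrizableSpace E] [BorelSpace E] :
    Measurable fun p : CadlagPath E × ℝ≥0 => p.1 p.2 := by
  have h : ∀ n : ℕ, Measurable fun p : CadlagPath E × ℝ≥0 => p.1 (gridAbove n p.2) := by
    intro n
    have h1 : Measurable fun p : CadlagPath E × ℕ => p.1 (((p.2 : ℝ≥0) + 1) / ((n : ℝ≥0) + 1)) :=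
      measurable_from_prod_countable_left fun k =>
        CadlagPath.measurable_apply (((k : ℝ≥0) + 1) / ((n : ℝ≥0) + 1))
    have h2 : Measurable fun p : CadlagPath E × ℝ≥0 => (p.1, ⌊((n : ℝ≥0) + 1) * p.2⌋₊) :=
      measurable_fst.prodMk (Nat.measurable_floor.comp (measurable_snd.const_mul _))
    exact h1.comp h2
  refine measurable_of_tendsto_metrizable h ?_
  rw [tendsto_pi_nhds]
  exact fun p => (p.1.rightCont p.2).tendsto.comp (tendsto_gridAbove p.2)

theorem CadlagPath.measurable_apply_random [PseudoMetrizableSpace E] [BorelSpace E] {Ω : Type*}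
    {m : MeasurableSpace Ω} {W : Ω → CadlagPath E} {u : Ω → ℝ≥0} (hW : Measurable W)
    (hu : Measurable u) : Measurable fun ω => W ω (u ω) :=
  CadlagPath.measurable_eval.comp (hW.prodMk hu)

/-- The path stopped at `t` is measurable even if only the path up to time `t` is observed, so joint
measurability can be applied to it. -/
theorem CadlagPath.measurable_apply_random_of_le [PseudoMetrizableSpace E] [BorelSpace E]
    {Ω : Type*} {m : MeasurableSpace Ω} {W : Ω → CadlagPath E} {u : Ω → ℝ≥0} {t : ℝ≥0}
    (hW : ∀ s ≤ t, Measurable fun ω => W ω s)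
    (hu : Measurable u) : Measurable fun ω => W ω (min (u ω) t) := by
  have h : Measurable fun ω => (W ω).stopAt t :=
    CadlagPath.measurable_of_apply fun s => hW _ (min_le_right s t)
  have h' := CadlagPath.measurable_apply_random h hu
  exact h'

end Paths

/-! ### The collision rule as a deterministic operation on paths -/

section Pathwise

variable {E : Type*}

/-- The path `x` is at time `s` at the position of one of the paths in `Z`. -/
def Meets (x : ℝ≥0 → E) (Z : Set (ℝ≥0 → E)) (s : ℝ≥0) : Prop := ∃ z ∈ Z, x s = z s

/-- Paths in the set `Z` that meet stay together. -/
def IsCoalescing (Z : Set (ℝ≥0 → E)) : Prop :=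
  ∀ z ∈ Z, ∀ z' ∈ Z, ∀ s t, z s = z' s → s ≤ t → z t = z' t

open Classical in
/-- The path that follows `x` until its first meeting with `Z`, and from then on a path of `Z`. -/
def fol (x : ℝ≥0 → E) (Z : Set (ℝ≥0 → E)) (t : ℝ≥0) : E :=
  if h : ∃ p : ℝ≥0 × (ℝ≥0 → E), p.2 ∈ Z ∧ x p.1 = p.2 p.1 ∧ p.1 ≤ t ∧ ∀ r < p.1, ¬ Meets x Z r
  then h.choose.2 t else x t

/-- The set of coalescing paths made from a list of free paths; the head of the list is the last
particle in the order. -/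
def coalSet : List (ℝ≥0 → E) → Set (ℝ≥0 → E)
  | [] => ∅
  | x :: l => insert (fol x (coalSet l)) (coalSet l)

theorem Meets.mono {x : ℝ≥0 → E} {Z W : Set (ℝ≥0 → E)} {s : ℝ≥0} (h : Meets x Z s)
    (hZW : Z ⊆ W) : Meets x W s :=
  let ⟨z, hz, e⟩ := h
  ⟨z, hZW hz, e⟩

theorem IsCoalescing.mono {Z W : Set (ℝ≥0 → E)} (h : IsCoalescing W) (hZW : Z ⊆ W) :
    IsCoalescing Z := fun z hz z' hz' => h z (hZW hz) z' (hZW hz')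

theorem fol_of_not_meets {x : ℝ≥0 → E} {Z : Set (ℝ≥0 → E)} {t : ℝ≥0}
    (h : ∀ s ≤ t, ¬ Meets x Z s) : fol x Z t = x t := by
  refine dif_neg ?_
  rintro ⟨p, hp, e, hpt, -⟩
  exact h _ hpt ⟨_, hp, e⟩

/-- The arbitrary choice in `fol` is harmless: a first meeting time is unique, and the paths of a
coalescing set that are met there agree afterwards. -/
theorem fol_of_meets {x z : ℝ≥0 → E} {Z : Set (ℝ≥0 → E)} {s t : ℝ≥0} (hZ : IsCoalescing Z)
    (hz : z ∈ Z) (e : x s = z s) (hs : ∀ r < s, ¬ Meets x Z r) (hst : s ≤ t) :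
    fol x Z t = z t := by
  have h : ∃ p : ℝ≥0 × (ℝ≥0 → E),
      p.2 ∈ Z ∧ x p.1 = p.2 p.1 ∧ p.1 ≤ t ∧ ∀ r < p.1, ¬ Meets x Z r := ⟨(s, z), hz, e, hst, hs⟩
  have h1 : fol x Z t = h.choose.2 t := dif_pos h
  obtain ⟨h2, h3, h4, h5⟩ := h.choose_spec
  rw [h1]
  generalize h.choose = p at h2 h3 h4 h5
  have : p.1 = s := by
    rcases lt_trichotomy p.1 s with h | h | h
    · exact absurd ⟨_, h2, h3⟩ (hs _ h)
    · exact h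
    · exact absurd ⟨_, hz, e⟩ (h5 _ h)
  rw [this] at h3
  exact hZ _ h2 _ hz s t (h3.symm.trans e) hst

theorem coalSet_append_subset (l l' : List (ℝ≥0 → E)) : coalSet l' ⊆ coalSet (l ++ l') := by
  induction l with
  | nil => exact subset_rfl
  | cons x l ih => exact ih.trans (Set.subset_insert _ _)

@[simp] theorem coalSet_singleton (x : ℝ≥0 → E) : coalSet [x] = {x} := by
  have : fol x ∅ = x := funext fun t => fol_of_not_meets fun s _ ⟨z, hz, _⟩ => hz
  simp [coalSet, this]

/-- Earlier particles act on later ones only through their set of coalescing paths, so an exchange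
of two neighbours need only be checked at their own place in the order. -/
theorem coalSet_append_congr (l : List (ℝ≥0 → E)) {l₁ l₂ : List (ℝ≥0 → E)}
    (h : coalSet l₁ = coalSet l₂) : coalSet (l ++ l₁) = coalSet (l ++ l₂) := by
  induction l with
  | nil => exact h
  | cons x l ih => simp only [List.cons_append, coalSet, ih]

open Classical in
/-- The free paths (given with their indices) that have not been absorbed by time `S`. -/
def alive {ι : Type*} (x : ι → ℝ≥0 → E) (S : ℝ≥0) : List ι → List ι
  | [] => []
  | a :: l => if ∃ s ≤ S, Meets (x a) (coalSet (l.map x)) s then alive x S l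
      else a :: alive x S l

theorem alive_sublist {ι : Type*} (x : ι → ℝ≥0 → E) (S : ℝ≥0) (l : List ι) :
    (alive x S l).Sublist l := by
  induction l with
  | nil => exact List.Sublist.refl _
  | cons a l ih =>
    rw [alive]
    split_ifs
    · exact ih.cons a
    · exact ih.cons_cons a

theorem fol_zero (x : ℝ≥0 → E) (Z : Set (ℝ≥0 → E)) : fol x Z 0 = x 0 := by
  by_cases h : ∃ p : ℝ≥0 × (ℝ≥0 → E),
      p.2 ∈ Z ∧ x p.1 = p.2 p.1 ∧ p.1 ≤ 0 ∧ ∀ r < p.1, ¬ Meets x Z r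
  · have h1 : fol x Z 0 = h.choose.2 0 := dif_pos h
    obtain ⟨h2, h3, h4, h5⟩ := h.choose_spec
    rw [h1]
    rw [nonpos_iff_eq_zero.1 h4] at h3
    exact h3.symm
  · exact dif_neg h

theorem coalSet_image_zero (l : List (ℝ≥0 → E)) :
    (fun z : ℝ≥0 → E => z 0) '' coalSet l = {y | y ∈ l.map fun x => x 0} := by
  induction l with
  | nil => simp [coalSet]
  | cons x l ih =>
    rw [coalSet, Set.image_insert_eq, ih, fol_zero]
    ext y
    simp

variable [TopologicalSpace E]

/-- Right-continuous paths. -/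
def IsRC (x : ℝ≥0 → E) : Prop := ∀ t, ContinuousWithinAt x (Set.Ici t) t

theorem CadlagPath.isRC (w : CadlagPath E) : IsRC (w : ℝ≥0 → E) := w.rightCont

/-- A finite set of right-continuous coalescing paths. -/
structure IsCoalescingFamily (Z : Set (ℝ≥0 → E)) : Prop where
  finite : Z.Finite
  rc : ∀ z ∈ Z, IsRC z
  coalescing : IsCoalescing Z

theorem IsRC.shift {x : ℝ≥0 → E} (hx : IsRC x) (s : ℝ≥0) : IsRC fun t => x (s + t) := by
  intro t
  exact (hx (s + t)).comp (f := fun u => s + u) (by fun_prop) fun u hu => add_le_add_right hu s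

variable [T2Space E]

/-- If `x` were apart from all paths of `Z` at the infimum of the meeting times, then by
right-continuity, separation of points and finiteness of `Z` it would stay apart on an interval to
the right. -/
theorem IsRC.exists_first {x : ℝ≥0 → E} {Z : Set (ℝ≥0 → E)} {t : ℝ≥0} (hx : IsRC x)
    (hfin : Z.Finite) (hZ : ∀ z ∈ Z, IsRC z) (h : Meets x Z t) :
    ∃ s ≤ t, Meets x Z s ∧ ∀ r < s, ¬ Meets x Z r := by
  set M := {s | Meets x Z s} with hM
  have hne : M.Nonempty := ⟨t, h⟩
  have hbdd : BddBelow M := OrderBot.bddBelow M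
  refine ⟨sInf M, csInf_le hbdd h, ?_, fun r hr hm => (csInf_le hbdd hm).not_gt hr⟩
  by_contra hcon
  have h1 : ∀ z ∈ Z, ∀ᶠ u in 𝓝[≥] (sInf M), x u ≠ z u := by
    intro z hz
    have hne : x (sInf M) ≠ z (sInf M) := fun e => hcon ⟨z, hz, e⟩
    obtain ⟨U, V, hU, hV, hxU, hzV, hUV⟩ := t2_separation hne
    filter_upwards [(hx _).tendsto.eventually (hU.mem_nhds hxU),
      (hZ z hz _).tendsto.eventually (hV.mem_nhds hzV)] with u hu hv h
    exact Set.disjoint_left.1 hUV hu (h ▸ hv)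
  have h2 : ∀ᶠ u in 𝓝[≥] (sInf M), ∀ z ∈ Z, x u ≠ z u := (eventually_all_finite hfin).2 h1
  obtain ⟨b, hb, hb'⟩ := (mem_nhdsGE_iff_exists_Ico_subset (a := sInf M)).1 h2
  obtain ⟨u, hu, hub⟩ := exists_lt_of_csInf_lt hne hb
  have hu' := csInf_le hbdd hu
  obtain ⟨z, hz, e⟩ := hu
  exact hb' ⟨hu', hub⟩ z hz e

theorem fol_cases {x : ℝ≥0 → E} {Z : Set (ℝ≥0 → E)} (hx : IsRC x) (hZ : IsCoalescingFamily Z) :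
    ((∀ t, ¬ Meets x Z t) ∧ fol x Z = x) ∨ ∃ s, ∃ z ∈ Z, x s = z s ∧ (∀ r < s, ¬ Meets x Z r) ∧
      (∀ t < s, fol x Z t = x t) ∧ ∀ t, s ≤ t → fol x Z t = z t := by
  by_cases h : ∀ t, ¬ Meets x Z t
  · exact Or.inl ⟨h, funext fun t => fol_of_not_meets fun s _ => h s⟩
  · push Not at h
    obtain ⟨t, ht⟩ := h
    obtain ⟨s, -, ⟨z, hz, e⟩, hs⟩ := hx.exists_first hZ.finite hZ.rc ht
    exact Or.inr ⟨s, z, hz, e, hs,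
      fun t ht => fol_of_not_meets fun r hr => hs r (hr.trans_lt ht),
      fun t ht => fol_of_meets hZ.coalescing hz e hs ht⟩

theorem IsRC.fol {x : ℝ≥0 → E} {Z : Set (ℝ≥0 → E)} (hx : IsRC x) (hZ : IsCoalescingFamily Z) :
    IsRC (fol x Z) := by
  rcases fol_cases hx hZ with ⟨-, h⟩ | ⟨s, z, hz, e, hs, h1, h2⟩
  · rwa [h]
  · intro t
    rcases lt_or_ge t s with hts | hts
    · refine (hx t).congr_of_eventuallyEq ?_ (h1 t hts)
      filter_upwards [mem_nhdsWithin_of_mem_nhds (Iio_mem_nhds hts)] with u hu using h1 u hu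
    · exact (hZ.rc z hz t).congr (fun u hu => h2 u (hts.trans hu)) (h2 t hts)

theorem IsCoalescingFamily.insert_fol {x : ℝ≥0 → E} {Z : Set (ℝ≥0 → E)} (hx : IsRC x)
    (hZ : IsCoalescingFamily Z) : IsCoalescingFamily (insert (fol x Z) Z) := by
  -- Before it joins `Z` the new path is `x`, which meets nothing; afterwards it is a path of `Z`,
  -- and the coalescence of `Z` applies.
  have key : ∀ z ∈ Z, ∀ s t, fol x Z s = z s → s ≤ t → fol x Z t = z t := by
    intro z hz s t e hst
    rcases fol_cases hx hZ with ⟨h, h'⟩ | ⟨r, z', hz', e', hr, h1, h2⟩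
    · rw [h'] at e
      exact absurd ⟨z, hz, e⟩ (h s)
    · rcases lt_or_ge s r with hsr | hsr
      · rw [h1 s hsr] at e
        exact absurd ⟨z, hz, e⟩ (hr s hsr)
      · rw [h2 s hsr] at e
        rw [h2 t (hsr.trans hst)]
        exact hZ.coalescing _ hz' _ hz s t e hst
  refine ⟨hZ.finite.insert _, ?_, ?_⟩
  · rintro z (rfl | hz)
    · exact hx.fol hZ
    · exact hZ.rc z hz
  · rintro z (rfl | hz) z' (rfl | hz') s t e hst
    · rfl
    · exact key z' hz' s t e hst
    · exact (key z hz s t e.symm hst).symm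
    · exact hZ.coalescing z hz z' hz' s t e hst

theorem isCoalescingFamily_coalSet {l : List (ℝ≥0 → E)} (h : ∀ x ∈ l, IsRC x) :
    IsCoalescingFamily (coalSet l) := by
  induction l with
  | nil => exact ⟨Set.finite_empty, fun _ h => h.elim, fun _ h => h.elim⟩
  | cons x l ih =>
    exact (ih fun y hy => h y (List.mem_cons_of_mem _ hy)).insert_fol (h x List.mem_cons_self)

/-- If `x` meets no path of `W` before it meets `Z`, then at its first meeting it is also on a path
of `Z`, which it may be taken to follow. -/
theorem fol_congr {x : ℝ≥0 → E} {Z W : Set (ℝ≥0 → E)} (hx : IsRC x) (hZ : IsCoalescingFamily Z)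
    (hW : IsCoalescing W) (hZW : Z ⊆ W)
    (h : ∀ r, Meets x W r → ∃ r' ≤ r, Meets x Z r') : fol x W = fol x Z := by
  funext t
  rcases fol_cases hx hZ with ⟨h1, h2⟩ | ⟨s, z, hz, e, hs, h1, h2⟩
  · rw [h2]
    refine fol_of_not_meets fun s _ hm => ?_
    obtain ⟨r, -, hr⟩ := h s hm
    exact h1 r hr
  · have hs' : ∀ r < s, ¬ Meets x W r := fun r hr hm => by
      obtain ⟨r', hr', hm'⟩ := h r hm
      exact hs r' (hr'.trans_lt hr) hm'
    rcases lt_or_ge t s with hts | hts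
    · rw [h1 t hts]
      exact fol_of_not_meets fun r hr => hs' r (hr.trans_lt hts)
    · rw [h2 t hts]
      exact fol_of_meets hW (hZW hz) e hs' hts

/-- With no meeting before `T`, the time and place of joining `Z` are determined by the free path
from `T` on. -/
theorem fol_tail_congr {x y : ℝ≥0 → E} {Z : Set (ℝ≥0 → E)} {T : ℝ≥0} (hx : IsRC x)
    (hZ : IsCoalescingFamily Z) (hxy : ∀ t, T ≤ t → x t = y t) (hxZ : ∀ r < T, ¬ Meets x Z r)
    (hyZ : ∀ r < T, ¬ Meets y Z r) {t : ℝ≥0} (ht : T ≤ t) : fol x Z t = fol y Z t := by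
  have hm : ∀ r, Meets y Z r → Meets x Z r := by
    intro r hr
    rcases lt_or_ge r T with h | h
    · exact absurd hr (hyZ r h)
    · obtain ⟨z, hz, e⟩ := hr
      exact ⟨z, hz, (hxy r h).trans e⟩
  rcases fol_cases hx hZ with ⟨h1, h2⟩ | ⟨s, z, hz, e, hs, h1, h2⟩
  · rw [h2, hxy t ht]
    exact (fol_of_not_meets fun r _ h => h1 r (hm r h)).symm
  · have hTs : T ≤ s := not_lt.1 fun h => hxZ s h ⟨z, hz, e⟩
    rcases lt_or_ge t s with hts | hts
    · rw [h1 t hts, hxy t ht]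
      exact (fol_of_not_meets fun r hr h => hs r (hr.trans_lt hts) (hm r h)).symm
    · rw [h2 t hts]
      exact (fol_of_meets hZ.coalescing hz ((hxy s hTs).symm.trans e)
        (fun r hr h => hs r hr (hm r h)) hts).symm

/-- If two free paths do not meet before one of them meets `Z`, their order is irrelevant. -/
theorem fol_insert_of_late {a b : ℝ≥0 → E} {Z : Set (ℝ≥0 → E)} (ha : IsRC a) (hb : IsRC b)
    (hZ : IsCoalescingFamily Z)
    (h : ∀ T, a T = b T → ∃ r ≤ T, Meets a Z r ∨ Meets b Z r) :
    fol a (insert (fol b Z) Z) = fol a Z := by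
  refine fol_congr ha hZ (hZ.insert_fol hb).coalescing (Set.subset_insert _ _) ?_
  rintro r ⟨z, rfl | hz, e⟩
  -- If `b` has been absorbed by time `r`, its coalescing path is by then a path of `Z`, so meeting
  -- it is meeting `Z`; otherwise it is still `b`, and the hypothesis applies.
  · by_cases hm : ∃ s ≤ r, Meets b Z s
    · obtain ⟨s, hs, hm⟩ := hm
      rcases fol_cases hb hZ with ⟨h1, h2⟩ | ⟨s', z, hz, e', hs', h1, h2⟩
      · exact absurd hm (h1 s)
      · have : s' ≤ r := (not_lt.1 fun h => hs' s h hm).trans hs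
        rw [h2 r this] at e
        exact ⟨r, le_rfl, z, hz, e⟩
    · push Not at hm
      rw [fol_of_not_meets hm] at e
      obtain ⟨r', hr', hm' | hm'⟩ := h r e
      · exact ⟨r', hr', hm'⟩
      · exact absurd hm' (hm r' hr')
  · exact ⟨r, le_rfl, z, hz, e⟩

theorem swap_of_late {a b : ℝ≥0 → E} {Z : Set (ℝ≥0 → E)} (ha : IsRC a) (hb : IsRC b)
    (hZ : IsCoalescingFamily Z)
    (h : ∀ T, a T = b T → ∃ r ≤ T, Meets a Z r ∨ Meets b Z r) :
    insert (fol b (insert (fol a Z) Z)) (insert (fol a Z) Z) =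
      insert (fol a (insert (fol b Z) Z)) (insert (fol b Z) Z) := by
  rw [fol_insert_of_late ha hb hZ h, fol_insert_of_late hb ha hZ
    (fun T e => (h T e.symm).imp fun r hr => hr.imp_right Or.symm), Set.insert_comm]

/-- If two free paths meet before they meet `Z`, exchanging their order amounts to exchanging them
from their first meeting on. -/
theorem swap_of_early {a b a' b' : ℝ≥0 → E} {Z : Set (ℝ≥0 → E)} {T : ℝ≥0} (ha : IsRC a)
    (hb' : IsRC b') (hZ : IsCoalescingFamily Z)
    (e : a T = b T) (hT : ∀ r < T, a r ≠ b r) (haZ : ∀ r ≤ T, ¬ Meets a Z r)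
    (hbZ : ∀ r ≤ T, ¬ Meets b Z r) (ha1 : ∀ t < T, a' t = a t) (ha2 : ∀ t, T ≤ t → a' t = b t)
    (hb1 : ∀ t < T, b' t = b t) (hb2 : ∀ t, T ≤ t → b' t = a t) :
    insert (fol b (insert (fol a Z) Z)) (insert (fol a Z) Z) =
      insert (fol a' (insert (fol b' Z) Z)) (insert (fol b' Z) Z) := by
  have hb'Z : ∀ r < T, ¬ Meets b' Z r := fun r hr ⟨z, hz, e⟩ =>
    hbZ r hr.le ⟨z, hz, (hb1 r hr).symm.trans e⟩
  have h1 : ∀ t < T, fol b' Z t = b t := fun t ht => by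
    rw [fol_of_not_meets fun r hr => hb'Z r (hr.trans_lt ht), hb1 t ht]
  have h2 : ∀ t, T ≤ t → fol b' Z t = fol a Z t := fun t ht =>
    fol_tail_congr hb' hZ hb2 hb'Z (fun r hr => haZ r hr.le) ht
  have h3 : ∀ t ≤ T, fol a Z t = a t := fun t ht =>
    fol_of_not_meets fun r hr => haZ r (hr.trans ht)
  have hW := (hZ.insert_fol ha).coalescing
  have hW' := (hZ.insert_fol hb').coalescing
  have hm : ∀ r < T, ¬ Meets b (insert (fol a Z) Z) r := by
    rintro r hr ⟨z, rfl | hz, e⟩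
    · rw [h3 r hr.le] at e
      exact hT r hr e.symm
    · exact hbZ r hr.le ⟨z, hz, e⟩
  have hm' : ∀ r < T, ¬ Meets a' (insert (fol b' Z) Z) r := by
    rintro r hr ⟨z, rfl | hz, e⟩
    · rw [h1 r hr, ha1 r hr] at e
      exact hT r hr e
    · exact haZ r hr.le ⟨z, hz, (ha1 r hr).symm.trans e⟩
  -- Both orders produce the same two paths: `fol a Z`, and the path that is `b` before `T` and `fol
  -- a Z` afterwards. The path of the later particle in one order is that of the earlier particle in
  -- the other.
  have h4 : fol b (insert (fol a Z) Z) = fol b' Z := by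
    funext t
    rcases lt_or_ge t T with ht | ht
    · rw [h1 t ht, fol_of_not_meets fun r hr => hm r (hr.trans_lt ht)]
    · rw [h2 t ht, fol_of_meets hW (Set.mem_insert _ _) ((h3 T le_rfl).trans e).symm hm ht]
  have h5 : fol a' (insert (fol b' Z) Z) = fol a Z := by
    funext t
    rcases lt_or_ge t T with ht | ht
    · rw [h3 t ht.le, fol_of_not_meets fun r hr => hm' r (hr.trans_lt ht), ha1 t ht]
    · rw [fol_of_meets hW' (Set.mem_insert _ _) (s := T) _ hm' ht, h2 t ht]
      rw [ha2 T le_rfl, h2 T le_rfl, h3 T le_rfl, e]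
  rw [h4, h5, Set.insert_comm]

/-! ### Restarting at a fixed time -/

theorem shift_image_insert_fol_of_meets {x : ℝ≥0 → E} {Z : Set (ℝ≥0 → E)} {S : ℝ≥0}
    (hx : IsRC x) (hZ : IsCoalescingFamily Z) (h : ∃ s ≤ S, Meets x Z s) :
    (fun (z : ℝ≥0 → E) t => z (S + t)) '' insert (fol x Z) Z =
      (fun (z : ℝ≥0 → E) t => z (S + t)) '' Z := by
  refine subset_antisymm ?_ (Set.image_mono (Set.subset_insert _ _))
  rw [Set.image_insert_eq, Set.insert_subset_iff]
  refine ⟨?_, subset_rfl⟩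
  obtain ⟨s, hs, hm⟩ := h
  rcases fol_cases hx hZ with ⟨h1, h2⟩ | ⟨s', z, hz, e', hs', h1, h2⟩
  · exact absurd hm (h1 s)
  · have : s' ≤ S := (not_lt.1 fun h => hs' s h hm).trans hs
    exact ⟨z, hz, funext fun t => (h2 _ (this.trans le_self_add)).symm⟩

theorem shift_fol_of_not_meets {x : ℝ≥0 → E} {Z : Set (ℝ≥0 → E)} {S : ℝ≥0}
    (hx : IsRC x) (hZ : IsCoalescingFamily Z) (h : ∀ s ≤ S, ¬ Meets x Z s) :
    (fun t => fol x Z (S + t)) =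
      fol (fun t => x (S + t)) ((fun (z : ℝ≥0 → E) t => z (S + t)) '' Z) := by
  have hm : ∀ r, Meets (fun t => x (S + t)) ((fun (z : ℝ≥0 → E) t => z (S + t)) '' Z) r →
      Meets x Z (S + r) := by
    rintro r ⟨-, ⟨z, hz, rfl⟩, e⟩
    exact ⟨z, hz, e⟩
  have hc : IsCoalescing ((fun (z : ℝ≥0 → E) t => z (S + t)) '' Z) := by
    rintro - ⟨z, hz, rfl⟩ - ⟨z', hz', rfl⟩ s t e hst
    exact hZ.coalescing z hz z' hz' _ _ e (add_le_add_right hst S)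
  funext t
  rcases fol_cases hx hZ with ⟨h1, h2⟩ | ⟨s', z, hz, e', hs', h1, h2⟩
  · rw [h2]
    exact (fol_of_not_meets fun r _ hr => h1 _ (hm r hr)).symm
  · have hSs : S ≤ s' := not_lt.1 fun hlt => h s' hlt.le ⟨z, hz, e'⟩
    obtain ⟨s, rfl⟩ := exists_add_of_le hSs
    rcases lt_or_ge t s with ht | ht
    · rw [h1 _ (by gcongr)]
      exact (fol_of_not_meets fun r hr hr' =>
        hs' (S + r) (by gcongr; exact hr.trans_lt ht) (hm r hr')).symm
    · rw [h2 _ (by gcongr)]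
      exact (fol_of_meets (z := fun t => z (S + t)) hc ⟨z, hz, rfl⟩ e'
        (fun r hr hr' => hs' _ (by gcongr) (hm r hr')) ht).symm

/-- A particle absorbed by time `S` duplicates another path from then on and can be dropped. A
surviving one has met nothing up to and including `S`, so it obeys the same rule with shifted paths.
The strong Markov property of free particles reaches the coalescing ones through this identity. -/
theorem shift_image_coalSet {ι : Type*} {x : ι → ℝ≥0 → E} (hx : ∀ i, IsRC (x i)) (S : ℝ≥0)
    (l : List ι) :
    (fun (z : ℝ≥0 → E) t => z (S + t)) '' coalSet (l.map x) =
      coalSet ((alive x S l).map fun i t => x i (S + t)) := by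
  induction l with
  | nil => simp [coalSet, alive]
  | cons a l ih =>
    have hl : IsCoalescingFamily (coalSet (l.map x)) := isCoalescingFamily_coalSet fun y hy => by
      obtain ⟨i, -, rfl⟩ := List.mem_map.1 hy
      exact hx i
    rw [List.map_cons, coalSet, alive]
    split_ifs with h
    · rw [shift_image_insert_fol_of_meets (hx a) hl h, ih]
    · push Not at h
      rw [Set.image_insert_eq, shift_fol_of_not_meets (hx a) hl h, ih]
      rfl

/-! ### Continuity -/

/-- At the joining time the two pieces take the same value, so no jump is created. This transfers
quasi-left-continuity from free to coalescing paths. -/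
theorem continuousAt_fol {x : ℝ≥0 → E} {Z : Set (ℝ≥0 → E)} {T : ℝ≥0} (hx : IsRC x)
    (hZ : IsCoalescingFamily Z) (hxT : ContinuousAt x T) (hZT : ∀ z ∈ Z, ContinuousAt z T) :
    ContinuousAt (fol x Z) T := by
  rcases fol_cases hx hZ with ⟨h1, h2⟩ | ⟨s, z, hz, e, hs, h1, h2⟩
  · rwa [h2]
  · rcases lt_trichotomy T s with h | h | h
    · refine hxT.congr ?_
      filter_upwards [Iio_mem_nhds h] with u hu using (h1 u hu).symm
    · subst h
      rw [← continuousWithinAt_univ, ← Set.Iio_union_Ici (a := T), continuousWithinAt_union]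
      constructor
      · refine (hxT.continuousWithinAt).congr (fun u hu => h1 u hu) ?_
        rw [h2 T le_rfl, e]
      · exact ((hZT z hz).continuousWithinAt).congr (fun u hu => h2 u hu) (h2 T le_rfl)
    · refine (hZT z hz).congr ?_
      filter_upwards [Ioi_mem_nhds h] with u hu using (h2 u (le_of_lt hu)).symm

theorem continuousAt_of_mem_coalSet {l : List (ℝ≥0 → E)} {T : ℝ≥0} (hl : ∀ x ∈ l, IsRC x)
    (hT : ∀ x ∈ l, ContinuousAt x T) : ∀ z ∈ coalSet l, ContinuousAt z T := by
  induction l with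
  | nil => exact fun _ h => h.elim
  | cons x l ih =>
    have hl' : ∀ y ∈ l, IsRC y := fun y hy => hl y (List.mem_cons_of_mem _ hy)
    have ih' := ih hl' fun y hy => hT y (List.mem_cons_of_mem _ hy)
    rintro z (rfl | hz)
    · exact continuousAt_fol (hl x List.mem_cons_self) (isCoalescingFamily_coalSet hl')
        (hT x List.mem_cons_self) ih'
    · exact ih' z hz

/-! ### The collision rule -/

/-- The infimum in `collisionTime` is attained, and among coalescing paths the rule of the least
index selects the same future as any other choice. -/
theorem follow_eq_fol {ι : Type*} [LinearOrder ι] [WellFoundedLT ι] {x : ℝ≥0 → E}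
    {ζ : ι → ℝ≥0 → E} (hx : IsRC x) (hζ : IsCoalescingFamily (Set.range ζ)) :
    follow x ζ = fol x (Set.range ζ) := by
  have hM : {t : ℝ≥0 | ∃ j, x t = ζ j t} = {t | Meets x (Set.range ζ) t} := by
    ext t
    simp [Meets]
  funext t
  rcases fol_cases hx hζ with ⟨h1, h2⟩ | ⟨s, z, hz, e, hs, h1, h2⟩
  · have hc : collisionTime x ζ = ⊤ := by
      rw [collisionTime, hM]
      simp [h1]
    rw [h2]
    refine dif_neg ?_
    rw [hc]
    simp
  · have hc : collisionTime x ζ = s := by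
      rw [collisionTime, hM]
      refine le_antisymm (iInf₂_le s ⟨z, hz, e⟩) (le_iInf₂ fun r hr => ?_)
      exact_mod_cast not_lt.1 fun h => hs r h hr
    have hJ : ∃ J, IsLeast {j | x (collisionTime x ζ).toNNReal =
        ζ j (collisionTime x ζ).toNNReal} J := by
      obtain ⟨j, rfl⟩ := hz
      have hne : {j | x (collisionTime x ζ).toNNReal =
        ζ j (collisionTime x ζ).toNNReal}.Nonempty := ⟨j, by simpa [hc] using e⟩
      exact ⟨_, WellFounded.min_mem wellFounded_lt _ hne,
        fun k hk => WellFounded.min_le wellFounded_lt hk⟩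
    rcases lt_or_ge t s with ht | ht
    · rw [h1 t ht]
      refine dif_neg ?_
      rw [hc]
      rintro ⟨h, -⟩
      exact absurd (by exact_mod_cast h) (not_le.2 ht)
    · have h : collisionTime x ζ ≤ t ∧ ∃ J, IsLeast {j | x (collisionTime x ζ).toNNReal =
        ζ j (collisionTime x ζ).toNNReal} J := ⟨by rw [hc]; exact_mod_cast ht, hJ⟩
      have h3 : follow x ζ t = ζ h.2.choose t := dif_pos h
      have h4 : x s = ζ h.2.choose s := by simpa [hc] using h.2.choose_spec.1
      rw [h3]
      exact (fol_of_meets hζ.coalescing ⟨_, rfl⟩ h4 hs ht).symm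

/-- The particles `0, …, n - 1` of the index set `[N]`, the last one first. -/
def idxBelow (N : ℕ∞) : ℕ → List (Idx N)
  | 0 => []
  | n + 1 => open Classical in if h : (n : ℕ∞) < N then ⟨n, h⟩ :: idxBelow N n else idxBelow N n

theorem mem_idxBelow {N : ℕ∞} {n : ℕ} {i : Idx N} : i ∈ idxBelow N n ↔ i.1 < n := by
  induction n with
  | zero => simp [idxBelow]
  | succ n ih =>
    rw [idxBelow]
    split_ifs with h
    · rw [List.mem_cons, ih, Nat.lt_succ_iff_lt_or_eq, or_comm, Subtype.ext_iff]
    · rw [ih]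
      constructor
      · exact fun h => h.trans (Nat.lt_succ_self n)
      · intro hi
        refine lt_of_le_of_ne (Nat.lt_succ_iff.1 hi) ?_
        rintro rfl
        exact h i.2

theorem nodup_idxBelow (N : ℕ∞) (n : ℕ) : (idxBelow N n).Nodup := by
  induction n with
  | zero => simp [idxBelow]
  | succ n ih =>
    rw [idxBelow]
    split_ifs with h
    · refine List.nodup_cons.2 ⟨fun hm => ?_, ih⟩
      exact lt_irrefl _ (mem_idxBelow.1 hm)
    · exact ih

theorem coalesce_eq_fol_of {N : ℕ∞} {ξ : Idx N → ℝ≥0 → E} (hξ : ∀ i, IsRC (ξ i)) {n : ℕ}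
    (h : (n : ℕ∞) < N)
    (ih : coalSet ((idxBelow N n).map ξ) = {z | ∃ i : Idx N, i.1 < n ∧ z = coalesce ξ i}) :
    coalesce ξ ⟨n, h⟩ = fol (ξ ⟨n, h⟩) (coalSet ((idxBelow N n).map ξ)) := by
  have hr : Set.range (fun j : {j : Idx N // j < ⟨n, h⟩} => coalesce ξ j.1) =
      coalSet ((idxBelow N n).map ξ) := by
    rw [ih]
    ext z
    constructor
    · rintro ⟨j, rfl⟩
      exact ⟨j.1, j.2, rfl⟩
    · rintro ⟨i, hi, rfl⟩
      exact ⟨⟨i, hi⟩, rfl⟩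
  have hg : IsCoalescingFamily (coalSet ((idxBelow N n).map ξ)) :=
    isCoalescingFamily_coalSet fun y hy => by
      obtain ⟨i, -, rfl⟩ := List.mem_map.1 hy
      exact hξ i
  rw [coalesce, ← hr]
  exact follow_eq_fol (hξ _) (by rwa [hr])

theorem coalSet_idxBelow {N : ℕ∞} {ξ : Idx N → ℝ≥0 → E} (hξ : ∀ i, IsRC (ξ i)) (n : ℕ) :
    coalSet ((idxBelow N n).map ξ) = {z | ∃ i : Idx N, i.1 < n ∧ z = coalesce ξ i} := by
  induction n with
  | zero => simp [idxBelow, coalSet]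
  | succ n ih =>
    rw [idxBelow]
    split_ifs with h
    · have h1 := coalesce_eq_fol_of hξ h ih
      rw [List.map_cons, coalSet, ← h1, ih]
      ext z
      constructor
      · rintro (rfl | ⟨i, hi, rfl⟩)
        · exact ⟨⟨n, h⟩, Nat.lt_succ_self n, rfl⟩
        · exact ⟨i, hi.trans (Nat.lt_succ_self n), rfl⟩
      · rintro ⟨i, hi, rfl⟩
        rcases Nat.lt_succ_iff_lt_or_eq.1 hi with hi | hi
        · exact Or.inr ⟨i, hi, rfl⟩
        · left
          congr
          exact Subtype.ext hi
    · rw [ih]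
      ext z
      refine exists_congr fun i => and_congr_left fun _ => ?_
      constructor
      · exact fun h => h.trans (Nat.lt_succ_self n)
      · intro hi
        refine lt_of_le_of_ne (Nat.lt_succ_iff.1 hi) ?_
        rintro rfl
        exact h i.2

theorem coalesce_eq_fol {N : ℕ∞} {ξ : Idx N → ℝ≥0 → E} (hξ : ∀ i, IsRC (ξ i)) (i : Idx N) :
    coalesce ξ i = fol (ξ i) (coalSet ((idxBelow N i.1).map ξ)) :=
  coalesce_eq_fol_of hξ i.2 (coalSet_idxBelow hξ i.1)

end Pathwise

/-! ### The σ-algebra on closed sets in terms of hitting open sets -/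

section HitSets

variable {E : Type*} [TopologicalSpace E]

/-- The complements of a compact exhaustion form a countable neighbourhood base at infinity. -/
theorem secondCountableTopology_onePoint [LocallyCompactSpace E] [SecondCountableTopology E]
    [T2Space E] : SecondCountableTopology (OnePoint E) := by
  set K : ℕ → Set E := fun n => CompactExhaustion.choice E n with hK
  have hKc : ∀ n, IsCompact (K n) := fun n => (CompactExhaustion.choice E).isCompact n
  set B : Set (Set (OnePoint E)) :=
    (fun b : Set E => ((↑) : E → OnePoint E) '' b) '' countableBasis E ∪
      Set.range fun n => (((↑) : E → OnePoint E) '' (K n))ᶜ with hB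
  have hBc : B.Countable := ((countable_countableBasis E).image _).union (Set.countable_range _)
  refine IsTopologicalBasis.secondCountableTopology (b := B)
    (isTopologicalBasis_of_isOpen_of_nhds ?_ ?_) hBc
  · rintro u (⟨b, hb, rfl⟩ | ⟨n, rfl⟩)
    · exact OnePoint.isOpenEmbedding_coe.isOpenMap _ (isOpen_of_mem_countableBasis hb)
    · exact OnePoint.isOpen_compl_image_coe.2 ⟨(hKc n).isClosed, hKc n⟩
  · intro a u ha hu
    induction a using OnePoint.rec with
    | infty =>
      obtain ⟨hcl, hc⟩ := (OnePoint.isOpen_iff_of_mem ha).1 hu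
      obtain ⟨n, hn⟩ := (CompactExhaustion.choice E).exists_superset_of_isCompact hc
      refine ⟨_, Or.inr ⟨n, rfl⟩, by simp, ?_⟩
      intro y hy
      induction y using OnePoint.rec with
      | infty => exact ha
      | coe y =>
        by_contra hyu
        exact hy ⟨y, hn (by simpa using hyu), rfl⟩
    | coe x =>
      obtain ⟨b, hb, hxb, hbu⟩ := (isBasis_countableBasis E).exists_subset_of_mem_open
        (show x ∈ ((↑) : E → OnePoint E) ⁻¹' u from ha) (hu.preimage OnePoint.continuous_coe)
      exact ⟨_, Or.inl ⟨b, hb, rfl⟩, ⟨x, hxb, rfl⟩, Set.image_subset_iff.2 hbu⟩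

/-- `E` is an open subset of its one-point compactification, which is compact and metrizable. -/
theorem polishSpace_of_locallyCompact [LocallyCompactSpace E] [SecondCountableTopology E]
    [T2Space E] : PolishSpace E := by
  have := secondCountableTopology_onePoint (E := E)
  let : MetricSpace (OnePoint E) := metrizableSpaceMetric _
  have : PolishSpace (OnePoint E) := inferInstance
  have h : PolishSpace (Set.range ((↑) : E → OnePoint E)) :=
    OnePoint.isOpenEmbedding_coe.isOpen_range.polishSpace
  exact (OnePoint.isOpenEmbedding_coe.isEmbedding.toHomeomorph).isClosedEmbedding.polishSpace

/-- The event that a closed set hits `U`. -/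
def hitSet (U : Set E) : Set (ClosedSubset E) := {A | (A.1 ∩ U).Nonempty}

/-- An open set meets a closure exactly if it meets the set itself, so the point at infinity needs
no events of its own. -/
theorem coe_compactify_inter_nonempty {A : ClosedSubset E} {V : Set (OnePoint E)}
    (hV : IsOpen V) : ((A.compactify : Set (OnePoint E)) ∩ V).Nonempty ↔
      A ∈ hitSet (((↑) : E → OnePoint E) ⁻¹' V) := by
  change (closure (((↑) : E → OnePoint E) '' A.1) ∩ V).Nonempty ↔
    (A.1 ∩ (((↑) : E → OnePoint E) ⁻¹' V)).Nonempty
  rw [Set.inter_comm, closure_inter_open_nonempty_iff' hV]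
  constructor
  · rintro ⟨-, hv, a, ha, rfl⟩
    exact ⟨a, ha, hv⟩
  · rintro ⟨a, ha, hv⟩
    exact ⟨a, hv, a, ha, rfl⟩
where
  closure_inter_open_nonempty_iff' {s V : Set (OnePoint E)} (hV : IsOpen V) :
      (V ∩ closure s).Nonempty ↔ (V ∩ s).Nonempty := by
    rw [Set.inter_comm V, Set.inter_comm V]
    exact closure_inter_open_nonempty_iff hV

theorem secondCountableTopology_closedSubset [LocallyCompactSpace E] [SecondCountableTopology E]
    [T2Space E] : SecondCountableTopology (ClosedSubset E) := by
  have := secondCountableTopology_onePoint (E := E)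
  exact secondCountableTopology_induced _ _ ClosedSubset.compactify

theorem isOpen_hitSet {U : Set E} (hU : IsOpen U) : IsOpen (hitSet U) := by
  refine ⟨_, NonemptyCompacts.isOpen_inter_nonempty_of_isOpen
    (OnePoint.isOpenEmbedding_coe.isOpenMap _ hU), ?_⟩
  ext A
  refine (coe_compactify_inter_nonempty (OnePoint.isOpenEmbedding_coe.isOpenMap _ hU)).trans ?_
  rw [Set.preimage_image_eq _ OnePoint.coe_injective]

theorem measurableSet_hitSet {U : Set E} (hU : IsOpen U) : MeasurableSet (hitSet U) :=
  MeasurableSpace.measurableSet_generateFrom (isOpen_hitSet hU)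

theorem measurableSpace_closedSubset [LocallyCompactSpace E] [SecondCountableTopology E]
    [T2Space E] : (instMeasurableSpaceClosedSubset : MeasurableSpace (ClosedSubset E)) =
      MeasurableSpace.generateFrom {s | ∃ U : Set E, IsOpen U ∧ s = hitSet U} := by
  have := secondCountableTopology_onePoint (E := E)
  have := secondCountableTopology_closedSubset (E := E)
  refine le_antisymm ?_ (MeasurableSpace.generateFrom_le ?_)
  · change borel (ClosedSubset E) ≤ _
    have ht : (inferInstance : TopologicalSpace (ClosedSubset E)) = .generateFrom
        (Set.preimage (fun A : ClosedSubset E => (A.compactify : Set (OnePoint E))) ''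
          (Set.powerset '' {U | IsOpen U} ∪
            (fun V => {s : Set (OnePoint E) | (s ∩ V).Nonempty}) '' {V | IsOpen V})) := by
      rw [← induced_generateFrom_eq]
      change TopologicalSpace.induced _ (TopologicalSpace.induced _ _) = _
      rw [induced_compose]
      rfl
    rw [borel_eq_generateFrom_of_subbasis ht]
    set m := MeasurableSpace.generateFrom {s | ∃ U : Set E, IsOpen U ∧ s = hitSet U} with hm
    have hit : ∀ V : Set (OnePoint E), IsOpen V → MeasurableSet[m]
        {A : ClosedSubset E | ((A.compactify : Set (OnePoint E)) ∩ V).Nonempty} := by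
      intro V hV
      simp_rw [coe_compactify_inter_nonempty hV]
      exact MeasurableSpace.measurableSet_generateFrom
        ⟨_, hV.preimage OnePoint.continuous_coe, rfl⟩
    refine MeasurableSpace.generateFrom_le ?_
    rintro - ⟨-, ⟨U, hU, rfl⟩ | ⟨V, hV, rfl⟩, rfl⟩
    · have hU : IsOpen U := hU
      set 𝒱 : Set (Set (Set (OnePoint E))) := {v | v ⊆ countableBasis (OnePoint E) ∧ v.Finite}
      have h𝒱 : 𝒱.Countable :=
        (Set.countable_ofPred_finite_subset (countable_countableBasis (OnePoint E))).mono
          (by rintro v ⟨h1, h2⟩; exact ⟨h2, h1⟩)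
      -- A compact set is inside `U` exactly if it misses some finite union of basic open sets that
      -- covers the compact set `Uᶜ`. There are countably many such unions, so containment is
      -- expressed by countably many hits.
      have heq : (fun A : ClosedSubset E => (A.compactify : Set (OnePoint E))) ⁻¹' U.powerset =
          ⋃ v ∈ {v ∈ 𝒱 | Uᶜ ⊆ ⋃₀ v},
            {A : ClosedSubset E | ((A.compactify : Set (OnePoint E)) ∩ ⋃₀ v).Nonempty}ᶜ := by
        ext A
        simp only [Set.mem_preimage, Set.mem_powerset_iff, Set.mem_iUnion, exists_prop]
        constructor
        · intro hA
          obtain ⟨P, W, hP, hW, hAP, hUW, hPW⟩ := SeparatedNhds.of_isCompact_isCompact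
            A.compactify.isCompact hU.isClosed_compl.isCompact
            (Set.disjoint_compl_right_iff_subset.2 hA)
          obtain ⟨v, hv, hWv⟩ :=
            (isBasis_countableBasis (OnePoint E)).open_eq_sUnion hW
          obtain ⟨v', hv', hfin, hc⟩ := hU.isClosed_compl.isCompact.elim_finite_subcover_image
            (b := v) (c := id) (fun s hs => isOpen_of_mem_countableBasis (hv hs))
            (by simpa only [id, ← Set.sUnion_eq_biUnion (s := v)] using hWv ▸ hUW)
          simp only [id, ← Set.sUnion_eq_biUnion (s := v')] at hc
          refine ⟨v', ⟨⟨hv'.trans hv, hfin⟩, hc⟩, ?_⟩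
          rintro ⟨y, hy, hyv⟩
          exact Set.disjoint_left.1 hPW (hAP hy) (hWv ▸ Set.sUnion_subset_sUnion hv' hyv)
        · rintro ⟨v, ⟨-, hv⟩, hA⟩ y hy
          by_contra hyU
          exact hA ⟨y, hy, hv hyU⟩
      rw [heq]
      refine MeasurableSet.biUnion (h𝒱.mono fun v hv => hv.1) fun v hv => (hit _ ?_).compl
      exact isOpen_sUnion fun s hs => isOpen_of_mem_countableBasis (hv.1.1 hs)
    · exact hit V hV
  · rintro - ⟨U, hU, rfl⟩
    exact measurableSet_hitSet hU

theorem measurable_closedSubset_of_hitSet [LocallyCompactSpace E] [SecondCountableTopology E]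
    [T2Space E] {Ω : Type*} {m : MeasurableSpace Ω} {f : Ω → ClosedSubset E}
    (h : ∀ U, IsOpen U → MeasurableSet (f ⁻¹' hitSet U)) : Measurable f := by
  rw [measurableSpace_closedSubset]
  refine measurable_generateFrom ?_
  rintro - ⟨U, hU, rfl⟩
  exact h U hU

theorem countablySeparated_closedSubset [LocallyCompactSpace E] [SecondCountableTopology E]
    [T2Space E] : MeasurableSpace.CountablySeparated (ClosedSubset E) := by
  refine ⟨⟨{s | ∃ b ∈ countableBasis E, s = hitSet b}, ?_, ?_, ?_⟩⟩
  · have : {s | ∃ b ∈ countableBasis E, s = hitSet b} = hitSet '' countableBasis E := by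
      ext s
      simp [eq_comm]
    rw [this]
    exact (countable_countableBasis E).image _
  · rintro - ⟨b, hb, rfl⟩
    exact measurableSet_hitSet (isOpen_of_mem_countableBasis hb)
  · intro A _ A' _ h
    have key : ∀ A A' : ClosedSubset E, (∀ s ∈ {s | ∃ b ∈ countableBasis E, s = hitSet b},
        A ∈ s ↔ A' ∈ s) → A.1 ⊆ A'.1 := by
      intro A A' h x hx
      by_contra hxA
      obtain ⟨b, hb, hxb, hbA⟩ := (isBasis_countableBasis E).exists_subset_of_mem_open
        (show x ∈ A'.1ᶜ from hxA) A'.2.1.isOpen_compl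
      obtain ⟨y, hy, hyb⟩ := (h _ ⟨b, hb, rfl⟩).1 ⟨x, hx, hxb⟩
      exact hbA hyb hy
    exact Subtype.ext (subset_antisymm (key A A' h) (key A' A fun s hs => (h s hs).symm))

theorem closureRange_mem_hitSet {N : ℕ∞} [NeZero N] {x : Idx N → E} {U : Set E}
    (hU : IsOpen U) : closureRange x ∈ hitSet U ↔ ∃ i, x i ∈ U := by
  refine (closure_inter_open_nonempty_iff hU).trans ?_
  constructor
  · rintro ⟨-, ⟨i, rfl⟩, hi⟩
    exact ⟨i, hi⟩
  · rintro ⟨i, hi⟩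
    exact ⟨_, ⟨i, rfl⟩, hi⟩

theorem measurable_closureRange [LocallyCompactSpace E] [SecondCountableTopology E]
    [T2Space E] [MeasurableSpace E] [OpensMeasurableSpace E] {N : ℕ∞} [NeZero N] {Ω : Type*}
    {m : MeasurableSpace Ω} {Z : Idx N → Ω → E} (hZ : ∀ i, Measurable (Z i)) :
    Measurable fun ω => closureRange fun i => Z i ω := by
  refine measurable_closedSubset_of_hitSet fun U hU => ?_
  have : (fun ω => closureRange fun i => Z i ω) ⁻¹' hitSet U = ⋃ i, Z i ⁻¹' U := by
    ext ω
    simp [closureRange_mem_hitSet hU]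
  rw [this]
  exact MeasurableSet.iUnion fun i => hZ i hU.measurableSet

/-- A finite list of pairs of a time and an open set. -/
abbrev IsOpenList (H : List (ℝ≥0 × Set E)) : Prop := ∀ p ∈ H, IsOpen p.2

/-- The event that a set-valued path hits all the given sets at the given times. -/
def hitEvent (H : List (ℝ≥0 × Set E)) : Set (ℝ≥0 → ClosedSubset E) :=
  {η | ∀ p ∈ H, η p.1 ∈ hitSet p.2}

theorem measurableSet_hitEvent {H : List (ℝ≥0 × Set E)} (hH : IsOpenList H) :
    MeasurableSet (hitEvent H) := by
  have : hitEvent H = ⋂ p ∈ H, (fun η : ℝ≥0 → ClosedSubset E => η p.1) ⁻¹' hitSet p.2 := by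
    ext η
    simp [hitEvent]
  rw [this]
  exact MeasurableSet.biInter (List.finite_toSet H).countable fun p hp =>
    measurable_pi_apply p.1 (measurableSet_hitSet (hH p hp))

/-- Concatenating lists intersects their hit events, so these form a π-system; lists of length one
already generate the σ-algebra. -/
theorem measure_ext_of_hitEvent [LocallyCompactSpace E] [SecondCountableTopology E]
    [T2Space E] {μ ν : Measure (ℝ≥0 → ClosedSubset E)} [IsFiniteMeasure μ]
    (h : ∀ H : List (ℝ≥0 × Set E), IsOpenList H → μ (hitEvent H) = ν (hitEvent H)) : μ = ν := by
  refine MeasureTheory.ext_of_generate_finite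
    {s | ∃ H : List (ℝ≥0 × Set E), IsOpenList H ∧ s = hitEvent H} ?_ ?_ ?_ ?_
  · refine le_antisymm ?_ (MeasurableSpace.generateFrom_le ?_)
    · change (⨆ t : ℝ≥0, MeasurableSpace.comap (fun η : ℝ≥0 → ClosedSubset E => η t) _) ≤ _
      refine iSup_le fun t => ?_
      rw [measurableSpace_closedSubset, MeasurableSpace.comap_generateFrom]
      refine MeasurableSpace.generateFrom_le ?_
      rintro - ⟨-, ⟨U, hU, rfl⟩, rfl⟩
      refine MeasurableSpace.measurableSet_generateFrom ⟨[(t, U)], by simpa using hU, ?_⟩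
      ext η
      simp [hitEvent]
    · rintro - ⟨H, hH, rfl⟩
      exact measurableSet_hitEvent hH
  · rintro - ⟨H, hH, rfl⟩ - ⟨H', hH', rfl⟩ -
    refine ⟨H ++ H', ?_, ?_⟩
    · intro p hp
      rcases List.mem_append.1 hp with hp | hp
      · exact hH p hp
      · exact hH' p hp
    · ext η
      simp [hitEvent, or_imp, forall_and]
  · rintro - ⟨H, hH, rfl⟩
    exact h H hH
  · have := h [] (by simp)
    simpa [hitEvent] using this

end HitSets

/-! ### The Markov property of one particle on path space -/

section OneParticle

variable {E : Type*} [TopologicalSpace E] [LocallyCompactSpace E] [SecondCountableTopology E]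
  [T2Space E]

/-- An open subset is σ-compact; the functions are one on an increasing sequence of compacts that
covers `U`, and zero off `U`. -/
theorem exists_zeroAtInfty_tendsto_indicator {U : Set E} (hU : IsOpen U) :
    ∃ f : ℕ → C₀(E, ℝ), (∀ n x, f n x ∈ Set.Icc (0 : ℝ) 1) ∧
      ∀ x, Tendsto (fun n => ENNReal.ofReal (f n x)) atTop (𝓝 (U.indicator 1 x)) := by
  have : LocallyCompactSpace U := hU.locallyCompactSpace
  set K : ℕ → Set E := fun n => ((↑) : U → E) '' compactCovering U n with hK
  have hKc : ∀ n, IsCompact (K n) := fun n =>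
    (isCompact_compactCovering U n).image continuous_subtype_val
  have hKU : ∀ n, K n ⊆ U := by
    rintro n - ⟨x, -, rfl⟩
    exact x.2
  choose f h1 h0 hc hf using fun n => exists_continuous_one_zero_of_isCompact (hKc n)
    hU.isClosed_compl (Set.disjoint_compl_right_iff_subset.2 (hKU n))
  refine ⟨fun n => ⟨f n, (hc n).is_zero_at_infty⟩, fun n x => hf n x, fun x => ?_⟩
  by_cases hx : x ∈ U
  · obtain ⟨n, hn⟩ := exists_mem_compactCovering (⟨x, hx⟩ : U)
    refine tendsto_const_nhds.congr' ?_
    filter_upwards [eventually_ge_atTop n] with k hk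
    have : f k x = 1 := h1 k ⟨⟨x, hx⟩, compactCovering_subset U hk hn, rfl⟩
    change _ = ENNReal.ofReal (f k x)
    simp [hx, this]
  · refine tendsto_const_nhds.congr fun n => ?_
    have : f n x = 0 := h0 n hx
    change _ = ENNReal.ofReal (f n x)
    simp [hx, this]

variable [MeasurableSpace E] [BorelSpace E]

/-- Finite measures on a space whose `σ`-algebra is generated by maps to `E` agree if they agree on
all finite products of functions in `C₀(E)` of these maps. -/
theorem measure_ext_of_zeroAtInfty {Z α : Type*} [mZ : MeasurableSpace Z] (y : α → Z → E)
    (hZ : mZ = ⨆ a, MeasurableSpace.comap (y a) inferInstance) {μ ν : Measure Z}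
    [IsFiniteMeasure μ]
    (h : ∀ (J : Finset α) (f : α → C₀(E, ℝ)), (∀ a x, f a x ∈ Set.Icc (0 : ℝ) 1) →
      ∫⁻ z, ∏ a ∈ J, ENNReal.ofReal (f a (y a z)) ∂μ =
        ∫⁻ z, ∏ a ∈ J, ENNReal.ofReal (f a (y a z)) ∂ν) : μ = ν := by
  classical
  have hy : ∀ a, Measurable (y a) := fun a => by
    rw [hZ]
    exact Measurable.mono (comap_measurable _)
      (le_iSup (fun a => MeasurableSpace.comap (y a) inferInstance) a) le_rfl
  have huniv : μ Set.univ = ν Set.univ := by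
    simpa using h ∅ 0 (by simp)
  have : IsFiniteMeasure ν := ⟨huniv ▸ measure_lt_top μ _⟩
  have key : ∀ (J : Finset α) (U : α → Set E), (∀ a, IsOpen (U a)) →
      ∀ f : α → ℕ → C₀(E, ℝ), (∀ a n x, f a n x ∈ Set.Icc (0 : ℝ) 1) →
      (∀ a x, Tendsto (fun n => ENNReal.ofReal (f a n x)) atTop (𝓝 ((U a).indicator 1 x))) →
      ∀ ρ : Measure Z, IsFiniteMeasure ρ →
      Tendsto (fun n => ∫⁻ z, ∏ a ∈ J, ENNReal.ofReal (f a n (y a z)) ∂ρ) atTop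
        (𝓝 (ρ (⋂ a ∈ J, y a ⁻¹' U a))) := by
    intro J U hU f hf hlim ρ hρ
    have hm : MeasurableSet (⋂ a ∈ J, y a ⁻¹' U a) :=
      Finset.measurableSet_biInter J fun a _ => hy a (hU a).measurableSet
    rw [← lintegral_indicator_one hm]
    refine tendsto_lintegral_of_dominated_convergence 1 ?_ ?_ ?_ ?_
    · intro n
      exact Finset.measurable_fun_prod J fun a _ =>
        ENNReal.measurable_ofReal.comp ((f a n).continuous.measurable.comp (hy a))
    · intro n
      refine Eventually.of_forall fun z => ?_
      exact Finset.prod_le_one' fun a _ => ENNReal.ofReal_le_one.2 (hf a n _).2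
    · simp
    · refine Eventually.of_forall fun z => ?_
      have h1 := ENNReal.tendsto_finsetProd_of_ne_top J (fun a _ => hlim a (y a z))
        (fun a _ => by by_cases hz : y a z ∈ U a <;> simp [hz])
      convert h1 using 2
      rw [Set.indicator_apply]
      split_ifs with hz
      · symm
        refine Finset.prod_eq_one fun a ha => ?_
        have : y a z ∈ U a := by simpa using Set.mem_iInter₂.1 hz a ha
        simp [this]
      · obtain ⟨a, ha, hza⟩ : ∃ a ∈ J, y a z ∉ U a := by
          simpa using hz
        exact (Finset.prod_eq_zero ha (by simp [hza])).symm
  refine MeasureTheory.ext_of_generate_finite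
    {s | ∃ (J : Finset α) (U : α → Set E), (∀ a, IsOpen (U a)) ∧ s = ⋂ a ∈ J, y a ⁻¹' U a}
    ?_ ?_ ?_ huniv
  · refine le_antisymm ?_ (MeasurableSpace.generateFrom_le ?_)
    · rw [hZ]
      refine iSup_le fun a => ?_
      rw [BorelSpace.measurable_eq (α := E), borel, MeasurableSpace.comap_generateFrom]
      refine MeasurableSpace.generateFrom_le ?_
      rintro - ⟨U, hU, rfl⟩
      exact MeasurableSpace.measurableSet_generateFrom ⟨{a}, fun _ => U, fun _ => hU, by simp⟩
    · rintro - ⟨J, U, hU, rfl⟩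
      exact Finset.measurableSet_biInter J fun a _ => hy a (hU a).measurableSet
  · rintro - ⟨J, U, hU, rfl⟩ - ⟨J', U', hU', rfl⟩ -
    refine ⟨J ∪ J', fun a => (if a ∈ J then U a else Set.univ) ∩
      (if a ∈ J' then U' a else Set.univ), fun a => ?_, ?_⟩
    · refine IsOpen.inter ?_ ?_
      · split_ifs
        · exact hU a
        · exact isOpen_univ
      · split_ifs
        · exact hU' a
        · exact isOpen_univ
    · ext z
      simp only [Set.mem_inter_iff, Set.mem_iInter, Set.mem_preimage, Finset.mem_union]
      constructor
      · rintro ⟨h1, h2⟩ a -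
        constructor
        · split_ifs with ha
          · exact h1 a ha
          · trivial
        · split_ifs with ha
          · exact h2 a ha
          · trivial
      · intro h
        refine ⟨fun a ha => ?_, fun a ha => ?_⟩
        · simpa [ha] using (h a (Or.inl ha)).1
        · simpa [ha] using (h a (Or.inr ha)).2
  · rintro - ⟨J, U, hU, rfl⟩
    choose f hf hlim using fun a => exists_zeroAtInfty_tendsto_indicator (hU a)
    refine tendsto_nhds_unique (key J U hU f hf hlim μ inferInstance) ?_
    refine (key J U hU f hf hlim ν inferInstance).congr fun n => ?_
    exact (h J (fun a => f a n) fun a x => hf a n x).symm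

namespace FellerProcess

variable (X : FellerProcess E)

instance : IsMarkovKernel X.law := X.isMarkovKernel_law

instance (t : ℝ≥0) : IsMarkovKernel (X.semigroup t) := X.isFeller.markov t

theorem exists_semigroup_apply (t : ℝ≥0) {f : C₀(E, ℝ)} (hf : ∀ x, f x ∈ Set.Icc (0 : ℝ) 1) :
    ∃ g : C₀(E, ℝ), (∀ x, g x ∈ Set.Icc (0 : ℝ) 1) ∧
      ∀ x, ∫⁻ y, ENNReal.ofReal (f y) ∂(X.semigroup t x) = ENNReal.ofReal (g x) := by
  obtain ⟨g, hg⟩ := X.isFeller.map_zeroAtInfty t f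
  have hi : ∀ x, Integrable f (X.semigroup t x) := fun x =>
    Integrable.of_bound f.continuous.aestronglyMeasurable 1
      (Eventually.of_forall fun y => by rw [Real.norm_of_nonneg (hf y).1]; exact (hf y).2)
  refine ⟨g, fun x => ?_, fun x => ?_⟩
  · rw [hg]
    refine ⟨integral_nonneg fun y => (hf y).1, ?_⟩
    calc ∫ y, f y ∂(X.semigroup t x) ≤ ∫ y, 1 ∂(X.semigroup t x) :=
          integral_mono (hi x) (integrable_const _) fun y => (hf y).2
      _ = 1 := by simp
  · rw [hg, ofReal_integral_eq_lintegral_ofReal (hi x) (Eventually.of_forall fun y => (hf y).1)]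

theorem pathPast_le (s : ℝ≥0) :
    pathPast E s ≤ (inferInstance : MeasurableSpace (CadlagPath E)) :=
  iSup_mono fun _ => iSup_le fun _ => le_rfl

theorem measurable_pathPast {s u : ℝ≥0} (h : u ≤ s) :
    Measurable[pathPast E s] fun w : CadlagPath E => w u :=
  Measurable.mono (comap_measurable _) (le_iSup₂ (f := fun (u : ℝ≥0) (_ : u ≤ s) =>
    MeasurableSpace.comap (fun w : CadlagPath E => w u) inferInstance) u h) le_rfl

theorem pathPast_mono {s t : ℝ≥0} (h : s ≤ t) : pathPast E s ≤ pathPast E t :=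
  iSup_mono fun _ => iSup_mono' fun hu => ⟨hu.trans h, le_rfl⟩

theorem setLIntegral_markov (x : E) (u t : ℝ≥0) {A : Set (CadlagPath E)}
    (hA : MeasurableSet[pathPast E u] A) {g : E → ℝ≥0∞} (hg : Measurable g) :
    ∫⁻ w in A, g (w (u + t)) ∂(X.law x) =
      ∫⁻ w in A, ∫⁻ y, g y ∂(X.semigroup t (w u)) ∂(X.law x) := by
  have hm : Measurable fun w : CadlagPath E => X.semigroup t (w u) :=
    (X.semigroup t).measurable.comp (CadlagPath.measurable_apply u)
  have h : ((X.law x).restrict A).map (fun w : CadlagPath E => w (u + t)) =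
      ((X.law x).restrict A).bind fun w => X.semigroup t (w u) := by
    ext B hB
    rw [Measure.map_apply (CadlagPath.measurable_apply _) hB,
      Measure.restrict_apply (CadlagPath.measurable_apply _ hB),
      Measure.bind_apply hB hm.aemeasurable, ← X.markov_property x u t A B hA hB, Set.inter_comm]
    rfl
  rw [← lintegral_map hg (CadlagPath.measurable_apply _), h,
    Measure.lintegral_bind hm.aemeasurable hg.aemeasurable]

/-- The version for sets says that two densities define the same measure on `pathPast E u`; the
claim is the integral of `F` against it. -/
theorem lintegral_mul_markov (x : E) (u t : ℝ≥0) {F : CadlagPath E → ℝ≥0∞}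
    (hF : Measurable[pathPast E u] F) {g : E → ℝ≥0∞} (hg : Measurable g) :
    ∫⁻ w, F w * g (w (u + t)) ∂(X.law x) =
      ∫⁻ w, F w * ∫⁻ y, g y ∂(X.semigroup t (w u)) ∂(X.law x) := by
  have h1 : Measurable fun w : CadlagPath E => g (w (u + t)) :=
    hg.comp (CadlagPath.measurable_apply _)
  have h2 : Measurable fun w : CadlagPath E => ∫⁻ y, g y ∂(X.semigroup t (w u)) :=
    (hg.lintegral_kernel).comp (CadlagPath.measurable_apply _)
  have hF' : Measurable F := hF.mono (pathPast_le u) le_rfl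
  have h : ((X.law x).withDensity fun w => g (w (u + t))).trim (pathPast_le u) =
      ((X.law x).withDensity fun w => ∫⁻ y, g y ∂(X.semigroup t (w u))).trim (pathPast_le u) := by
    refine @Measure.ext _ (pathPast E u) _ _ fun A hA => ?_
    rw [trim_measurableSet_eq _ hA, trim_measurableSet_eq _ hA,
      withDensity_apply _ (pathPast_le u _ hA), withDensity_apply _ (pathPast_le u _ hA)]
    exact X.setLIntegral_markov x u t hA hg
  have h3 := congrArg (fun ν => @lintegral _ (pathPast E u) ν F) h
  simp only [lintegral_trim (pathPast_le u) hF] at h3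
  rw [lintegral_withDensity_eq_lintegral_mul _ h1 hF',
    lintegral_withDensity_eq_lintegral_mul _ h2 hF'] at h3
  simpa only [Pi.mul_apply, mul_comm] using h3

/-- The finite-dimensional Markov property, with a continuous conditional expectation. -/
theorem exists_continuous_markov (J : Finset ℝ≥0) :
    ∀ f : ℝ≥0 → C₀(E, ℝ), (∀ t x, f t x ∈ Set.Icc (0 : ℝ) 1) →
    ∃ Ψ : E → ℝ, Continuous Ψ ∧ (∀ x, Ψ x ∈ Set.Icc (0 : ℝ) 1) ∧
      ∀ x s A, MeasurableSet[pathPast E s] A →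
        ∫⁻ w in A, ∏ t ∈ J, ENNReal.ofReal (f t (w (s + t))) ∂(X.law x) =
          ∫⁻ w in A, ENNReal.ofReal (Ψ (w s)) ∂(X.law x) := by
  classical
  induction J using Finset.induction_on_max with
  | empty => exact fun f hf => ⟨fun _ => 1, continuous_const, by simp, by simp⟩
  | insert a J hJ ih =>
    intro f hf
    have haJ : a ∉ J := fun h => lt_irrefl _ (hJ a h)
    have hof : ∀ f : C₀(E, ℝ), Measurable fun x => ENNReal.ofReal (f x) := fun f =>
      ENNReal.measurable_ofReal.comp f.continuous.measurable
    rcases J.eq_empty_or_nonempty with rfl | hne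
    · obtain ⟨g, hg, hgf⟩ := X.exists_semigroup_apply a (hf a)
      refine ⟨g, g.continuous, hg, fun x s A hA => ?_⟩
      simp only [insert_empty_eq, Finset.prod_singleton]
      rw [X.setLIntegral_markov x s a hA (hof _)]
      simp only [hgf]
    · set b := J.max' hne with hb
      have hbJ : b ∈ J := J.max'_mem hne
      obtain ⟨g, hg, hgf⟩ := X.exists_semigroup_apply (a - b) (hf a)
      -- The factor at the last time `a` is conditioned on the past of the preceding time `b` and
      -- absorbed into the factor at `b`. The Feller property keeps the new factor in `C₀(E)`, which
      -- in the end makes `Ψ` continuous.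
      obtain ⟨Ψ, hΨ, hΨ1, h⟩ := ih (fun t => if t = b then f t * g else f t) (by
        intro t x
        split_ifs
        · exact ⟨mul_nonneg (hf t x).1 (hg x).1, mul_le_one₀ (hf t x).2 (hg x).1 (hg x).2⟩
        · exact hf t x)
      refine ⟨Ψ, hΨ, hΨ1, fun x s A hA => ?_⟩
      rw [← h x s A hA]
      have hA' : MeasurableSet A := pathPast_le s _ hA
      have hsb : s + b + (a - b) = s + a := by
        rw [add_assoc, add_tsub_cancel_of_le (hJ b hbJ).le]
      have hF : Measurable[pathPast E (s + b)] fun w : CadlagPath E =>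
          A.indicator 1 w * ∏ t ∈ J, ENNReal.ofReal (f t (w (s + t))) := by
        refine Measurable.mul ?_ ?_
        · exact Measurable.indicator (f := fun _ => (1 : ℝ≥0∞)) measurable_const
            (pathPast_mono le_self_add _ hA)
        · refine Finset.measurable_fun_prod J fun t ht => (hof _).comp ?_
          exact measurable_pathPast (by gcongr; exact J.le_max' t ht)
      have h1 := X.lintegral_mul_markov x (s + b) (a - b) hF (hof (f a))
      rw [hsb] at h1
      simp only [hgf] at h1
      have e1 : ∀ w : CadlagPath E, A.indicator (fun w : CadlagPath E =>
          ∏ t ∈ insert a J, ENNReal.ofReal (f t (w (s + t)))) w =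
          (A.indicator 1 w * ∏ t ∈ J, ENNReal.ofReal (f t (w (s + t)))) *
            ENNReal.ofReal (f a (w (s + a))) := by
        intro w
        by_cases hw : w ∈ A
        · simp [hw, Finset.prod_insert haJ, mul_comm]
        · simp [hw]
      have e2 : ∀ w : CadlagPath E, A.indicator (fun w : CadlagPath E =>
          ∏ t ∈ J, ENNReal.ofReal ((if t = b then f t * g else f t : C₀(E, ℝ)) (w (s + t)))) w =
          (A.indicator 1 w * ∏ t ∈ J, ENNReal.ofReal (f t (w (s + t)))) *
            ENNReal.ofReal (g (w (s + b))) := by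
        intro w
        by_cases hw : w ∈ A
        · have : ∀ t ∈ J,
              ENNReal.ofReal ((if t = b then f t * g else f t : C₀(E, ℝ)) (w (s + t))) =
              ENNReal.ofReal (f t (w (s + t))) *
                (if t = b then ENNReal.ofReal (g (w (s + t))) else 1) := by
            intro t _
            split_ifs
            · exact ENNReal.ofReal_mul (hf _ _).1
            · rw [mul_one]
          simp only [Set.indicator_of_mem hw, Finset.prod_congr rfl this, Pi.one_apply, one_mul,
            Finset.prod_mul_distrib, Finset.prod_ite_eq', hbJ, if_true]
        · simp [hw]
      rw [← lintegral_indicator hA', ← lintegral_indicator hA']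
      simp only [e1, e2]
      exact h1

theorem exists_continuous_lintegral (J : Finset ℝ≥0) {f : ℝ≥0 → C₀(E, ℝ)}
    (hf : ∀ t x, f t x ∈ Set.Icc (0 : ℝ) 1) :
    ∃ Ψ : E → ℝ, Continuous Ψ ∧ (∀ x, Ψ x ∈ Set.Icc (0 : ℝ) 1) ∧
      (∀ x, ∫⁻ w, ∏ t ∈ J, ENNReal.ofReal (f t (w t)) ∂(X.law x) = ENNReal.ofReal (Ψ x)) ∧
      ∀ x s A, MeasurableSet[pathPast E s] A →
        ∫⁻ w in A, ∏ t ∈ J, ENNReal.ofReal (f t (w (s + t))) ∂(X.law x) =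
          ∫⁻ w in A, ENNReal.ofReal (Ψ (w s)) ∂(X.law x) := by
  obtain ⟨Ψ, h1, h2, h3⟩ := X.exists_continuous_markov J f hf
  refine ⟨Ψ, h1, h2, fun x => ?_, h3⟩
  have h4 := h3 x 0 Set.univ MeasurableSet.univ
  simp only [zero_add, Measure.restrict_univ] at h4
  rw [h4, lintegral_congr_ae (g := fun _ => ENNReal.ofReal (Ψ x)), lintegral_const,
    measure_univ, mul_one]
  filter_upwards [X.start x] with w hw
  rw [hw]

/-- The Markov property of the laws on path space. -/
theorem law_inter_shift (x : E) (s : ℝ≥0) {A : Set (CadlagPath E)}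
    (hA : MeasurableSet[pathPast E s] A) {B : Set (CadlagPath E)} (hB : MeasurableSet B) :
    X.law x (A ∩ CadlagPath.shift s ⁻¹' B) = ∫⁻ w in A, X.law (w s) B ∂(X.law x) := by
  have hm : Measurable fun w : CadlagPath E => X.law (w s) :=
    X.law.measurable.comp (CadlagPath.measurable_apply s)
  have h : ((X.law x).restrict A).map (CadlagPath.shift s) =
      ((X.law x).restrict A).bind fun w => X.law (w s) := by
    refine measure_ext_of_zeroAtInfty (fun (t : ℝ≥0) (w : CadlagPath E) => w t) rfl
      fun J f hf => ?_
    obtain ⟨Ψ, -, -, h3, h4⟩ := X.exists_continuous_lintegral J hf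
    have hp : Measurable fun w : CadlagPath E => ∏ t ∈ J, ENNReal.ofReal (f t (w t)) :=
      Finset.measurable_fun_prod J fun t _ =>
        ENNReal.measurable_ofReal.comp ((f t).continuous.measurable.comp
          (CadlagPath.measurable_apply t))
    rw [lintegral_map hp (CadlagPath.measurable_shift s),
      Measure.lintegral_bind hm.aemeasurable hp.aemeasurable]
    exact (h4 x s A hA).trans (lintegral_congr fun w => (h3 (w s)).symm)
  have h' := DFunLike.congr_fun h B
  rw [Measure.map_apply (CadlagPath.measurable_shift s) hB,
    Measure.restrict_apply (CadlagPath.measurable_shift s hB),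
    Measure.bind_apply hB hm.aemeasurable, Set.inter_comm] at h'
  exact h'

end FellerProcess

end OneParticle

/-! ### Systems of independent particles and their Markov property -/

section Systems

variable {E : Type*} [TopologicalSpace E] [MeasurableSpace E] {ι : Type*}

/-- The `σ`-algebra generated by the paths `ξ i` up to time `s`. -/
abbrev rawPast {Ω : Type*} (ξ : ι → Ω → CadlagPath E) (s : ℝ≥0) : MeasurableSpace Ω :=
  ⨆ i : ι, ⨆ u : ℝ≥0, ⨆ _ : u ≤ s, MeasurableSpace.comap (fun ω => ξ i ω u) inferInstance

theorem rawPast_mono {Ω : Type*} (ξ : ι → Ω → CadlagPath E) {s t : ℝ≥0} (h : s ≤ t) :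
    rawPast ξ s ≤ rawPast ξ t :=
  iSup_mono fun _ => iSup_mono fun _ => iSup_mono' fun hu => ⟨hu.trans h, le_rfl⟩

theorem rawPast_le {Ω : Type*} [m : MeasurableSpace Ω] {ξ : ι → Ω → CadlagPath E}
    (hξ : ∀ i, Measurable (ξ i)) (s : ℝ≥0) : rawPast ξ s ≤ m :=
  iSup_le fun i => iSup_le fun u => iSup_le fun _ =>
    Measurable.comap_le ((CadlagPath.measurable_apply u).comp (hξ i))

theorem measurable_rawPast {Ω : Type*} (ξ : ι → Ω → CadlagPath E) (i : ι) {u s : ℝ≥0}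
    (h : u ≤ s) : Measurable[rawPast ξ s] fun ω => ξ i ω u :=
  Measurable.mono (comap_measurable _) (le_iSup_of_le i (le_iSup₂ (f := fun (u : ℝ≥0)
    (_ : u ≤ s) => MeasurableSpace.comap (fun ω => ξ i ω u) inferInstance) u h)) le_rfl

theorem rawPast_eq_comap {Ω : Type*} (ξ : ι → Ω → CadlagPath E) (s : ℝ≥0) :
    rawPast ξ s = MeasurableSpace.comap (fun ω i => ξ i ω)
      (rawPast (fun i (w : ι → CadlagPath E) => w i) s) := by
  simp only [rawPast, MeasurableSpace.comap_iSup, MeasurableSpace.comap_comp]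
  rfl

/-- The right-continuous filtration generated by the paths `ξ i`. -/
def pastFiltration {Ω : Type*} [m : MeasurableSpace Ω] (ξ : ι → Ω → CadlagPath E)
    (hξ : ∀ i, Measurable (ξ i)) : Filtration ℝ≥0 m where
  seq t := ⨅ ε : ℝ≥0, ⨅ _ : 0 < ε, rawPast ξ (t + ε)
  mono' _ _ h := iInf₂_mono fun ε _ => rawPast_mono ξ (by gcongr)
  le' t := iInf₂_le_of_le 1 one_pos (rawPast_le hξ _)

section

variable {Ω : Type*} [m : MeasurableSpace Ω] {ξ : ι → Ω → CadlagPath E}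
  (hξ : ∀ i, Measurable (ξ i))

theorem pastFiltration_le_rawPast {s t : ℝ≥0} (h : s < t) :
    pastFiltration ξ hξ s ≤ rawPast ξ t :=
  (iInf₂_le (t - s) (tsub_pos_of_lt h)).trans_eq (by rw [add_tsub_cancel_of_le h.le])

theorem rawPast_le_pastFiltration (s : ℝ≥0) : rawPast ξ s ≤ pastFiltration ξ hξ s :=
  le_iInf₂ fun _ _ => rawPast_mono ξ le_self_add

theorem measurable_pastFiltration (i : ι) {u s : ℝ≥0} (h : u ≤ s) :
    Measurable[pastFiltration ξ hξ s] fun ω => ξ i ω u :=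
  (measurable_rawPast ξ i h).mono (rawPast_le_pastFiltration hξ s) le_rfl

instance : (pastFiltration ξ hξ).IsRightContinuous := by
  refine ⟨fun t => ?_⟩
  rw [Filtration.rightCont_eq_of_not_isMax _ (not_isMax t)]
  refine le_iInf₂ fun ε hε => ?_
  have h : t < t + ε / 2 := lt_add_of_pos_right t (half_pos hε)
  refine (iInf₂_le (t + ε / 2) h).trans ?_
  refine pastFiltration_le_rawPast hξ ?_
  gcongr
  exact half_lt_self hε

end

variable [LocallyCompactSpace E] [SecondCountableTopology E] [T2Space E] [BorelSpace E]

theorem lintegral_prod_infinitePi {D : Type*} [MeasurableSpace D] (P : ι → Measure D)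
    [∀ i, IsProbabilityMeasure (P i)] (s : Finset ι) {g : ι → D → ℝ≥0∞}
    (hg : ∀ i, Measurable (g i)) :
    ∫⁻ w, ∏ i ∈ s, g i (w i) ∂(Measure.infinitePi P) = ∏ i ∈ s, ∫⁻ v, g i v ∂(P i) := by
  refine (lintegral_prod_eq_prod_lintegral_of_indepFun s (fun i (w : ι → D) => g i (w i))
    (iIndepFun_infinitePi hg) (fun i => (hg i).comp (measurable_pi_apply i))).trans ?_
  refine Finset.prod_congr rfl fun i _ => ?_
  conv_rhs => rw [← Measure.infinitePi_map_eval P i]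
  rw [lintegral_map (hg i) (measurable_pi_apply i)]

namespace FellerProcess

variable (X : FellerProcess E)

variable (ι) in
/-- The kernel that maps `x` to the law of independent copies of `X` started from the entries
of `x`. -/
def vecKernel : Kernel (ι → E) (ι → CadlagPath E) where
  toFun x := Measure.infinitePi fun i => X.law (x i)
  measurable' := by
    refine Measurable.measure_of_isPiSystem_of_isProbabilityMeasure
      (generateFrom_squareCylinders (α := fun _ : ι => CadlagPath E)).symm
      (isPiSystem_squareCylinders (fun _ => MeasurableSpace.isPiSystem_measurableSet)
        (fun _ => by simp)) ?_
    rintro - ⟨s, t, ht, rfl⟩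
    have ht' : ∀ i ∈ s, MeasurableSet (t i) := fun i _ => ht i trivial
    simp only [Measure.infinitePi_pi _ ht']
    exact Finset.measurable_fun_prod s fun i _ =>
      (X.law.measurable_coe (ht i trivial)).comp (measurable_pi_apply i)

theorem vecKernel_apply (x : ι → E) :
    X.vecKernel ι x = Measure.infinitePi fun i => X.law (x i) := rfl

instance : IsMarkovKernel (X.vecKernel ι) :=
  ⟨fun x => by rw [vecKernel_apply]; infer_instance⟩

theorem vecKernel_map_comp {κ : Type*} {e : κ → ι} (he : Function.Injective e) (x : ι → E) :
    (X.vecKernel ι x).map (fun w k => w (e k)) = X.vecKernel κ (x ∘ e) :=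
  Measure.map_infinitePi_infinitePi_of_inj he

theorem vecKernel_start (x : ι → E) (i : ι) : ∀ᵐ w ∂(X.vecKernel ι x), w i 0 = x i := by
  have h := Measure.infinitePi_map_eval (fun i => X.law (x i)) i
  have h' := X.start (x i)
  rw [← h] at h'
  exact ae_of_ae_map (measurable_pi_apply i).aemeasurable h'

/-- All particles shifted by the time `s`. -/
def _root_.Coalescing.shiftAll (s : ℝ≥0) (w : ι → CadlagPath E) : ι → CadlagPath E :=
  fun i => (w i).shift s

theorem _root_.Coalescing.measurable_shiftAll (s : ℝ≥0) :
    Measurable (shiftAll s : (ι → CadlagPath E) → ι → CadlagPath E) :=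
  measurable_pi_lambda _ fun i => (CadlagPath.measurable_shift s).comp (measurable_pi_apply i)

theorem _root_.Coalescing.measurable_apply_all (s : ℝ≥0) :
    Measurable fun (w : ι → CadlagPath E) i => w i s :=
  measurable_pi_lambda _ fun i => (CadlagPath.measurable_apply s).comp (measurable_pi_apply i)

/-- On finite rectangles both sides factor over the particles, and each factor is the one-particle
property `law_inter_shift`. The general case follows by two π-λ arguments, one for the future and
one for the past. -/
theorem vecKernel_pi_inter_shiftAll_pi (x : ι → E) (q : ℝ≥0) (K : Finset ι)
    {A B : ι → Set (CadlagPath E)} (hA : ∀ i, MeasurableSet[pathPast E q] (A i))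
    (hB : ∀ i, MeasurableSet (B i)) :
    X.vecKernel ι x ((K : Set ι).pi A ∩ shiftAll q ⁻¹' ((K : Set ι).pi B)) =
      ∫⁻ w in (K : Set ι).pi A, X.vecKernel ι (fun i => w i q) ((K : Set ι).pi B)
          ∂(X.vecKernel ι x) := by
  have hA' : ∀ i, MeasurableSet (A i) := fun i => pathPast_le q _ (hA i)
  have hAB : ∀ i, MeasurableSet (A i ∩ CadlagPath.shift q ⁻¹' (B i)) := fun i =>
    (hA' i).inter (CadlagPath.measurable_shift q (hB i))
  have hAK : MeasurableSet ((K : Set ι).pi A) :=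
    MeasurableSet.pi K.countable_toSet fun i _ => hA' i
  have e : (K : Set ι).pi A ∩ shiftAll q ⁻¹' ((K : Set ι).pi B) =
      (K : Set ι).pi fun i => A i ∩ CadlagPath.shift q ⁻¹' (B i) := by
    ext w
    simp only [Set.mem_inter_iff, Set.mem_pi, Set.mem_preimage, ← forall₂_and]
    rfl
  have hg : ∀ i, Measurable ((A i).indicator fun v : CadlagPath E => X.law (v q) (B i)) :=
    fun i => ((X.law.measurable_coe (hB i)).comp
      (CadlagPath.measurable_apply q)).indicator (hA' i)
  rw [e, vecKernel_apply, Measure.infinitePi_pi _ fun i _ => hAB i,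
    ← lintegral_indicator hAK]
  have e2 : ∀ w : ι → CadlagPath E, ((K : Set ι).pi A).indicator
      (fun w => X.vecKernel ι (fun i => w i q) ((K : Set ι).pi B)) w =
      ∏ i ∈ K, (A i).indicator (fun v : CadlagPath E => X.law (v q) (B i)) (w i) := by
    intro w
    by_cases hw : w ∈ (K : Set ι).pi A
    · rw [Set.indicator_of_mem hw, vecKernel_apply, Measure.infinitePi_pi _ fun i _ => hB i]
      exact Finset.prod_congr rfl fun i hi => (Set.indicator_of_mem (hw i hi)
        fun v : CadlagPath E => X.law (v q) (B i)).symm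
    · rw [Set.indicator_of_notMem hw]
      obtain ⟨i, hi, hwi⟩ : ∃ i ∈ K, w i ∉ A i := by simpa [Set.mem_pi] using hw
      exact (Finset.prod_eq_zero hi (Set.indicator_of_notMem hwi _)).symm
  simp only [e2]
  rw [lintegral_prod_infinitePi _ K hg]
  refine Finset.prod_congr rfl fun i _ => ?_
  rw [lintegral_indicator (hA' i)]
  exact X.law_inter_shift (x i) q (hA i) (hB i)

theorem vecKernel_pi_inter_shiftAll (x : ι → E) (q : ℝ≥0) (K : Finset ι)
    {A : ι → Set (CadlagPath E)} (hA : ∀ i, MeasurableSet[pathPast E q] (A i))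
    {B : Set (ι → CadlagPath E)} (hB : MeasurableSet B) :
    X.vecKernel ι x ((K : Set ι).pi A ∩ shiftAll q ⁻¹' B) =
      ∫⁻ w in (K : Set ι).pi A, X.vecKernel ι (fun i => w i q) B
          ∂(X.vecKernel ι x) := by
  classical
  set P := X.vecKernel ι x
  have hm : Measurable fun w : ι → CadlagPath E => X.vecKernel ι fun i => w i q :=
    (X.vecKernel ι).measurable.comp (measurable_apply_all q)
  have hA' : ∀ i, MeasurableSet (A i) := fun i => pathPast_le q _ (hA i)
  have hAK : MeasurableSet ((K : Set ι).pi A) :=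
    MeasurableSet.pi K.countable_toSet fun i _ => hA' i
  have h : (P.restrict ((K : Set ι).pi A)).map (shiftAll q) =
      (P.restrict ((K : Set ι).pi A)).bind fun w => X.vecKernel ι fun i => w i q := by
    refine MeasureTheory.ext_of_generate_finite _
      (generateFrom_squareCylinders (α := fun _ : ι => CadlagPath E)).symm
      (isPiSystem_squareCylinders (fun _ => MeasurableSpace.isPiSystem_measurableSet)
        (fun _ => by simp)) ?_ ?_
    · rintro - ⟨K', B', hB', rfl⟩
      have hB' : ∀ i, MeasurableSet (B' i) := fun i => hB' i trivial
      have hBm : MeasurableSet ((K' : Set ι).pi B') :=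
        MeasurableSet.pi K'.countable_toSet fun i _ => hB' i
      rw [Measure.map_apply (measurable_shiftAll q) hBm,
        Measure.restrict_apply (measurable_shiftAll q hBm),
        Measure.bind_apply hBm hm.aemeasurable, Set.inter_comm]
      have eA : (K : Set ι).pi A =
          ((K ∪ K' : Finset ι) : Set ι).pi fun i => if i ∈ K then A i else Set.univ := by
        ext w
        simp only [Set.mem_pi, Finset.mem_coe, Finset.mem_union]
        constructor
        · intro h i _
          split_ifs with hi
          · exact h i hi
          · trivial
        · intro h i hi
          simpa [hi] using h i (Or.inl hi)
      have eB : (K' : Set ι).pi B' =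
          ((K ∪ K' : Finset ι) : Set ι).pi fun i => if i ∈ K' then B' i else Set.univ := by
        ext w
        simp only [Set.mem_pi, Finset.mem_coe, Finset.mem_union]
        constructor
        · intro h i _
          split_ifs with hi
          · exact h i hi
          · trivial
        · intro h i hi
          simpa [hi] using h i (Or.inr hi)
      rw [eA, eB]
      refine X.vecKernel_pi_inter_shiftAll_pi x q _ (fun i => ?_) fun i => ?_
      · split_ifs
        · exact hA i
        · exact MeasurableSet.univ
      · split_ifs
        · exact hB' i
        · exact MeasurableSet.univ
    · rw [Measure.map_apply (measurable_shiftAll q) MeasurableSet.univ,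
        Measure.bind_apply MeasurableSet.univ hm.aemeasurable]
      simp
  have h' := DFunLike.congr_fun h B
  rw [Measure.map_apply (measurable_shiftAll q) hB,
    Measure.restrict_apply (measurable_shiftAll q hB),
    Measure.bind_apply hB hm.aemeasurable, Set.inter_comm] at h'
  exact h'

theorem vecKernel_inter_shiftAll (x : ι → E) (q : ℝ≥0) {A : Set (ι → CadlagPath E)}
    (hA : MeasurableSet[rawPast (fun i (w : ι → CadlagPath E) => w i) q] A)
    {B : Set (ι → CadlagPath E)} (hB : MeasurableSet B) :
    X.vecKernel ι x (A ∩ shiftAll q ⁻¹' B) =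
      ∫⁻ w in A, X.vecKernel ι (fun i => w i q) B ∂(X.vecKernel ι x) := by
  set P := X.vecKernel ι x
  set 𝓒 : Set (Set (ι → CadlagPath E)) :=
    squareCylinders fun _ => {s : Set (CadlagPath E) | MeasurableSet[pathPast E q] s} with h𝓒
  have hpi : IsPiSystem 𝓒 := isPiSystem_squareCylinders
    (fun _ => @MeasurableSpace.isPiSystem_measurableSet _ (pathPast E q))
    (fun _ => @MeasurableSet.univ _ (pathPast E q))
  have hle : rawPast (fun i (w : ι → CadlagPath E) => w i) q ≤ MeasurableSpace.generateFrom 𝓒 := by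
    refine iSup_le fun i => iSup_le fun u => iSup_le fun hu => ?_
    rintro - ⟨C, hC, rfl⟩
    refine MeasurableSpace.measurableSet_generateFrom
      ⟨{i}, fun _ => (fun v : CadlagPath E => v u) ⁻¹' C, ?_, ?_⟩
    · exact fun _ _ => measurable_pathPast hu hC
    · ext w
      simp
  have hB' : MeasurableSet (shiftAll q ⁻¹' B : Set (ι → CadlagPath E)) :=
    measurable_shiftAll q hB
  have huniv : P (shiftAll q ⁻¹' B) = ∫⁻ w, X.vecKernel ι (fun i => w i q) B ∂P := by
    have := X.vecKernel_pi_inter_shiftAll x q ∅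
      (A := fun _ => Set.univ) (fun i => MeasurableSet.univ) hB
    simpa using this
  have key : MeasurableSet A ∧ P (A ∩ shiftAll q ⁻¹' B) =
      ∫⁻ w in A, X.vecKernel ι (fun i => w i q) B ∂P := by
    have hA' := hle _ hA
    clear hA
    induction A, hA' using MeasurableSpace.induction_on_inter (s := 𝓒) rfl hpi with
    | empty => simp
    | basic A hA =>
      obtain ⟨K, A', hA', rfl⟩ := hA
      exact ⟨MeasurableSet.pi K.countable_toSet fun i _ => pathPast_le q _ (hA' i trivial),
        X.vecKernel_pi_inter_shiftAll x q K (fun i => hA' i trivial) hB⟩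
    | compl A _ ih =>
      obtain ⟨hm, ih⟩ := ih
      refine ⟨hm.compl, ?_⟩
      have h1 := measure_inter_add_sdiff (μ := P) (shiftAll q ⁻¹' B) hm
      have h2 := lintegral_add_compl (μ := P)
        (fun w => X.vecKernel ι (fun i => w i q) B) hm
      rw [Set.inter_comm, ih, huniv, ← h2, Set.sdiff_eq, Set.inter_comm] at h1
      refine (ENNReal.add_right_inj ?_).1 h1
      rw [← ih]
      exact measure_ne_top _ _
    | iUnion f hd _ ih =>
      refine ⟨MeasurableSet.iUnion fun n => (ih n).1, ?_⟩
      rw [Set.iUnion_inter, measure_iUnion (fun i j hij => (hd hij).mono Set.inter_subset_left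
        Set.inter_subset_left) (fun n => (ih n).1.inter hB'),
        lintegral_iUnion (fun n => (ih n).1) hd]
      exact tsum_congr fun n => (ih n).2
  exact key.2

end FellerProcess

/-- Under `μ`, the paths `ξ i` are independent copies of `X` with a random vector of starting
points, in the sense that they have the Markov property with the laws `X.vecKernel ι x`. -/
structure IsMarkovSystem (X : FellerProcess E) {Ω : Type*} [MeasurableSpace Ω] (μ : Measure Ω)
    (ξ : ι → Ω → CadlagPath E) : Prop where
  measurable : ∀ i, Measurable (ξ i)
  markov : ∀ (q : ℝ≥0) (A : Set Ω), MeasurableSet[rawPast ξ q] A →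
    ∀ B : Set (ι → CadlagPath E), MeasurableSet B →
      μ (A ∩ {ω | shiftAll q (fun i => ξ i ω) ∈ B}) =
        ∫⁻ ω in A, X.vecKernel ι (fun i => ξ i ω q) B ∂μ

variable {X : FellerProcess E}

/-- Random starting points are needed because a system restarted at a stopping time has a law of
this form. -/
theorem isMarkovSystem_bind (ν : Measure (ι → E)) [SFinite ν] :
    IsMarkovSystem X (ν.bind (X.vecKernel ι)) fun i (w : ι → CadlagPath E) => w i where
  measurable := measurable_pi_apply
  markov q A hA B hB := by
    have hA' : MeasurableSet A := rawPast_le measurable_pi_apply q _ hA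
    have hB' : MeasurableSet (shiftAll q ⁻¹' B : Set (ι → CadlagPath E)) :=
      measurable_shiftAll q hB
    have hm : Measurable fun w : ι → CadlagPath E => X.vecKernel ι (fun i => w i q) B :=
      ((X.vecKernel ι).measurable_coe hB).comp (measurable_apply_all q)
    change (ν.bind (X.vecKernel ι)) (A ∩ shiftAll q ⁻¹' B) = _
    rw [Measure.bind_apply (hA'.inter hB') (X.vecKernel ι).aemeasurable, ← lintegral_indicator hA',
      Measure.lintegral_bind (X.vecKernel ι).aemeasurable (hm.indicator hA').aemeasurable]
    refine lintegral_congr fun x => ?_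
    rw [lintegral_indicator hA']
    exact X.vecKernel_inter_shiftAll x q hA hB

theorem isMarkovSystem_vecKernel (x : ι → E) :
    IsMarkovSystem X (X.vecKernel ι x) fun i (w : ι → CadlagPath E) => w i where
  measurable := measurable_pi_apply
  markov q _ hA _ hB := X.vecKernel_inter_shiftAll x q hA hB

theorem IsMarkovSystem.of_map {Ω : Type*} [MeasurableSpace Ω] {μ : Measure Ω}
    {ξ : ι → Ω → CadlagPath E} (hξ : ∀ i, Measurable (ξ i))
    (h : IsMarkovSystem X (μ.map fun ω i => ξ i ω) fun i (w : ι → CadlagPath E) => w i) :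
    IsMarkovSystem X μ ξ where
  measurable := hξ
  markov q A hA B hB := by
    have hξ' : Measurable fun ω i => ξ i ω := measurable_pi_lambda _ hξ
    rw [rawPast_eq_comap] at hA
    obtain ⟨A', hA', rfl⟩ := hA
    have h1 : (μ.map fun ω i => ξ i ω) (A' ∩ shiftAll q ⁻¹' B) = ∫⁻ w in A',
      X.vecKernel ι (fun i => w i q) B ∂(μ.map fun ω i => ξ i ω) := h.markov q A' hA' B hB
    have hA'm := rawPast_le measurable_pi_apply q _ hA'
    have hm : Measurable fun w : ι → CadlagPath E => X.vecKernel ι (fun i => w i q) B :=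
      ((X.vecKernel ι).measurable_coe hB).comp (measurable_apply_all q)
    rw [setLIntegral_map hA'm hm hξ', Measure.map_apply hξ'
      (hA'm.inter (measurable_shiftAll q hB))] at h1
    exact h1

theorem IsFreeSystem.map_eq_vecKernel {N : ℕ∞} {x : Idx N → E} {Ω : Type*}
    [MeasurableSpace Ω] {μ : Measure Ω} {ξ : Idx N → Ω → CadlagPath E}
    (h : IsFreeSystem X x μ ξ) : μ.map (fun ω i => ξ i ω) = X.vecKernel (Idx N) x := by
  have := h.indep.isProbabilityMeasure
  rw [(iIndepFun_iff_map_fun_eq_infinitePi_map h.measurable).1 h.indep]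
  simp only [h.map_eq]
  rfl

theorem IsFreeSystem.isMarkovSystem {N : ℕ∞} {x : Idx N → E} {Ω : Type*}
    [MeasurableSpace Ω] {μ : Measure Ω} {ξ : Idx N → Ω → CadlagPath E}
    (h : IsFreeSystem X x μ ξ) : IsMarkovSystem X μ ξ := by
  refine IsMarkovSystem.of_map h.measurable ?_
  rw [h.map_eq_vecKernel]
  exact isMarkovSystem_vecKernel x

end Systems

/-! ### The strong Markov property of the free particles -/

section StrongMarkov

variable {E : Type*} [TopologicalSpace E] [MeasurableSpace E] {ι : Type*}
  [LocallyCompactSpace E] [SecondCountableTopology E] [T2Space E] [BorelSpace E]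

theorem measurable_prod_apply (J : Finset (ι × ℝ≥0)) (f : ι × ℝ≥0 → C₀(E, ℝ)) :
    Measurable fun w : ι → CadlagPath E => ∏ p ∈ J, ENNReal.ofReal (f p (w p.1 p.2)) :=
  Finset.measurable_fun_prod J fun p _ => ENNReal.measurable_ofReal.comp
    ((f p).continuous.measurable.comp ((CadlagPath.measurable_apply p.2).comp
      (measurable_pi_apply p.1)))

/-- By independence the integral is a finite product of the continuous one-particle functions, each
evaluated at one coordinate of `x`. -/
theorem FellerProcess.exists_continuous_lintegral_vecKernel (X : FellerProcess E)
    (J : Finset (ι × ℝ≥0)) {f : ι × ℝ≥0 → C₀(E, ℝ)}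
    (hf : ∀ p x, f p x ∈ Set.Icc (0 : ℝ) 1) :
    ∃ Ψ : (ι → E) → ℝ, Continuous Ψ ∧ (∀ x, Ψ x ∈ Set.Icc (0 : ℝ) 1) ∧
      ∀ x, ∫⁻ w, ∏ p ∈ J, ENNReal.ofReal (f p (w p.1 p.2)) ∂(X.vecKernel ι x) =
        ENNReal.ofReal (Ψ x) := by
  classical
  set I : Finset ι := J.image Prod.fst with hI
  set K : ι → Finset ℝ≥0 := fun i => {p ∈ J | p.1 = i}.image Prod.snd with hK
  choose Ψ h1 h2 h3 _ using fun i => X.exists_continuous_lintegral (K i)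
    (f := fun t => f (i, t)) fun t x => hf (i, t) x
  have e : ∀ w : ι → CadlagPath E, ∏ p ∈ J, ENNReal.ofReal (f p (w p.1 p.2)) =
      ∏ i ∈ I, ∏ t ∈ K i, ENNReal.ofReal (f (i, t) (w i t)) := by
    intro w
    rw [← Finset.prod_fiberwise_of_maps_to (s := J) (t := I) (g := Prod.fst)
      fun p hp => Finset.mem_image_of_mem _ hp]
    refine Finset.prod_congr rfl fun i _ => ?_
    rw [hK, Finset.prod_image]
    · refine Finset.prod_congr rfl fun p hp => ?_
      have := (Finset.mem_filter.1 hp).2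
      subst this
      rfl
    · intro p hp p' hp' hpp
      have h := (Finset.mem_filter.1 hp).2
      have h' := (Finset.mem_filter.1 hp').2
      exact Prod.ext (h.trans h'.symm) hpp
  refine ⟨fun x => ∏ i ∈ I, Ψ i (x i), ?_, fun x => ⟨?_, ?_⟩, fun x => ?_⟩
  · exact continuous_finsetProd I fun i _ => (h1 i).comp (continuous_apply i)
  · exact Finset.prod_nonneg fun i _ => (h2 i _).1
  · exact Finset.prod_le_one (fun i _ => (h2 i _).1) fun i _ => (h2 i _).2
  · simp only [e]
    refine (lintegral_prod_infinitePi (fun i => X.law (x i)) I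
      (g := fun i (v : CadlagPath E) => ∏ t ∈ K i, ENNReal.ofReal (f (i, t) (v t))) ?_).trans ?_
    rotate_left
    · rw [ENNReal.ofReal_prod_of_nonneg fun i _ => (h2 i _).1]
      exact Finset.prod_congr rfl fun i _ => h3 i (x i)
    · exact fun i => Finset.measurable_fun_prod (K i) fun t _ => ENNReal.measurable_ofReal.comp
        ((f (i, t)).continuous.measurable.comp (CadlagPath.measurable_apply t))

theorem measurableSpace_vec : (MeasurableSpace.pi : MeasurableSpace (ι → CadlagPath E)) =
    ⨆ p : ι × ℝ≥0, MeasurableSpace.comap (fun w : ι → CadlagPath E => w p.1 p.2)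
      inferInstance := by
  refine le_antisymm (iSup_le fun i => ?_) (iSup_le fun p => ?_)
  · change MeasurableSpace.comap _ (⨆ t : ℝ≥0, _) ≤ _
    rw [MeasurableSpace.comap_iSup]
    refine iSup_le fun t => ?_
    rw [MeasurableSpace.comap_comp]
    exact le_iSup (fun p : ι × ℝ≥0 => MeasurableSpace.comap
      (fun w : ι → CadlagPath E => w p.1 p.2) inferInstance) (i, t)
  · exact ((CadlagPath.measurable_apply p.2).comp (measurable_pi_apply p.1)).comap_le

/-- Finite measures on the space of vectors of paths agree if they agree on products of functions
in `C₀(E)` of the positions at fixed times. -/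
theorem measure_vec_ext {μ ν : Measure (ι → CadlagPath E)} [IsFiniteMeasure μ]
    (h : ∀ (J : Finset (ι × ℝ≥0)) (f : ι × ℝ≥0 → C₀(E, ℝ)),
      (∀ p x, f p x ∈ Set.Icc (0 : ℝ) 1) →
      ∫⁻ w, ∏ p ∈ J, ENNReal.ofReal (f p (w p.1 p.2)) ∂μ =
        ∫⁻ w, ∏ p ∈ J, ENNReal.ofReal (f p (w p.1 p.2)) ∂ν) : μ = ν :=
  measure_ext_of_zeroAtInfty (fun (p : ι × ℝ≥0) (w : ι → CadlagPath E) => w p.1 p.2)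
    measurableSpace_vec h

theorem measurable_shiftAll_random {Ω : Type*} [MeasurableSpace Ω] {ξ : ι → Ω → CadlagPath E}
    (hξ : ∀ i, Measurable (ξ i)) {s : Ω → ℝ≥0} (hs : Measurable s) :
    Measurable fun ω => shiftAll (s ω) fun i => ξ i ω :=
  measurable_pi_lambda _ fun i => CadlagPath.measurable_of_apply fun t => by
    have := CadlagPath.measurable_apply_random (hξ i) (hs.add_const t)
    exact this

theorem measurable_apply_all_random {Ω : Type*} [MeasurableSpace Ω] {ξ : ι → Ω → CadlagPath E}
    (hξ : ∀ i, Measurable (ξ i)) {s : Ω → ℝ≥0} (hs : Measurable s) :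
    Measurable fun ω i => ξ i ω (s ω) :=
  measurable_pi_lambda _ fun i => CadlagPath.measurable_apply_random (hξ i) hs

section

variable {Ω : Type*} [m : MeasurableSpace Ω] {ξ : ι → Ω → CadlagPath E}
  {hξ : ∀ i, Measurable (ξ i)} {S : Ω → WithTop ℝ≥0} (hS : IsStoppingTime (pastFiltration ξ hξ) S)

/-- The value of a random time, replaced by `0` where it is infinite. -/
abbrev finVal (S : Ω → WithTop ℝ≥0) (ω : Ω) : ℝ≥0 := (S ω).untopD 0

theorem coe_finVal {S : Ω → WithTop ℝ≥0} {ω : Ω} (h : S ω < ⊤) : (finVal S ω : WithTop ℝ≥0) = S ω := by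
  lift S ω to ℝ≥0 using h.ne with t ht
  rw [finVal, ← ht, WithTop.untopD_coe]

include hS in
theorem measurable_finVal : Measurable (finVal S) :=
  hS.measurable'.untopD 0

/-- `S < q` means that `S ≤ r` for some `r < q` in a countable dense set, and the right-continuous
past at `r` is contained in the raw past at `q`. -/
theorem measurableSet_rawPast_inter_lt {A : Set Ω} (hA : MeasurableSet[hS.measurableSpace] A)
    (q : ℝ≥0) : MeasurableSet[rawPast ξ q] (A ∩ {ω | S ω < q}) := by
  obtain ⟨D, hD, hd⟩ := exists_countable_dense ℝ≥0
  have : A ∩ {ω | S ω < q} = ⋃ r ∈ {r ∈ D | r < q}, A ∩ {ω | S ω ≤ r} := by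
    ext ω
    simp only [Set.mem_inter_iff, Set.mem_ofPred_eq, Set.mem_iUnion, exists_prop]
    constructor
    · rintro ⟨hωA, hω⟩
      obtain ⟨s, hs⟩ := WithTop.ne_top_iff_exists.1 (hω.trans_le le_top).ne
      rw [← hs] at hω ⊢
      obtain ⟨r, hr, h1, h2⟩ := hd.exists_between (WithTop.coe_lt_coe.1 hω)
      exact ⟨r, ⟨hr, h2⟩, hωA, WithTop.coe_le_coe.2 h1.le⟩
    · rintro ⟨r, ⟨-, hr⟩, hωA, hω⟩
      exact ⟨hωA, hω.trans_lt (WithTop.coe_lt_coe.2 hr)⟩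
  rw [this]
  refine MeasurableSet.biUnion (hD.mono fun r hr => hr.1) fun r hr => ?_
  exact pastFiltration_le_rawPast hξ hr.2 _ (hA.2 r)

theorem measurableSet_of_inter_le {A : Set Ω} (hAS : A ⊆ {ω | S ω < ⊤})
    (h : ∀ t : ℝ≥0, MeasurableSet[pastFiltration ξ hξ t] (A ∩ {ω | S ω ≤ t})) :
    MeasurableSet[hS.measurableSpace] A := by
  refine ⟨?_, h⟩
  have : A = ⋃ n : ℕ, A ∩ {ω | S ω ≤ ((n : ℝ≥0) : WithTop ℝ≥0)} := by
    ext ω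
    simp only [Set.mem_iUnion, Set.mem_inter_iff, exists_and_left]
    refine ⟨fun hω => ⟨hω, ?_⟩, fun hω => hω.1⟩
    obtain ⟨n, hn⟩ := exists_nat_ge (finVal S ω)
    refine ⟨n, ?_⟩
    change S ω ≤ _
    rw [← coe_finVal (hAS hω)]
    exact WithTop.coe_le_coe.2 hn
  rw [this]
  exact MeasurableSet.iUnion fun n => le_iSup (pastFiltration ξ hξ) (n : ℝ≥0) _ (h n)

end

namespace IsMarkovSystem

variable {X : FellerProcess E} {Ω : Type*} [m : MeasurableSpace Ω] {μ : Measure Ω}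
  [IsFiniteMeasure μ] {ξ : ι → Ω → CadlagPath E} (h : IsMarkovSystem X μ ξ)
  {S : Ω → WithTop ℝ≥0} (hS : IsStoppingTime (pastFiltration ξ h.measurable) S)

include hS in
theorem strong_grid {A : Set Ω} (hA : MeasurableSet[hS.measurableSpace] A)
    (hAS : A ⊆ {ω | S ω < ⊤}) (n : ℕ) {B : Set (ι → CadlagPath E)} (hB : MeasurableSet B) :
    μ (A ∩ {ω | shiftAll (gridAbove n (finVal S ω)) (fun i => ξ i ω) ∈ B}) =
      ∫⁻ ω in A, X.vecKernel ι (fun i => ξ i ω (gridAbove n (finVal S ω))) B ∂μ := by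
  have hAm : MeasurableSet A := hS.measurableSpace_le _ hA
  have hn : (0 : ℝ≥0) < (n : ℝ≥0) + 1 := by positivity
  have hs : Measurable (finVal S) := measurable_finVal hS
  have hfl : Measurable fun ω => ⌊((n : ℝ≥0) + 1) * finVal S ω⌋₊ :=
    Nat.measurable_floor.comp (hs.const_mul _)
  have hg : Measurable fun ω => gridAbove n (finVal S ω) := by
    have : Measurable fun k : ℕ => ((k : ℝ≥0) + 1) / ((n : ℝ≥0) + 1) := measurable_from_top
    exact this.comp hfl
  set Ak : ℕ → Set Ω := fun k => A ∩ {ω | ⌊((n : ℝ≥0) + 1) * finVal S ω⌋₊ = k} with hAk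
  have hAkm : ∀ k, MeasurableSet (Ak k) := fun k => hAm.inter (hfl (measurableSet_singleton k))
  have hd : Pairwise (Function.onFun Disjoint Ak) := by
    intro i j hij
    refine Set.disjoint_left.2 fun ω hi hj => hij ?_
    exact hi.2.symm.trans hj.2
  have hU : A = ⋃ k, Ak k := by
    ext ω
    simp [hAk]
  have hraw : ∀ k : ℕ, MeasurableSet[rawPast ξ (((k : ℝ≥0) + 1) / ((n : ℝ≥0) + 1))] (Ak k) := by
    intro k
    -- The grid time is constant on each cell `k/(n+1) ≤ S < (k+1)/(n+1)`, and the cell is known to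
    -- the raw past at its right end, so the Markov property at a fixed time applies.
    have e : Ak k = (A ∩ {ω | S ω < ((((k : ℝ≥0) + 1) / ((n : ℝ≥0) + 1) : ℝ≥0) : WithTop ℝ≥0)}) \
        (Set.univ ∩ {ω | S ω < (((k : ℝ≥0) / ((n : ℝ≥0) + 1) : ℝ≥0) : WithTop ℝ≥0)}) := by
      ext ω
      simp only [hAk, Set.mem_inter_iff, Set.mem_sdiff, Set.mem_ofPred_eq, Set.mem_univ, true_and,
        and_assoc]
      refine and_congr_right fun hω => ?_
      rw [← coe_finVal (hAS hω), WithTop.coe_lt_coe, WithTop.coe_lt_coe, not_lt,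
        Nat.floor_eq_iff (by positivity), lt_div_iff₀ hn, div_le_iff₀ hn, and_comm,
        mul_comm]
    rw [e]
    refine (measurableSet_rawPast_inter_lt hS hA _).diff ?_
    refine rawPast_mono ξ ?_ _ (measurableSet_rawPast_inter_lt hS (MeasurableSet.univ) _)
    gcongr
    exact le_self_add
  have hBm : MeasurableSet {ω | shiftAll (gridAbove n (finVal S ω)) (fun i => ξ i ω) ∈ B} :=
    measurable_shiftAll_random h.measurable hg hB
  conv_lhs => rw [hU]
  conv_rhs => rw [hU]
  rw [Set.iUnion_inter, measure_iUnion (fun i j hij => (hd hij).mono Set.inter_subset_left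
    Set.inter_subset_left) (fun k => (hAkm k).inter hBm), lintegral_iUnion hAkm hd]
  refine tsum_congr fun k => ?_
  have hk : ∀ ω ∈ Ak k, gridAbove n (finVal S ω) = ((k : ℝ≥0) + 1) / ((n : ℝ≥0) + 1) := by
    intro ω hω
    have : ⌊((n : ℝ≥0) + 1) * finVal S ω⌋₊ = k := hω.2
    rw [gridAbove, this]
  rw [setLIntegral_congr_fun (g := fun ω =>
    X.vecKernel ι (fun i => ξ i ω (((k : ℝ≥0) + 1) / ((n : ℝ≥0) + 1))) B) (hAkm k)
    (fun ω hω => by simp only [hk ω hω]), ← h.markov _ _ (hraw k) B hB]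
  congr 1
  ext ω
  simp only [Set.mem_inter_iff, Set.mem_ofPred_eq]
  refine and_congr_right fun hω => ?_
  rw [hk ω hω]

include hS in
/-- The strong Markov property. -/
theorem strong {A : Set Ω} (hA : MeasurableSet[hS.measurableSpace] A)
    (hAS : A ⊆ {ω | S ω < ⊤}) :
    (μ.restrict A).map (fun ω => shiftAll (finVal S ω) fun i => ξ i ω) =
      (μ.restrict A).bind fun ω => X.vecKernel ι fun i => ξ i ω (finVal S ω) := by
  have hAm : MeasurableSet A := hS.measurableSpace_le _ hA
  have hs : Measurable (finVal S) := measurable_finVal hS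
  have hg : ∀ n, Measurable fun ω => gridAbove n (finVal S ω) := by
    intro n
    have : Measurable fun k : ℕ => ((k : ℝ≥0) + 1) / ((n : ℝ≥0) + 1) := measurable_from_top
    exact this.comp (Nat.measurable_floor.comp (hs.const_mul _))
  have hm : ∀ {s : Ω → ℝ≥0}, Measurable s → Measurable fun ω =>
      X.vecKernel ι fun i => ξ i ω (s ω) := fun hs =>
    (X.vecKernel ι).measurable.comp (measurable_apply_all_random h.measurable hs)
  -- Tested on products of functions in `C₀(E)`, the identity at grid times passes to the limit: on
  -- the left by right-continuity of the paths, on the right also by continuity of `Ψ`.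
  refine measure_vec_ext fun J f hf => ?_
  obtain ⟨Ψ, h1, h2, h3⟩ := X.exists_continuous_lintegral_vecKernel J hf
  have hJ := measurable_prod_apply J f
  have hgrid : ∀ n, ∫⁻ ω in A, ∏ p ∈ J,
      ENNReal.ofReal (f p (ξ p.1 ω (gridAbove n (finVal S ω) + p.2))) ∂μ =
      ∫⁻ ω in A, ENNReal.ofReal (Ψ fun i => ξ i ω (gridAbove n (finVal S ω))) ∂μ := by
    intro n
    have e : (μ.restrict A).map
        (fun ω => shiftAll (gridAbove n (finVal S ω)) fun i => ξ i ω) =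
        (μ.restrict A).bind fun ω => X.vecKernel ι fun i => ξ i ω (gridAbove n (finVal S ω)) := by
      ext B hB
      rw [Measure.map_apply (measurable_shiftAll_random h.measurable (hg n)) hB,
        Measure.restrict_apply (measurable_shiftAll_random h.measurable (hg n) hB),
        Measure.bind_apply hB (hm (hg n)).aemeasurable, Set.inter_comm]
      exact h.strong_grid hS hA hAS n hB
    have e' := congrArg (fun ν => ∫⁻ w, ∏ p ∈ J, ENNReal.ofReal (f p (w p.1 p.2)) ∂ν) e
    refine (lintegral_map hJ (measurable_shiftAll_random h.measurable (hg n))).symm.trans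
      (e'.trans ?_)
    refine (Measure.lintegral_bind (hm (hg n)).aemeasurable hJ.aemeasurable).trans ?_
    exact lintegral_congr fun ω => h3 _
  rw [lintegral_map hJ (measurable_shiftAll_random h.measurable hs),
    Measure.lintegral_bind (hm hs).aemeasurable hJ.aemeasurable]
  have hrhs : ∫⁻ ω in A, ∫⁻ w, ∏ p ∈ J, ENNReal.ofReal (f p (w p.1 p.2))
      ∂(X.vecKernel ι fun i => ξ i ω (finVal S ω)) ∂μ =
      ∫⁻ ω in A, ENNReal.ofReal (Ψ fun i => ξ i ω (finVal S ω)) ∂μ :=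
    lintegral_congr fun ω => h3 _
  rw [hrhs]
  have l1 : Tendsto (fun n => ∫⁻ ω in A, ∏ p ∈ J,
      ENNReal.ofReal (f p (ξ p.1 ω (gridAbove n (finVal S ω) + p.2))) ∂μ) atTop
      (𝓝 (∫⁻ ω in A, ∏ p ∈ J, ENNReal.ofReal (f p (ξ p.1 ω (finVal S ω + p.2))) ∂μ)) := by
    refine tendsto_lintegral_of_dominated_convergence 1 ?_ ?_ ?_ ?_
    · intro n
      exact hJ.comp (measurable_shiftAll_random h.measurable (hg n))
    · exact fun n => Eventually.of_forall fun ω =>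
        Finset.prod_le_one' fun p _ => ENNReal.ofReal_le_one.2 (hf p _).2
    · simp
    · refine Eventually.of_forall fun ω => ?_
      refine ENNReal.tendsto_finsetProd_of_ne_top J (fun p _ => ?_) fun p _ => ENNReal.ofReal_ne_top
      refine (ENNReal.continuous_ofReal.comp (f p).continuous).continuousAt.tendsto.comp ?_
      refine ((ξ p.1 ω).rightCont _).tendsto.comp (tendsto_nhdsWithin_iff.2 ⟨?_, ?_⟩)
      · exact (tendsto_nhdsWithin_iff.1 (tendsto_gridAbove (finVal S ω))).1.add_const p.2
      · refine Eventually.of_forall fun n => ?_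
        exact add_le_add_left (lt_gridAbove n _).le p.2
  have l2 : Tendsto (fun n => ∫⁻ ω in A,
      ENNReal.ofReal (Ψ fun i => ξ i ω (gridAbove n (finVal S ω))) ∂μ) atTop
      (𝓝 (∫⁻ ω in A, ENNReal.ofReal (Ψ fun i => ξ i ω (finVal S ω)) ∂μ)) := by
    refine tendsto_lintegral_of_dominated_convergence 1 ?_ ?_ ?_ ?_
    · intro n
      have : Measurable fun x : ι → E => ENNReal.ofReal (Ψ x) := by
        have hk := hJ.lintegral_kernel (κ := X.vecKernel ι)
        simpa only [h3] using hk
      exact this.comp (measurable_apply_all_random h.measurable (hg n))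
    · exact fun n => Eventually.of_forall fun ω => ENNReal.ofReal_le_one.2 (h2 _).2
    · simp
    · refine Eventually.of_forall fun ω => ?_
      refine (ENNReal.continuous_ofReal.comp h1).continuousAt.tendsto.comp ?_
      rw [tendsto_pi_nhds]
      exact fun i => ((ξ i ω).rightCont _).tendsto.comp (tendsto_gridAbove (finVal S ω))
  exact tendsto_nhds_unique l1 (l2.congr fun n => (hgrid n).symm)

include hS in
/-- The strong Markov property, jointly with a variable that is measurable at the
stopping time. -/
theorem strong_joint {A : Set Ω} (hA : MeasurableSet[hS.measurableSpace] A)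
    (hAS : A ⊆ {ω | S ω < ⊤}) {Γ : Type*} [MeasurableSpace Γ] {V : Ω → Γ}
    (hV' : Measurable V)
    (hV : ∀ C, MeasurableSet C → MeasurableSet[hS.measurableSpace] (A ∩ V ⁻¹' C)) {g : Γ × (ι → CadlagPath E) → ℝ≥0∞}
    (hg : Measurable g) :
    ∫⁻ ω in A, g (V ω, shiftAll (finVal S ω) fun i => ξ i ω) ∂μ =
      ∫⁻ ω in A, ∫⁻ w, g (V ω, w) ∂(X.vecKernel ι fun i => ξ i ω (finVal S ω)) ∂μ := by
  have hAm : MeasurableSet A := hS.measurableSpace_le _ hA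
  have hs : Measurable (finVal S) := measurable_finVal hS
  have hθ := measurable_shiftAll_random h.measurable hs
  have hmk : Measurable fun ω => X.vecKernel ι fun i => ξ i ω (finVal S ω) :=
    (X.vecKernel ι).measurable.comp (measurable_apply_all_random h.measurable hs)
  set κ : Kernel Ω (ι → CadlagPath E) :=
    (X.vecKernel ι).comap (fun ω i => ξ i ω (finVal S ω))
      (measurable_apply_all_random h.measurable hs) with hκ
  have hp : Measurable fun p : Ω × (ι → CadlagPath E) => (V p.1, p.2) :=
    (hV'.comp measurable_fst).prodMk measurable_snd
  have e : (μ.restrict A).map (fun ω => (V ω, shiftAll (finVal S ω) fun i => ξ i ω)) =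
      ((μ.restrict A) ⊗ₘ κ).map fun p => (V p.1, p.2) := by
    refine Measure.ext_prod fun {C B} hC hB => ?_
    have hVC : MeasurableSet (V ⁻¹' C) := hV' hC
    rw [Measure.map_apply (hV'.prodMk hθ) (hC.prod hB), Measure.map_apply hp (hC.prod hB),
      Measure.restrict_apply (hV'.prodMk hθ (hC.prod hB))]
    have e1 : (fun p : Ω × (ι → CadlagPath E) => (V p.1, p.2)) ⁻¹' C ×ˢ B = (V ⁻¹' C) ×ˢ B := rfl
    rw [e1, Measure.compProd_apply_prod hVC hB, Measure.restrict_restrict hVC, Set.inter_comm _ A]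
    have e2 := DFunLike.congr_fun (h.strong hS (A := A ∩ V ⁻¹' C)
      (hV C hC) (Set.inter_subset_left.trans hAS)) B
    rw [Measure.map_apply hθ hB, Measure.restrict_apply (hθ hB), Measure.bind_apply hB
      hmk.aemeasurable] at e2
    rw [Set.inter_comm (V ⁻¹' C) A]
    refine Eq.trans ?_ e2
    congr 1
    ext ω
    simp only [Set.mem_inter_iff, Set.mem_preimage, Set.mem_prod]
    tauto
  have e' := congrArg (fun ν => ∫⁻ p, g p ∂ν) e
  refine (lintegral_map hg (hV'.prodMk hθ)).symm.trans (e'.trans ?_)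
  exact (lintegral_map hg hp).trans (Measure.lintegral_compProd (hg.comp hp))

end IsMarkovSystem

end StrongMarkov

/-! ### Quasi-left-continuity -/

section QuasiLeftContinuity

theorem CadlagPath.exists_tendsto_of_monotone {E : Type*} [TopologicalSpace E] (w : CadlagPath E)
    {s : ℕ → ℝ≥0} (hs : Monotone s) {R : ℝ≥0} (hR : Tendsto s atTop (𝓝 R)) :
    ∃ l, Tendsto (fun n => w (s n)) atTop (𝓝 l) := by
  by_cases h : ∃ n, R ≤ s n
  · obtain ⟨n, hn⟩ := h
    refine ⟨w R, tendsto_const_nhds.congr' ?_⟩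
    filter_upwards [eventually_ge_atTop n] with k hk
    exact congrArg w (le_antisymm (hn.trans (hs hk)) (hs.ge_of_tendsto hR k))
  · push Not at h
    obtain ⟨l, hl⟩ := w.leftLim R
    exact ⟨l, hl.comp (tendsto_nhdsWithin_iff.2 ⟨hR, Eventually.of_forall h⟩)⟩

variable {E : Type*} [TopologicalSpace E] [MeasurableSpace E] {ι : Type*}
  [LocallyCompactSpace E] [SecondCountableTopology E] [T2Space E] [BorelSpace E]

theorem FellerProcess.law_map_apply (X : FellerProcess E) (x : E) (t : ℝ≥0) :
    (X.law x).map (fun w : CadlagPath E => w t) = X.semigroup t x := by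
  ext B hB
  have h := X.markov_property x 0 t Set.univ B MeasurableSet.univ hB
  rw [Set.univ_inter, zero_add] at h
  refine (Measure.map_apply (CadlagPath.measurable_apply t) hB).trans (h.trans ?_)
  rw [Measure.restrict_univ]
  refine (lintegral_congr_ae (g := fun _ => X.semigroup t x B) ?_).trans (by simp)
  filter_upwards [X.start x] with w hw
  exact congrArg (fun y => X.semigroup t y B) hw

theorem FellerProcess.lintegral_vecKernel_pair (X : FellerProcess E) (x : ι → E) (i : ι) (t : ℝ≥0)
    (f : E → ℝ≥0∞) {g : E → ℝ≥0∞} (hg : Measurable g) :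
    ∫⁻ w, f (w i 0) * g (w i t) ∂(X.vecKernel ι x) =
      f (x i) * ∫⁻ y, g y ∂(X.semigroup t (x i)) := by
  have h1 : ∫⁻ w, f (w i 0) * g (w i t) ∂(X.vecKernel ι x) =
      ∫⁻ w, f (x i) * g (w i t) ∂(X.vecKernel ι x) := by
    refine lintegral_congr_ae ?_
    filter_upwards [X.vecKernel_start x i] with w hw
    exact congrArg (fun y => f y * g (w i t)) hw
  have hm : Measurable fun w : CadlagPath E => w t := CadlagPath.measurable_apply t
  have h3 : ∫⁻ w, g (w i t) ∂(X.vecKernel ι x) = ∫⁻ y, g y ∂(X.semigroup t (x i)) := by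
    rw [← X.law_map_apply (x i) t, lintegral_map hg hm]
    conv_rhs => rw [← Measure.infinitePi_map_eval (fun i => X.law (x i)) i]
    exact (lintegral_map (hg.comp hm) (measurable_pi_apply i)).symm
  refine h1.trans ((lintegral_const_mul (f (x i))
    (hg.comp (hm.comp (measurable_pi_apply i)))).trans ?_)
  exact congrArg (fun y => f (x i) * y) h3

theorem FellerProcess.tendsto_lintegral_semigroup (X : FellerProcess E) {f : C₀(E, ℝ)}
    (hf : ∀ x, f x ∈ Set.Icc (0 : ℝ) 1) (x : E) :
    Tendsto (fun t : ℝ≥0 => ∫⁻ y, ENNReal.ofReal (f y) ∂(X.semigroup t x)) (𝓝[>] 0)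
      (𝓝 (ENNReal.ofReal (f x))) := by
  have h := (X.isFeller.strongly_continuous f).tendsto_at x
  refine ((ENNReal.continuous_ofReal.tendsto _).comp h).congr fun t => ?_
  refine ofReal_integral_eq_lintegral_ofReal ?_ (Eventually.of_forall fun y => (hf y).1)
  exact Integrable.of_bound f.continuous.aestronglyMeasurable 1
    (Eventually.of_forall fun y => by rw [Real.norm_of_nonneg (hf y).1]; exact (hf y).2)

namespace IsMarkovSystem

variable {X : FellerProcess E} {Ω : Type*} [m : MeasurableSpace Ω] {μ : Measure Ω}
  [IsFiniteMeasure μ] {ξ : ι → Ω → CadlagPath E} (h : IsMarkovSystem X μ ξ)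

theorem lintegral_pair {S : Ω → WithTop ℝ≥0} (hS : IsStoppingTime (pastFiltration ξ h.measurable) S)
    (hfin : ∀ ω, S ω < ⊤) (i : ι) (t : ℝ≥0) {f g : E → ℝ≥0∞} (hf : Measurable f)
    (hg : Measurable g) :
    ∫⁻ ω, f (ξ i ω (finVal S ω)) * g (ξ i ω (finVal S ω + t)) ∂μ =
      ∫⁻ ω, f (ξ i ω (finVal S ω)) * ∫⁻ y, g y ∂(X.semigroup t (ξ i ω (finVal S ω))) ∂μ := by
  have h0 := h.strong hS (A := Set.univ) MeasurableSet.univ fun ω _ => hfin ω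
  rw [Measure.restrict_univ] at h0
  have hs : Measurable (finVal S) := measurable_finVal hS
  have hm : Measurable fun w : ι → CadlagPath E => f (w i 0) * g (w i t) :=
    (hf.comp ((CadlagPath.measurable_apply 0).comp (measurable_pi_apply i))).mul
      (hg.comp ((CadlagPath.measurable_apply t).comp (measurable_pi_apply i)))
  have e := congrArg (fun ν => ∫⁻ w, f (w i 0) * g (w i t) ∂ν) h0
  have e1 : ∫⁻ ω, f (ξ i ω (finVal S ω + 0)) * g (ξ i ω (finVal S ω + t)) ∂μ =
      ∫⁻ ω, f (ξ i ω (finVal S ω)) * ∫⁻ y, g y ∂(X.semigroup t (ξ i ω (finVal S ω))) ∂μ := by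
    refine (lintegral_map hm (measurable_shiftAll_random h.measurable hs)).symm.trans (e.trans ?_)
    refine (Measure.lintegral_bind ((X.vecKernel ι).measurable.comp
      (measurable_apply_all_random h.measurable hs)).aemeasurable hm.aemeasurable).trans ?_
    exact lintegral_congr fun ω => X.lintegral_vecKernel_pair _ i t f hg
  simpa only [add_zero] using e1

/-- Along a bounded increasing sequence of stopping times, each path converges to its value at the
limit. -/
theorem ae_tendsto_of_bounded {S : ℕ → Ω → WithTop ℝ≥0}
    (hS : ∀ n, IsStoppingTime (pastFiltration ξ h.measurable) (S n))
    (hmono : ∀ ω, Monotone fun n => S n ω) {K : ℝ≥0} (hK : ∀ n ω, S n ω ≤ K) (i : ι) :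
    ∀ᵐ ω ∂μ, ∀ R, Tendsto (fun n => finVal (S n) ω) atTop (𝓝 R) →
      Tendsto (fun n => ξ i ω (finVal (S n) ω)) atTop (𝓝 (ξ i ω R)) := by
  have : PolishSpace E := polishSpace_of_locallyCompact
  have hfin : ∀ n ω, S n ω < ⊤ := fun n ω => (hK n ω).trans_lt (WithTop.coe_lt_top K)
  have hs : ∀ n, Measurable (finVal (S n)) := fun n => measurable_finVal (hS n)
  have hmono' : ∀ ω, Monotone fun n => finVal (S n) ω := by
    intro ω n k hnk
    rw [← WithTop.coe_le_coe, coe_finVal (hfin n ω), coe_finVal (hfin k ω)]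
    exact hmono ω hnk
  have hbdd : ∀ ω, BddAbove (Set.range fun n => finVal (S n) ω) := by
    refine fun ω => ⟨K, ?_⟩
    rintro - ⟨n, rfl⟩
    change finVal (S n) ω ≤ K
    rw [← WithTop.coe_le_coe, coe_finVal (hfin n ω)]
    exact hK n ω
  set R : Ω → ℝ≥0 := fun ω => ⨆ n, finVal (S n) ω with hRdef
  have hR : ∀ ω, Tendsto (fun n => finVal (S n) ω) atTop (𝓝 (R ω)) := fun ω =>
    tendsto_atTop_ciSup (hmono' ω) (hbdd ω)
  have hRm : Measurable R := measurable_of_tendsto_metrizable hs (tendsto_pi_nhds.2 hR)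
  have hadd : ∀ ω (t : ℝ≥0), Tendsto (fun n => finVal (S n) ω + t) atTop (𝓝 (R ω + t)) :=
    fun ω t => (hR ω).add_const t
  -- `M t` is the limit of the positions at times `S n + t`. The aim is that `M 0`, a left limit if
  -- `S n` stays below `R`, equals the position at `R`.
  choose M hM using fun (t : ℝ≥0) ω => (ξ i ω).exists_tendsto_of_monotone
    (s := fun n => finVal (S n) ω + t) (fun n k hnk => add_le_add_left (hmono' ω hnk) t) (hadd ω t)
  have hM0 : ∀ ω, Tendsto (fun n => ξ i ω (finVal (S n) ω)) atTop (𝓝 (M 0 ω)) := by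
    simpa only [add_zero] using hM 0
  have hξn : ∀ n, Measurable fun ω => ξ i ω (finVal (S n) ω) := fun n =>
    CadlagPath.measurable_apply_random (h.measurable i) (hs n)
  have hξR : Measurable fun ω => ξ i ω (R ω) :=
    CadlagPath.measurable_apply_random (h.measurable i) hRm
  have hMm : ∀ t, Measurable (M t) := fun t => measurable_of_tendsto_metrizable
    (fun n => CadlagPath.measurable_apply_random (h.measurable i) ((hs n).add_const t))
    (tendsto_pi_nhds.2 (hM t))
  have hu : Tendsto (fun k : ℕ => 1 / ((k : ℝ≥0) + 1)) atTop (𝓝[>] 0) :=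
    tendsto_nhdsWithin_iff.2 ⟨tendsto_one_div_nnreal, Eventually.of_forall fun k => by
      have : (0 : ℝ≥0) < 1 / ((k : ℝ≥0) + 1) := by positivity
      exact this⟩
  -- For small `t > 0` the times `S n + t` eventually lie slightly above `R`, where right-continuity
  -- keeps the path in a given closed neighbourhood of its value at `R`.
  have hMlim : ∀ ω, Tendsto (fun k : ℕ => M (1 / ((k : ℝ≥0) + 1)) ω) atTop
      (𝓝 (ξ i ω (R ω))) := by
    intro ω
    refine (closed_nhds_basis (ξ i ω (R ω))).tendsto_right_iff.2 fun V hV => ?_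
    have h1 := ((ξ i ω).rightCont (R ω)).tendsto.eventually hV.1
    obtain ⟨δ, hδ, h2⟩ := (mem_nhdsGE_iff_exists_Ico_subset).1 h1
    have h3 : ∀ᶠ k : ℕ in atTop, R ω + 1 / ((k : ℝ≥0) + 1) < δ := by
      have := (tendsto_one_div_nnreal.const_add (R ω))
      rw [add_zero] at this
      exact this.eventually (Iio_mem_nhds hδ)
    filter_upwards [h3] with k hk
    refine hV.2.mem_of_tendsto (hM _ ω) ?_
    have hpos : R ω < R ω + 1 / ((k : ℝ≥0) + 1) := lt_add_of_pos_right _ (by positivity)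
    filter_upwards [(hadd ω _).eventually (Ioo_mem_nhds hpos hk)] with n hn
    exact h2 ⟨hn.1.le, hn.2⟩
  -- The strong Markov property at `S n` relates the position at `S n + t` to the semigroup applied
  -- to `f`. The limit `n → ∞` uses the Feller property; then `t → 0` uses `hMlim` and strong
  -- continuity.
  have key : ∀ (F : E → ℝ≥0∞) (f : C₀(E, ℝ)), Continuous F → (∀ x, F x ≤ 1) →
      (∀ x, f x ∈ Set.Icc (0 : ℝ) 1) →
      ∫⁻ ω, F (M 0 ω) * ENNReal.ofReal (f (ξ i ω (R ω))) ∂μ =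
        ∫⁻ ω, F (M 0 ω) * ENNReal.ofReal (f (M 0 ω)) ∂μ := by
    intro F f hF hF1 hf
    have hfm : Measurable fun x => ENNReal.ofReal (f x) :=
      ENNReal.measurable_ofReal.comp f.continuous.measurable
    have hfc : Continuous fun x => ENNReal.ofReal (f x) :=
      ENNReal.continuous_ofReal.comp f.continuous
    have hf1 : ∀ x, ENNReal.ofReal (f x) ≤ 1 := fun x => ENNReal.ofReal_le_one.2 (hf x).2
    have step : ∀ t, ∫⁻ ω, F (M 0 ω) * ENNReal.ofReal (f (M t ω)) ∂μ =
        ∫⁻ ω, F (M 0 ω) * ∫⁻ y, ENNReal.ofReal (f y) ∂(X.semigroup t (M 0 ω)) ∂μ := by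
      intro t
      obtain ⟨g, hg1, hg⟩ := X.exists_semigroup_apply t hf
      have l1 : Tendsto (fun n => ∫⁻ ω, F (ξ i ω (finVal (S n) ω)) *
          ENNReal.ofReal (f (ξ i ω (finVal (S n) ω + t))) ∂μ) atTop
          (𝓝 (∫⁻ ω, F (M 0 ω) * ENNReal.ofReal (f (M t ω)) ∂μ)) := by
        refine tendsto_lintegral_of_dominated_convergence 1 (fun n => ?_) (fun n => ?_) ?_ ?_
        · exact (hF.measurable.comp (hξn n)).mul (hfm.comp
            (CadlagPath.measurable_apply_random (h.measurable i) ((hs n).add_const t)))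
        · exact Eventually.of_forall fun ω => mul_le_one' (hF1 _) (hf1 _)
        · simp
        · refine Eventually.of_forall fun ω => ENNReal.Tendsto.mul ?_ (Or.inr ?_) ?_ (Or.inr ?_)
          · exact (hF.tendsto _).comp (hM0 ω)
          · exact ENNReal.ofReal_ne_top
          · exact (hfc.tendsto _).comp (hM t ω)
          · exact ((hF1 _).trans_lt ENNReal.one_lt_top).ne
      have l2 : Tendsto (fun n => ∫⁻ ω, F (ξ i ω (finVal (S n) ω)) *
          ENNReal.ofReal (g (ξ i ω (finVal (S n) ω))) ∂μ) atTop
          (𝓝 (∫⁻ ω, F (M 0 ω) * ENNReal.ofReal (g (M 0 ω)) ∂μ)) := by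
        refine tendsto_lintegral_of_dominated_convergence 1 (fun n => ?_) (fun n => ?_) ?_ ?_
        · exact (hF.measurable.comp (hξn n)).mul (ENNReal.measurable_ofReal.comp
            (g.continuous.measurable.comp (hξn n)))
        · exact Eventually.of_forall fun ω =>
            mul_le_one' (hF1 _) (ENNReal.ofReal_le_one.2 (hg1 _).2)
        · simp
        · refine Eventually.of_forall fun ω => ENNReal.Tendsto.mul ?_ (Or.inr ?_) ?_ (Or.inr ?_)
          · exact (hF.tendsto _).comp (hM0 ω)
          · exact ENNReal.ofReal_ne_top
          · exact ((ENNReal.continuous_ofReal.comp g.continuous).tendsto _).comp (hM0 ω)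
          · exact ((hF1 _).trans_lt ENNReal.one_lt_top).ne
      simp only [hg]
      refine tendsto_nhds_unique l1 (l2.congr fun n => ?_)
      rw [h.lintegral_pair (hS n) (hfin n) i t hF.measurable hfm]
      simp only [hg]
    have l1 : Tendsto (fun k : ℕ => ∫⁻ ω, F (M 0 ω) *
        ENNReal.ofReal (f (M (1 / ((k : ℝ≥0) + 1)) ω)) ∂μ) atTop
        (𝓝 (∫⁻ ω, F (M 0 ω) * ENNReal.ofReal (f (ξ i ω (R ω))) ∂μ)) := by
      refine tendsto_lintegral_of_dominated_convergence 1 (fun n => ?_) (fun n => ?_) ?_ ?_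
      · exact (hF.measurable.comp (hMm 0)).mul (hfm.comp (hMm _))
      · exact Eventually.of_forall fun ω => mul_le_one' (hF1 _) (hf1 _)
      · simp
      · refine Eventually.of_forall fun ω => ENNReal.Tendsto.const_mul ?_ (Or.inr ?_)
        · exact (hfc.tendsto _).comp (hMlim ω)
        · exact ((hF1 _).trans_lt ENNReal.one_lt_top).ne
    have l2 : Tendsto (fun k : ℕ => ∫⁻ ω, F (M 0 ω) *
        ∫⁻ y, ENNReal.ofReal (f y) ∂(X.semigroup (1 / ((k : ℝ≥0) + 1)) (M 0 ω)) ∂μ) atTop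
        (𝓝 (∫⁻ ω, F (M 0 ω) * ENNReal.ofReal (f (M 0 ω)) ∂μ)) := by
      refine tendsto_lintegral_of_dominated_convergence 1 (fun n => ?_) (fun n => ?_) ?_ ?_
      · exact (hF.measurable.comp (hMm 0)).mul (hfm.lintegral_kernel.comp (hMm 0))
      · refine Eventually.of_forall fun ω => mul_le_one' (hF1 _) ?_
        have := X.isFeller.markov (1 / ((n : ℝ≥0) + 1))
        exact (lintegral_mono hf1).trans (by simp)
      · simp
      · refine Eventually.of_forall fun ω => ENNReal.Tendsto.const_mul ?_ (Or.inr ?_)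
        · exact (X.tendsto_lintegral_semigroup hf _).comp hu
        · exact ((hF1 _).trans_lt ENNReal.one_lt_top).ne
    exact tendsto_nhds_unique l1 (l2.congr fun k => (step _).symm)
  have hp1 : Measurable fun ω => (M 0 ω, ξ i ω (R ω)) := (hMm 0).prodMk hξR
  have hp2 : Measurable fun ω => (M 0 ω, M 0 ω) := (hMm 0).prodMk (hMm 0)
  -- Equality of these joint laws puts the first pair almost surely on the diagonal.
  have hlaw : μ.map (fun ω => (M 0 ω, ξ i ω (R ω))) = μ.map fun ω => (M 0 ω, M 0 ω) := by
    refine measure_ext_of_zeroAtInfty (fun (b : Bool) (p : E × E) => cond b p.2 p.1) ?_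
      fun J f hf => ?_
    · rw [iSup_bool_eq, sup_comm]
      rfl
    · have hfm : ∀ b, Measurable fun x => ENNReal.ofReal (f b x) := fun b =>
        ENNReal.measurable_ofReal.comp (f b).continuous.measurable
      have hm : Measurable fun p : E × E =>
          ∏ b ∈ J, ENNReal.ofReal (f b (cond b p.2 p.1)) := by
        refine Finset.measurable_fun_prod J fun b _ => ?_
        cases b
        · exact (hfm false).comp measurable_fst
        · exact (hfm true).comp measurable_snd
      rw [lintegral_map hm hp1, lintegral_map hm hp2]
      by_cases ht : true ∈ J
      · by_cases hb : false ∈ J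
        · have hJ : J = {false, true} := by
            ext b
            cases b <;> simp [ht, hb]
          simp only [hJ, Finset.prod_pair (show false ≠ true by decide), cond_true, cond_false]
          exact key (fun x => ENNReal.ofReal (f false x)) (f true)
            (ENNReal.continuous_ofReal.comp (f false).continuous)
            (fun x => ENNReal.ofReal_le_one.2 (hf _ x).2) (hf true)
        · have hJ : J = {true} := by
            ext b
            cases b <;> simp [ht, hb]
          simp only [hJ, Finset.prod_singleton, cond_true]
          have := key 1 (f true) continuous_one (fun _ => le_rfl) (hf true)
          simpa only [Pi.one_apply, one_mul] using this
      · refine lintegral_congr fun ω => Finset.prod_congr rfl fun b hb => ?_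
        cases b
        · rfl
        · exact absurd hb ht
  have hdiag : MeasurableSet (Set.diagonal E)ᶜ := measurableSet_diagonal.compl
  have h0 : μ {ω | ξ i ω (R ω) ≠ M 0 ω} = 0 := by
    have := DFunLike.congr_fun hlaw (Set.diagonal E)ᶜ
    rw [Measure.map_apply hp1 hdiag, Measure.map_apply hp2 hdiag] at this
    refine measure_mono_null (t := (fun ω => (M 0 ω, ξ i ω (R ω))) ⁻¹' (Set.diagonal E)ᶜ) ?_ ?_
    · exact fun ω hω e => hω e.symm
    · rw [this]
      refine measure_mono_null (t := ∅) ?_ measure_empty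
      exact fun ω hω => hω rfl
  have h1 : ∀ᵐ ω ∂μ, ξ i ω (R ω) = M 0 ω := by
    rw [ae_iff]
    exact h0
  filter_upwards [h1] with ω hω R' hR'
  rw [tendsto_nhds_unique hR' (hR ω)]
  exact hω ▸ hM0 ω

/-- Quasi-left-continuity: paths do not jump at the limits of strictly increasing sequences of
stopping times. -/
theorem ae_continuousAt {S : ℕ → Ω → WithTop ℝ≥0}
    (hS : ∀ n, IsStoppingTime (pastFiltration ξ h.measurable) (S n))
    (hmono : ∀ ω, Monotone fun n => S n ω) (i : ι) :
    ∀ᵐ ω ∂μ, ∀ t : ℝ≥0, (∀ n, S n ω < t) → IsLUB (Set.range fun n => S n ω) (t : WithTop ℝ≥0) →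
      ContinuousAt (ξ i ω) t := by
  -- Stopping times cut off at an integer `K ≥ t` are bounded and unchanged wherever they lie below
  -- `t`.
  have hK := fun K : ℕ => h.ae_tendsto_of_bounded
    (S := fun n ω => min (S n ω) ((K : ℝ≥0) : WithTop ℝ≥0))
    (fun n => (hS n).min_const _) (fun ω n k hnk => min_le_min_right _ (hmono ω hnk))
    (K := K) (fun n ω => min_le_right _ _) i
  filter_upwards [ae_all_iff.2 hK] with ω hω t ht hlub
  obtain ⟨K, hK⟩ := exists_nat_ge t
  have e : ∀ n, (finVal (fun ω => min (S n ω) ((K : ℝ≥0) : WithTop ℝ≥0)) ω : WithTop ℝ≥0) =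
      S n ω := by
    intro n
    have h1 : min (S n ω) ((K : ℝ≥0) : WithTop ℝ≥0) = S n ω :=
      min_eq_left ((ht n).le.trans (WithTop.coe_le_coe.2 hK))
    rw [coe_finVal, h1]
    exact h1.trans_lt ((ht n).trans_le le_top)
  set s : ℕ → ℝ≥0 := fun n => finVal (fun ω => min (S n ω) ((K : ℝ≥0) : WithTop ℝ≥0)) ω with hs
  have hst : ∀ n, s n < t := fun n => WithTop.coe_lt_coe.1 ((e n).trans_lt (ht n))
  have hsm : Monotone s := fun n k hnk =>
    WithTop.coe_le_coe.1 (((e n).trans_le (hmono ω hnk)).trans_eq (e k).symm)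
  have hlub' : IsLUB (Set.range s) t := by
    refine ⟨?_, fun b hb => ?_⟩
    · rintro - ⟨n, rfl⟩
      exact (hst n).le
    · refine WithTop.coe_le_coe.1 (hlub.2 ?_)
      rintro - ⟨n, rfl⟩
      exact (e n).symm.trans_le (WithTop.coe_le_coe.2 (hb ⟨n, rfl⟩))
  have hlim : Tendsto s atTop (𝓝 t) := tendsto_atTop_isLUB hsm hlub'
  obtain ⟨l, hl⟩ := (ξ i ω).leftLim t
  have h1 := hl.comp (tendsto_nhdsWithin_iff.2 ⟨hlim, Eventually.of_forall hst⟩)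
  have h2 := tendsto_nhds_unique h1 (hω K t hlim)
  rw [h2] at hl
  refine continuousAt_iff_continuous_left'_right'.2 ⟨hl, ?_⟩
  exact ((ξ i ω).rightCont t).mono Set.Ioi_subset_Ici_self

end IsMarkovSystem

end QuasiLeftContinuity

/-! ### Times at which two paths come close to each other -/

section PairTime

variable {E : Type*} [MetricSpace E]

/-- The infimum of the times at which the paths `x` and `z` are at distance less than `ε`. -/
def nearTime (x z : ℝ≥0 → E) (ε : ℝ) : WithTop ℝ≥0 :=
  ⨅ t ∈ {t : ℝ≥0 | dist (x t) (z t) < ε}, (t : WithTop ℝ≥0)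

theorem nearTime_le {x z : ℝ≥0 → E} {ε : ℝ} {t : ℝ≥0} (h : dist (x t) (z t) < ε) :
    nearTime x z ε ≤ t := iInf₂_le (f := fun (t : ℝ≥0) _ => (t : WithTop ℝ≥0)) t h

theorem nearTime_lt_iff {x z : ℝ≥0 → E} {ε : ℝ} {u : WithTop ℝ≥0} :
    nearTime x z ε < u ↔ ∃ t : ℝ≥0, dist (x t) (z t) < ε ∧ (t : WithTop ℝ≥0) < u := by
  rw [nearTime, iInf_lt_iff]
  refine exists_congr fun t => ?_
  rw [iInf_lt_iff]
  simp

theorem nearTime_anti (x z : ℝ≥0 → E) {ε δ : ℝ} (h : ε ≤ δ) : nearTime x z δ ≤ nearTime x z ε :=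
  le_iInf₂ fun _ ht => nearTime_le (lt_of_lt_of_le ht h)

theorem dist_nearTime_le {x z : ℝ≥0 → E} (hx : IsRC x) (hz : IsRC z) {ε : ℝ} {t : ℝ≥0}
    (h : nearTime x z ε = t) : dist (x t) (z t) ≤ ε := by
  by_contra! hlt
  have h1 : Tendsto (fun s => dist (x s) (z s)) (𝓝[≥] t) (𝓝 (dist (x t) (z t))) :=
    Tendsto.dist (hx t) (hz t)
  obtain ⟨u, hu, hsub⟩ := mem_nhdsGE_iff_exists_Ico_subset.1 (h1.eventually (Ioi_mem_nhds hlt))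
  have : nearTime x z ε < u := h ▸ WithTop.coe_lt_coe.2 hu
  obtain ⟨s, hs, hsu⟩ := nearTime_lt_iff.1 this
  have hts : t ≤ s := WithTop.coe_le_coe.1 (h ▸ nearTime_le hs)
  exact (hsub ⟨hts, WithTop.coe_lt_coe.1 hsu⟩ : ε < _).not_gt hs

/-- The limit of the times at which the paths `x` and `z` come close to each other. -/
def pairTime (x z : ℝ≥0 → E) : WithTop ℝ≥0 := ⨆ n : ℕ, nearTime x z (1 / ((n : ℝ) + 1))

theorem monotone_nearTime (x z : ℝ≥0 → E) :
    Monotone fun n : ℕ => nearTime x z (1 / ((n : ℝ) + 1)) := fun _ _ h =>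
  nearTime_anti x z (Nat.one_div_le_one_div h)

theorem ne_of_lt_pairTime {x z : ℝ≥0 → E} {t : ℝ≥0} (h : (t : WithTop ℝ≥0) < pairTime x z) :
    x t ≠ z t := by
  intro e
  obtain ⟨n, hn⟩ := lt_iSup_iff.1 h
  refine (nearTime_le ?_).not_gt hn
  rw [e, dist_self]
  positivity

/-- The condition that the paths `x` and `z` do not jump at the limit of the times at which they
come close to each other. -/
def NoJump (x z : ℝ≥0 → E) : Prop :=
  ∀ t : ℝ≥0, (∀ n : ℕ, nearTime x z (1 / ((n : ℝ) + 1)) < t) →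
    IsLUB (Set.range fun n : ℕ => nearTime x z (1 / ((n : ℝ) + 1))) (t : WithTop ℝ≥0) →
      ContinuousAt x t ∧ ContinuousAt z t

/-- Either the approach times increase to `t` from strictly below, and continuity at `t` carries the
vanishing distances to the limit, or they equal `t` from some index on, and right-continuity bounds
the distance at `t` by every `1/(k+1)`. -/
theorem eq_of_pairTime_eq {x z : ℝ≥0 → E} (hx : IsRC x) (hz : IsRC z) (hj : NoJump x z) {t : ℝ≥0}
    (h : pairTime x z = t) : x t = z t := by
  have hle : ∀ n : ℕ, nearTime x z (1 / ((n : ℝ) + 1)) ≤ t := fun n =>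
    (le_iSup (fun n : ℕ => nearTime x z (1 / ((n : ℝ) + 1))) n).trans_eq h
  have hlim0 : Tendsto (fun n : ℕ => 1 / ((n : ℝ) + 1)) atTop (𝓝 0) :=
    tendsto_one_div_add_atTop_nhds_zero_nat
  refine dist_le_zero.1 ?_
  by_cases hlt : ∀ n : ℕ, nearTime x z (1 / ((n : ℝ) + 1)) < t
  · have hlub : IsLUB (Set.range fun n : ℕ => nearTime x z (1 / ((n : ℝ) + 1)))
        (t : WithTop ℝ≥0) := h ▸ isLUB_iSup
    obtain ⟨hxt, hzt⟩ := hj t hlt hlub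
    choose s hs using fun n : ℕ => WithTop.ne_top_iff_exists.1 ((hlt n).trans_le le_top).ne
    have hsm : Monotone s := fun n k hnk => WithTop.coe_le_coe.1
      (((hs n).trans_le (monotone_nearTime x z hnk)).trans_eq (hs k).symm)
    have hst : IsLUB (Set.range s) t := by
      refine ⟨?_, fun b hb => WithTop.coe_le_coe.1 (hlub.2 ?_)⟩
      · rintro - ⟨n, rfl⟩
        exact WithTop.coe_le_coe.1 ((hs n).trans_le (hle n))
      · rintro - ⟨n, rfl⟩
        exact (hs n).symm.trans_le (WithTop.coe_le_coe.2 (hb ⟨n, rfl⟩))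
    have hlim := tendsto_atTop_isLUB hsm hst
    exact le_of_tendsto_of_tendsto' ((hxt.tendsto.comp hlim).dist (hzt.tendsto.comp hlim)) hlim0
      fun n => dist_nearTime_le hx hz (hs n).symm
  · push Not at hlt
    obtain ⟨n, hn⟩ := hlt
    refine ge_of_tendsto hlim0 ((eventually_ge_atTop n).mono fun k hk => ?_)
    exact dist_nearTime_le hx hz (le_antisymm (hle k) (hn.trans (monotone_nearTime x z hk)))

end PairTime

/-! ### Adapted versions of coalescing paths and stopping times for meetings -/

section Versions

section

variable {E : Type*} [TopologicalSpace E] [MeasurableSpace E] {ι : Type*}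
  {Ω : Type*} [m : MeasurableSpace Ω] {ξ : ι → Ω → CadlagPath E} {hξ : ∀ i, Measurable (ξ i)}

variable (hξ) in
/-- A random path that is adapted to the filtration generated by the paths `ξ i`. -/
def AdaptedPath (Z : Ω → CadlagPath E) : Prop :=
  ∀ t, Measurable[pastFiltration ξ hξ t] fun ω => Z ω t

theorem adaptedPath_self (i : ι) : AdaptedPath hξ (ξ i) := fun _ =>
  measurable_pastFiltration hξ i le_rfl

theorem AdaptedPath.measurable {Z : Ω → CadlagPath E} (hZ : AdaptedPath hξ Z) : Measurable Z :=
  CadlagPath.measurable_of_apply fun t => (hZ t).mono ((pastFiltration ξ hξ).le t) le_rfl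

/-- The time `T` is the first time at which the path `x` meets the set `Z` of paths. -/
def IsFirstMeeting (x : ℝ≥0 → E) (Z : Set (ℝ≥0 → E)) (T : WithTop ℝ≥0) : Prop :=
  (∀ t : ℝ≥0, (t : WithTop ℝ≥0) < T → ¬ Meets x Z t) ∧ ∀ t : ℝ≥0, T = t → Meets x Z t

end

section

variable {E : Type*} [MetricSpace E] [MeasurableSpace E] {ι : Type*}
  [LocallyCompactSpace E] [SecondCountableTopology E] [BorelSpace E]
  {Ω : Type*} [m : MeasurableSpace Ω] {ξ : ι → Ω → CadlagPath E} {hξ : ∀ i, Measurable (ξ i)}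

/-- By right-continuity, a distance less than `ε` persists for a short time, so countably many times
decide whether the approach time is less than `t`. For a right-continuous filtration this suffices.
-/
theorem isStoppingTime_nearTime {x z : Ω → CadlagPath E} (hx : AdaptedPath hξ x)
    (hz : AdaptedPath hξ z) (ε : ℝ) :
    IsStoppingTime (pastFiltration ξ hξ) fun ω => nearTime (x ω) (z ω) ε := by
  refine isStoppingTime_of_measurableSet_lt_of_isRightContinuous fun t => ?_
  obtain ⟨D, hD, hd⟩ := exists_countable_dense ℝ≥0
  have e : {ω | nearTime (x ω) (z ω) ε < t} =
      ⋃ s ∈ {s ∈ D | s < t}, {ω | dist (x ω s) (z ω s) < ε} := by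
    ext ω
    simp only [Set.mem_ofPred_eq, Set.mem_iUnion, exists_prop, nearTime_lt_iff, WithTop.coe_lt_coe]
    constructor
    · rintro ⟨s, hs, hst⟩
      have h1 : Tendsto (fun s => dist (x ω s) (z ω s)) (𝓝[≥] s) (𝓝 (dist (x ω s) (z ω s))) :=
        Tendsto.dist ((x ω).rightCont s) ((z ω).rightCont s)
      obtain ⟨u, hu, hsub⟩ :=
        mem_nhdsGE_iff_exists_Ico_subset.1 (h1.eventually (Iio_mem_nhds hs))
      obtain ⟨r, hr, hsr, hru⟩ := hd.exists_between (lt_min hst hu)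
      exact ⟨r, ⟨hr, hru.trans_le (min_le_left _ _)⟩,
        hsub ⟨hsr.le, hru.trans_le (min_le_right _ _)⟩⟩
    · rintro ⟨s, ⟨-, hst⟩, hs⟩
      exact ⟨s, hs, hst⟩
  rw [e]
  refine MeasurableSet.biUnion (hD.mono fun r hr => hr.1) fun r hr => ?_
  have hx' : Measurable[pastFiltration ξ hξ t] fun ω => x ω r :=
    (hx r).mono ((pastFiltration ξ hξ).mono hr.2.le) le_rfl
  have hz' : Measurable[pastFiltration ξ hξ t] fun ω => z ω r :=
    (hz r).mono ((pastFiltration ξ hξ).mono hr.2.le) le_rfl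
  exact @measurableSet_lt _ _ _ _ _ (pastFiltration ξ hξ t) _ _ _ _ _
    (@Measurable.dist E Ω _ _ _ (pastFiltration ξ hξ t) _ _ _ hx' hz')
    (@measurable_const _ _ _ (pastFiltration ξ hξ t) ε)

theorem isStoppingTime_pairTime {x z : Ω → CadlagPath E} (hx : AdaptedPath hξ x)
    (hz : AdaptedPath hξ z) :
    IsStoppingTime (pastFiltration ξ hξ) fun ω => pairTime (x ω) (z ω) := by
  intro t
  have e : {ω | pairTime (x ω) (z ω) ≤ t} =
      ⋂ n : ℕ, {ω | nearTime (x ω) (z ω) (1 / ((n : ℝ) + 1)) ≤ t} := by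
    ext ω
    refine (iSup_le_iff (f := fun n : ℕ => nearTime (x ω) (z ω) (1 / ((n : ℝ) + 1)))).trans ?_
    simp only [Set.mem_iInter, Set.mem_ofPred_eq]
  rw [e]
  exact MeasurableSet.iInter fun n => isStoppingTime_nearTime hx hz _ t

/-- A path made from `x` and a list of paths, which follows `x` before it comes close to one of them
and follows that path afterwards. -/
theorem exists_adapted_follow {x : Ω → CadlagPath E} (hx : AdaptedPath hξ x)
    (l : List (Ω → CadlagPath E)) (hl : ∀ z ∈ l, AdaptedPath hξ z) :
    ∃ (Y : Ω → CadlagPath E) (T : Ω → WithTop ℝ≥0), AdaptedPath hξ Y ∧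
      IsStoppingTime (pastFiltration ξ hξ) T ∧ ∀ ω,
        (∀ z ∈ l, T ω ≤ pairTime (x ω) (z ω)) ∧
        (∀ t : ℝ≥0, (t : WithTop ℝ≥0) < T ω → Y ω t = x ω t) ∧
        (T ω = ⊤ ∨ ∃ z ∈ l, T ω = pairTime (x ω) (z ω) ∧
          ∀ t : ℝ≥0, T ω ≤ t → Y ω t = z ω t) := by
  classical
  induction l with
  | nil => exact ⟨x, fun _ => ⊤, hx, fun t => by simp, fun ω => ⟨by simp, fun _ _ => rfl,
      Or.inl rfl⟩⟩
  | cons z l ih =>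
    obtain ⟨Y, T, hY, hT, h⟩ := ih fun z hz => hl z (List.mem_cons_of_mem _ hz)
    have hz := hl z List.mem_cons_self
    have hP := isStoppingTime_pairTime hx hz
    set P : Ω → WithTop ℝ≥0 := fun ω => pairTime (x ω) (z ω) with hPdef
    have hcat : ∀ ω (t : ℝ≥0), (x ω).cat (P ω) (z ω) t =
        if (t : WithTop ℝ≥0) < P ω then x ω t else z ω t := by
      intro ω t
      split_ifs with ht
      · exact CadlagPath.cat_of_lt ht
      · exact CadlagPath.cat_of_ge (not_lt.1 ht)
    refine ⟨fun ω => if P ω ≤ T ω then (x ω).cat (P ω) (z ω) else Y ω, fun ω => min (P ω) (T ω),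
      fun t => ?_, hP.min hT, fun ω => ⟨?_, ?_, ?_⟩⟩
    -- At time `t` the new path differs from `Y` only if `P ≤ T` and `P ≤ t`, an event known at `t`;
    -- before `P` both are still equal to `x`.
    · have e : (fun ω => (if P ω ≤ T ω then (x ω).cat (P ω) (z ω) else Y ω) t) =
          fun ω => if ω ∈ {ω | P ω ≤ T ω} ∩ {ω | P ω ≤ t} then z ω t else Y ω t := by
        funext ω
        by_cases h1 : P ω ≤ T ω
        · by_cases h2 : P ω ≤ t
          · rw [if_pos h1, if_pos ⟨h1, h2⟩, hcat, if_neg h2.not_gt]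
          · rw [if_pos h1, if_neg fun hh => h2 hh.2, hcat, if_pos (not_le.1 h2)]
            exact ((h ω).2.1 t ((not_le.1 h2).trans_le h1)).symm
        · rw [if_neg h1, if_neg fun hh => h1 hh.1]
      rw [e]
      exact Measurable.ite ((hP.measurableSet_le_stopping_time hT).2 t) (hz t) (hY t)
    · rintro z' hz'
      rcases List.mem_cons.1 hz' with rfl | hz'
      · exact min_le_left _ _
      · exact (min_le_right _ _).trans ((h ω).1 z' hz')
    · intro t ht
      by_cases h1 : P ω ≤ T ω
      · refine (congrArg (fun w : CadlagPath E => w t) (if_pos h1)).trans ?_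
        exact (hcat ω t).trans (if_pos (ht.trans_le (min_le_left _ _)))
      · refine (congrArg (fun w : CadlagPath E => w t) (if_neg h1)).trans ?_
        exact (h ω).2.1 t (ht.trans_le (min_le_right _ _))
    · by_cases h1 : P ω ≤ T ω
      · refine Or.inr ⟨z, List.mem_cons_self, min_eq_left h1, fun t ht => ?_⟩
        refine (congrArg (fun w : CadlagPath E => w t) (if_pos h1)).trans ?_
        exact (hcat ω t).trans (if_neg (not_lt.2 ((min_eq_left h1).symm.trans_le ht)))
      · have e := min_eq_right (not_le.1 h1).le
        rcases (h ω).2.2 with h2 | ⟨z', hz', h2, h3⟩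
        · exact absurd (h2 ▸ le_top) h1
        · refine Or.inr ⟨z', List.mem_cons_of_mem _ hz', e.trans h2, fun t ht => ?_⟩
          refine (congrArg (fun w : CadlagPath E => w t) (if_neg h1)).trans ?_
          exact h3 t (e.symm.trans_le ht)

end

variable {E : Type*} [TopologicalSpace E] [MeasurableSpace E] {ι : Type*}
  [LocallyCompactSpace E] [SecondCountableTopology E] [T2Space E] [BorelSpace E]
  {Ω : Type*} [m : MeasurableSpace Ω] {ξ : ι → Ω → CadlagPath E}

/-- Coalescing paths have versions that are adapted, and so has the first meeting time of a further
path with them. -/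
theorem exists_version_and_stoppingTime (X : FellerProcess E) (hξ : ∀ i, Measurable (ξ i)) (a : ι)
    {l : List ι} {k : List (Ω → CadlagPath E)} (hk : ∀ Z ∈ k, AdaptedPath hξ Z)
    (hlk : ∀ (μ : Measure Ω) [IsFiniteMeasure μ], IsMarkovSystem X μ ξ → ∀ᵐ ω ∂μ,
      coalSet (l.map fun i => (ξ i ω : ℝ≥0 → E)) = {z : ℝ≥0 → E | ∃ Z ∈ k, z = Z ω}) :
    ∃ (Y : Ω → CadlagPath E) (T : Ω → WithTop ℝ≥0), AdaptedPath hξ Y ∧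
      IsStoppingTime (pastFiltration ξ hξ) T ∧
      ∀ (μ : Measure Ω) [IsFiniteMeasure μ], IsMarkovSystem X μ ξ → ∀ᵐ ω ∂μ,
        IsFirstMeeting (ξ a ω) (coalSet (l.map fun i => (ξ i ω : ℝ≥0 → E))) (T ω) ∧
        fol (ξ a ω) (coalSet (l.map fun i => (ξ i ω : ℝ≥0 → E))) = Y ω := by
  have : PolishSpace E := polishSpace_of_locallyCompact
  let : MetricSpace E := metrizableSpaceMetric E
  obtain ⟨Y, T, hY, hT, h⟩ := exists_adapted_follow (adaptedPath_self (hξ := hξ) a) k hk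
  refine ⟨Y, T, hY, hT, fun μ _ hμ => ?_⟩
  -- Quasi-left-continuity is needed for all free paths with indices in `a :: l`, since the version
  -- `z` is a coalescing path glued from those with indices in `l`.
  have hc : ∀ᵐ ω ∂μ, ∀ z ∈ k, ∀ i ∈ a :: l, ∀ t : ℝ≥0,
      (∀ n : ℕ, nearTime (ξ a ω) (z ω) (1 / ((n : ℝ) + 1)) < t) →
      IsLUB (Set.range fun n : ℕ => nearTime (ξ a ω) (z ω) (1 / ((n : ℝ) + 1)))
        (t : WithTop ℝ≥0) → ContinuousAt (ξ i ω) t := by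
    refine (ae_ball_iff (List.finite_toSet k).countable).2 fun z hz =>
      (ae_ball_iff (List.finite_toSet (a :: l)).countable).2 fun i _ => ?_
    exact hμ.ae_continuousAt (S := fun n ω => nearTime (ξ a ω) (z ω) (1 / ((n : ℝ) + 1)))
      (fun n => isStoppingTime_nearTime (adaptedPath_self a) (hk z hz) _)
      (fun ω => monotone_nearTime _ _) i
  filter_upwards [hc, hlk μ hμ] with ω hω1 hω2
  have hrc : ∀ x ∈ l.map fun i => (ξ i ω : ℝ≥0 → E), IsRC x := by
    intro x hx
    obtain ⟨i, -, rfl⟩ := List.mem_map.1 hx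
    exact (ξ i ω).isRC
  have hZ := isCoalescingFamily_coalSet hrc
  have hpair : ∀ z ∈ k, ∀ t : ℝ≥0, pairTime (ξ a ω) (z ω) = t → ξ a ω t = z ω t := by
    intro z hz t ht
    have hzm : (z ω : ℝ≥0 → E) ∈ coalSet (l.map fun i => (ξ i ω : ℝ≥0 → E)) :=
      hω2 ▸ ⟨z, hz, rfl⟩
    refine eq_of_pairTime_eq (ξ a ω).isRC (z ω).isRC (fun t h1 h2 => ?_) ht
    refine ⟨hω1 z hz a List.mem_cons_self t h1 h2, ?_⟩
    refine continuousAt_of_mem_coalSet hrc (fun x hx => ?_) _ hzm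
    obtain ⟨i, hi, rfl⟩ := List.mem_map.1 hx
    exact hω1 z hz i (List.mem_cons_of_mem _ hi) t h1 h2
  have hfirst : IsFirstMeeting (ξ a ω) (coalSet (l.map fun i => (ξ i ω : ℝ≥0 → E))) (T ω) := by
    refine ⟨fun t ht => ?_, fun t ht => ?_⟩
    · rw [hω2]
      rintro ⟨-, ⟨z, hz, rfl⟩, e⟩
      exact ne_of_lt_pairTime (ht.trans_le ((h ω).1 z hz)) e
    · rcases (h ω).2.2 with h1 | ⟨z, hz, h1, -⟩
      · rw [h1] at ht
        exact absurd ht (WithTop.top_ne_coe)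
      · rw [hω2]
        exact ⟨_, ⟨z, hz, rfl⟩, hpair z hz t (h1.symm.trans ht)⟩
  refine ⟨hfirst, funext fun t => ?_⟩
  rcases lt_or_ge (t : WithTop ℝ≥0) (T ω) with ht | ht
  · rw [(h ω).2.1 t ht]
    exact fol_of_not_meets fun s hs => hfirst.1 s ((WithTop.coe_le_coe.2 hs).trans_lt ht)
  · rcases (h ω).2.2 with h1 | ⟨z, hz, h1, h2⟩
    · rw [h1] at ht
      exact absurd ht (WithTop.coe_lt_top t).not_ge
    · obtain ⟨s, hs⟩ := WithTop.ne_top_iff_exists.1 (ht.trans_lt (WithTop.coe_lt_top t)).ne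
      rw [h2 t ht]
      refine fol_of_meets hZ.coalescing (hω2 ▸ ⟨z, hz, rfl⟩) (hpair z hz s (h1.symm.trans hs.symm))
        (fun r hr => hfirst.1 r (hs ▸ WithTop.coe_lt_coe.2 hr)) ?_
      rw [← hs] at ht
      exact WithTop.coe_le_coe.1 ht

/-- The versions are chosen before the measure, so that one choice serves all starting points and
all restarted systems; measurability in the starting point depends on this. -/
theorem exists_version (X : FellerProcess E) (hξ : ∀ i, Measurable (ξ i)) (l : List ι) :
    ∃ k : List (Ω → CadlagPath E), (∀ Z ∈ k, AdaptedPath hξ Z) ∧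
      ∀ (μ : Measure Ω) [IsFiniteMeasure μ], IsMarkovSystem X μ ξ → ∀ᵐ ω ∂μ,
        coalSet (l.map fun i => (ξ i ω : ℝ≥0 → E)) = {z : ℝ≥0 → E | ∃ Z ∈ k, z = Z ω} := by
  induction l with
  | nil => exact ⟨[], by simp, fun μ _ _ => Eventually.of_forall fun ω => by simp [coalSet]⟩
  | cons a l ih =>
    obtain ⟨k, hk, hlk⟩ := ih
    obtain ⟨Y, T, hY, -, h⟩ := exists_version_and_stoppingTime X hξ a hk hlk
    refine ⟨Y :: k, ?_, fun μ _ hμ => ?_⟩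
    · rintro Z hZ
      rcases List.mem_cons.1 hZ with rfl | hZ
      exacts [hY, hk Z hZ]
    · filter_upwards [h μ hμ, hlk μ hμ] with ω h1 h2
      rw [List.map_cons, coalSet, h1.2, h2]
      ext z
      simp

theorem exists_stoppingTime (X : FellerProcess E) (hξ : ∀ i, Measurable (ξ i)) (a : ι)
    (l : List ι) :
    ∃ T : Ω → WithTop ℝ≥0, IsStoppingTime (pastFiltration ξ hξ) T ∧
      ∀ (μ : Measure Ω) [IsFiniteMeasure μ], IsMarkovSystem X μ ξ → ∀ᵐ ω ∂μ,
        IsFirstMeeting (ξ a ω) (coalSet (l.map fun i => (ξ i ω : ℝ≥0 → E))) (T ω) := by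
  obtain ⟨k, hk, hlk⟩ := exists_version X hξ l
  obtain ⟨Y, T, -, hT, h⟩ := exists_version_and_stoppingTime X hξ a hk hlk
  exact ⟨T, hT, fun μ _ hμ => (h μ hμ).mono fun ω hω => hω.1⟩

end Versions

/-! ### Stopped and grafted paths at random times -/

section StoppedPaths

variable {E : Type*} [TopologicalSpace E] [MeasurableSpace E] {ι : Type*}
  [LocallyCompactSpace E] [SecondCountableTopology E] [T2Space E] [BorelSpace E]

/-- The value of the random time `S` where it is at most `t`, and `0` elsewhere. -/
def truncVal {Ω : Type*} (S : Ω → WithTop ℝ≥0) (t : ℝ≥0) (ω : Ω) : ℝ≥0 :=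
  open Classical in if S ω ≤ t then finVal S ω else 0

theorem truncVal_of_le {Ω : Type*} {S : Ω → WithTop ℝ≥0} {t : ℝ≥0} {ω : Ω} (h : S ω ≤ t) :
    truncVal S t ω = finVal S ω := if_pos h

theorem truncVal_le {Ω : Type*} [MeasurableSpace Ω] (S : Ω → WithTop ℝ≥0) (t : ℝ≥0) (ω : Ω) : truncVal S t ω ≤ t := by
  rw [truncVal]
  split_ifs with h
  · rw [← WithTop.coe_le_coe, coe_finVal (h.trans_lt (WithTop.coe_lt_top t))]
    exact h
  · exact zero_le

section

variable {Ω : Type*} [m : MeasurableSpace Ω] {ξ : ι → Ω → CadlagPath E}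
  {hξ : ∀ i, Measurable (ξ i)} {S : Ω → WithTop ℝ≥0}

/-- Unlike `S` itself, its truncation is known at time `t`, and it agrees with `S` on `S ≤ t`. This
is how measurability at the stopping time is checked for quantities evaluated at `S`. -/
theorem measurable_truncVal (hS : IsStoppingTime (pastFiltration ξ hξ) S) (t : ℝ≥0) :
    Measurable[pastFiltration ξ hξ t] (truncVal S t) := by
  refine measurable_of_Iic fun r => ?_
  have e : truncVal S t ⁻¹' Set.Iic r =
      {ω | S ω ≤ (min r t : ℝ≥0)} ∪ {ω | S ω ≤ t}ᶜ := by
    ext ω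
    simp only [Set.mem_preimage, Set.mem_Iic, Set.mem_union, Set.mem_ofPred_eq, Set.mem_compl_iff]
    by_cases h : S ω ≤ t
    · rw [truncVal_of_le h, ← WithTop.coe_le_coe, coe_finVal (h.trans_lt (WithTop.coe_lt_top t)),
        WithTop.coe_min, le_min_iff]
      exact ⟨fun h' => Or.inl ⟨h', h⟩, fun h' => h'.elim And.left (absurd h)⟩
    · rw [truncVal, if_neg h]
      exact ⟨fun _ => Or.inr h, fun _ => zero_le⟩
  rw [e]
  exact ((pastFiltration ξ hξ).mono (min_le_right r t) _ (hS _)).union (hS t).compl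

theorem AdaptedPath.measurable_truncVal_apply {Z : Ω → CadlagPath E} (hZ : AdaptedPath hξ Z)
    (hS : IsStoppingTime (pastFiltration ξ hξ) S) (t : ℝ≥0) {φ : ℝ≥0 → ℝ≥0} (hφ : Measurable φ)
    (hφ' : ∀ s, φ s ≤ s) :
    Measurable[pastFiltration ξ hξ t] fun ω => Z ω (φ (truncVal S t ω)) := by
  have : PolishSpace E := polishSpace_of_locallyCompact
  have h := CadlagPath.measurable_apply_random_of_le (m := pastFiltration ξ hξ t) (W := Z) (t := t)
    (fun s hs => (hZ s).mono ((pastFiltration ξ hξ).mono hs) le_rfl)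
    (hφ.comp (measurable_truncVal hS t))
  have e : ∀ ω, min ((φ ∘ truncVal S t) ω) t = φ (truncVal S t ω) := fun ω =>
    min_eq_left ((hφ' _).trans (truncVal_le S t ω))
  have e' : (fun ω => Z ω (min ((φ ∘ truncVal S t) ω) t)) = fun ω => Z ω (φ (truncVal S t ω)) :=
    funext fun ω => congrArg (Z ω) (e ω)
  exact e' ▸ h

theorem AdaptedPath.measurable_stop_truncVal {Z : Ω → CadlagPath E} (hZ : AdaptedPath hξ Z)
    (hS : IsStoppingTime (pastFiltration ξ hξ) S) (t : ℝ≥0) :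
    Measurable[pastFiltration ξ hξ t] fun ω => (Z ω).stopAt (truncVal S t ω) :=
  CadlagPath.measurable_of_apply fun s => hZ.measurable_truncVal_apply hS t
    (φ := fun r => min s r) (measurable_const.min measurable_id) fun _ => min_le_right _ _

end

theorem CadlagPath.measurable_stop_random {Ω : Type*} [MeasurableSpace Ω] {W : Ω → CadlagPath E}
    {s : Ω → ℝ≥0} (hW : Measurable W) (hs : Measurable s) :
    Measurable fun ω => (W ω).stopAt (s ω) := by
  have : PolishSpace E := polishSpace_of_locallyCompact
  refine CadlagPath.measurable_of_apply fun t => ?_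
  have h := CadlagPath.measurable_apply_random hW ((measurable_const (a := t)).min hs)
  exact h

theorem CadlagPath.measurable_graft {Ω : Type*} [MeasurableSpace Ω] {x z : Ω → CadlagPath E}
    {s : Ω → ℝ≥0} (hx : Measurable x) (hz : Measurable z) (hs : Measurable s) :
    Measurable fun ω => (x ω).graft (s ω) (z ω) := by
  classical
  have : PolishSpace E := polishSpace_of_locallyCompact
  refine CadlagPath.measurable_of_apply fun t => ?_
  have e : (fun ω => (x ω).graft (s ω) (z ω) t) =
      fun ω => if ω ∈ {ω | t < s ω} then x ω t else z ω (t - s ω) := by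
    funext ω
    split_ifs with h
    · exact CadlagPath.graft_of_lt h
    · exact CadlagPath.graft_of_ge (not_lt.1 h)
  rw [e]
  exact Measurable.ite (measurableSet_lt measurable_const hs)
    ((CadlagPath.measurable_apply t).comp hx)
    (CadlagPath.measurable_apply_random hz (measurable_const.sub hs))

theorem CadlagPath.graft_stop (w z : CadlagPath E) (s : ℝ≥0) :
    (w.stopAt s).graft s z = w.graft s z := by
  refine CadlagPath.ext fun t => ?_
  rcases lt_or_ge t s with h | h
  · refine (CadlagPath.graft_of_lt h).trans (Eq.trans ?_ (CadlagPath.graft_of_lt h).symm)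
    exact congrArg w (min_eq_left h.le)
  · exact (CadlagPath.graft_of_ge h).trans (CadlagPath.graft_of_ge h).symm

theorem CadlagPath.graft_shift (w : CadlagPath E) (s : ℝ≥0) : w.graft s (w.shift s) = w := by
  refine CadlagPath.ext fun t => ?_
  rcases lt_or_ge t s with h | h
  · exact CadlagPath.graft_of_lt h
  · exact (CadlagPath.graft_of_ge h).trans (congrArg w (add_tsub_cancel_of_le h))

end StoppedPaths

/-! ### Exchanging two free paths after their meeting -/

section Swap

variable {E : Type*} [TopologicalSpace E] [MeasurableSpace E] {ι : Type*}

open Classical in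
/-- On the event `D`, the paths with the indices `a` and `b` are exchanged after the time `T`. -/
def swapAfter (T : (ι → CadlagPath E) → WithTop ℝ≥0) (D : Set (ι → CadlagPath E)) (a b : ι)
    (w : ι → CadlagPath E) : ι → CadlagPath E :=
  if w ∈ D then fun i => (w i).graft (finVal T w) ((w (Equiv.swap a b i)).shift (finVal T w))
  else w

variable [LocallyCompactSpace E] [SecondCountableTopology E] [T2Space E] [BorelSpace E]

theorem measurable_swapAfter {T : (ι → CadlagPath E) → WithTop ℝ≥0} {D : Set (ι → CadlagPath E)}
    (hT : Measurable (finVal T)) (hD : MeasurableSet D) (a b : ι) :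
    Measurable (swapAfter T D a b) := by
  classical
  have : PolishSpace E := polishSpace_of_locallyCompact
  have e : swapAfter T D a b = fun w => if w ∈ D then fun i =>
      (w i).graft (finVal T w) ((w (Equiv.swap a b i)).shift (finVal T w)) else w := by
    funext w
    rw [swapAfter]
  rw [e]
  refine Measurable.ite hD (measurable_pi_lambda _ fun i => ?_) measurable_id
  refine CadlagPath.measurable_graft (measurable_pi_apply i) ?_ hT
  exact (measurable_pi_apply (Equiv.swap a b i)).comp
    (measurable_shiftAll_random (fun i => measurable_pi_apply i) hT)

/-- Exchanging two paths after they have met preserves the law of independent copies. -/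
theorem FellerProcess.map_swapAfter (X : FellerProcess E) (x : ι → E)
    {T : (ι → CadlagPath E) → WithTop ℝ≥0} {D : Set (ι → CadlagPath E)} {a b : ι}
    (hT : IsStoppingTime
      (pastFiltration (fun i (w : ι → CadlagPath E) => w i) measurable_pi_apply) T)
    (hD : MeasurableSet[hT.measurableSpace] D) (hDT : D ⊆ {w | T w < ⊤})
    (hab : ∀ᵐ w ∂(X.vecKernel ι x), w ∈ D → w a (finVal T w) = w b (finVal T w)) :
    (X.vecKernel ι x).map (swapAfter T D a b) = X.vecKernel ι x := by
  classical
  have : PolishSpace E := polishSpace_of_locallyCompact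
  set P := X.vecKernel ι x with hP
  set σ : ι → ι := ⇑(Equiv.swap a b) with hσ
  have hsys : IsMarkovSystem X P fun i (w : ι → CadlagPath E) => w i := isMarkovSystem_vecKernel x
  have hDm : MeasurableSet D := hT.measurableSpace_le _ hD
  have hTm : Measurable (finVal T) := measurable_finVal hT
  have hΦ := measurable_swapAfter hTm hDm a b
  -- `V` records the past at `T`. Grafting the shifted paths onto it returns the original vector,
  -- and grafting the permuted shifted paths gives the exchanged one.
  set V : (ι → CadlagPath E) → ℝ≥0 × (ι → CadlagPath E) :=
    fun w => (finVal T w, fun i => (w i).stopAt (finVal T w)) with hVdef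
  have hV : Measurable V := hTm.prodMk (measurable_pi_lambda _ fun i =>
    CadlagPath.measurable_stop_random (measurable_pi_apply i) hTm)
  have hVT : ∀ C, MeasurableSet C → MeasurableSet[hT.measurableSpace] (D ∩ V ⁻¹' C) := by
    intro C hC
    refine measurableSet_of_inter_le hT (Set.inter_subset_left.trans hDT) fun t => ?_
    have hVt : Measurable[pastFiltration (fun i (w : ι → CadlagPath E) => w i) measurable_pi_apply t]
        fun w : ι → CadlagPath E => (truncVal T t w, fun i => (w i).stopAt (truncVal T t w)) := by
      refine Measurable.prodMk (measurable_truncVal hT t) ?_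
      refine Measurable.of_comap_le ((MeasurableSpace.comap_iSup).trans_le (iSup_le fun i => ?_))
      rw [MeasurableSpace.comap_comp]
      refine Measurable.comap_le ?_
      exact AdaptedPath.measurable_stop_truncVal (adaptedPath_self i) hT t
    have e : D ∩ V ⁻¹' C ∩ {w | T w ≤ t} = (D ∩ {w | T w ≤ t}) ∩
        (fun w : ι → CadlagPath E =>
          (truncVal T t w, fun i => (w i).stopAt (truncVal T t w))) ⁻¹' C := by
      ext w
      simp only [Set.mem_inter_iff, Set.mem_preimage, Set.mem_ofPred_eq, hVdef]
      constructor
      · rintro ⟨⟨h1, h2⟩, h3⟩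
        rw [truncVal_of_le h3]
        exact ⟨⟨h1, h3⟩, h2⟩
      · rintro ⟨⟨h1, h3⟩, h2⟩
        rw [truncVal_of_le h3] at h2
        exact ⟨⟨h1, h2⟩, h3⟩
    rw [e]
    exact MeasurableSet.inter (hD.2 t) (hVt hC)
  ext B hB
  set G : (ℝ≥0 × (ι → CadlagPath E)) × (ι → CadlagPath E) → ℝ≥0∞ := fun p =>
    B.indicator 1 fun i => (p.1.2 i).graft p.1.1 (p.2 i) with hG
  have hσm : Measurable fun w : ι → CadlagPath E => fun i => w (σ i) :=
    measurable_pi_lambda _ fun i => measurable_pi_apply (σ i)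
  have hGm : Measurable G := by
    refine (measurable_one.indicator hB).comp (measurable_pi_lambda _ fun i => ?_)
    exact CadlagPath.measurable_graft
      ((measurable_pi_apply i).comp (measurable_snd.comp measurable_fst))
      ((measurable_pi_apply i).comp measurable_snd) (measurable_fst.comp measurable_fst)
  have hGm' : Measurable fun p : (ℝ≥0 × (ι → CadlagPath E)) × (ι → CadlagPath E) =>
      G (p.1, fun i => p.2 (σ i)) := hGm.comp (measurable_fst.prodMk (hσm.comp measurable_snd))
  have h1 := hsys.strong_joint hT hD hDT hV hVT hGm'
  have h2 := hsys.strong_joint hT hD hDT hV hVT hGm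
  have h3 : ∫⁻ w in D, ∫⁻ w', G (V w, fun i => w' (σ i))
      ∂(X.vecKernel ι fun i => w i (finVal T w)) ∂P =
      ∫⁻ w in D, ∫⁻ w', G (V w, w') ∂(X.vecKernel ι fun i => w i (finVal T w)) ∂P := by
    -- On `D` the particles `a` and `b` are at the same point at time `T`, so the transposition
    -- fixes the vector of positions and hence the law of the future.
    refine setLIntegral_congr_fun_ae hDm ?_
    filter_upwards [hab] with w hw hwD
    have e1 := X.vecKernel_map_comp (Equiv.swap a b).injective fun i => w i (finVal T w)
    have e2 : (fun i => w i (finVal T w)) ∘ (Equiv.swap a b) = fun i => w i (finVal T w) := by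
      funext i
      change w (Equiv.swap a b i) (finVal T w) = w i (finVal T w)
      rcases eq_or_ne i a with rfl | hia
      · rw [Equiv.swap_apply_left]
        exact (hw hwD).symm
      · rcases eq_or_ne i b with rfl | hib
        · rw [Equiv.swap_apply_right]
          exact hw hwD
        · rw [Equiv.swap_apply_of_ne_of_ne hia hib]
    rw [e2] at e1
    conv_rhs => rw [← e1]
    exact (lintegral_map (hGm.comp (measurable_const.prodMk measurable_id)) hσm).symm
  have h4 : ∫⁻ w in D, B.indicator 1 (swapAfter T D a b w) ∂P = ∫⁻ w in D, B.indicator 1 w ∂P := by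
    refine Eq.trans ?_ (h1.trans (h3.trans (h2.symm.trans ?_)))
    · refine setLIntegral_congr_fun hDm fun w hw => congrArg (B.indicator 1) ?_
      rw [swapAfter, if_pos hw]
      exact funext fun i => (CadlagPath.graft_stop _ _ _).symm
    · refine setLIntegral_congr_fun hDm fun w hw => congrArg (B.indicator 1) ?_
      exact funext fun i => (CadlagPath.graft_stop _ _ _).trans (CadlagPath.graft_shift _ _)
  have h5 : ∫⁻ w in Dᶜ, B.indicator 1 (swapAfter T D a b w) ∂P =
      ∫⁻ w in Dᶜ, B.indicator 1 w ∂P := by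
    refine setLIntegral_congr_fun hDm.compl fun w hw => congrArg (B.indicator 1) ?_
    rw [swapAfter, if_neg hw]
  have hBm : Measurable (B.indicator (1 : (ι → CadlagPath E) → ℝ≥0∞)) :=
    measurable_one.indicator hB
  have h6 : ∫⁻ w, B.indicator 1 w ∂(P.map (swapAfter T D a b)) = ∫⁻ w, B.indicator 1 w ∂P := by
    rw [lintegral_map hBm hΦ, ← lintegral_add_compl _ hDm, h4, h5, lintegral_add_compl _ hDm]
  simpa only [lintegral_indicator_one hB] using h6

end Swap

/-! ### Hitting probabilities of finite systems and their symmetry -/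

section HitProb

variable {E : Type*} [TopologicalSpace E] {ι κ : Type*}

/-- For each `(t, U)` in the list `H`, some path of `Z` is in `U` at the time `t`. -/
def HitsAll (Z : Set (ℝ≥0 → E)) (H : List (ℝ≥0 × Set E)) : Prop :=
  ∀ p ∈ H, ∃ z ∈ Z, z p.1 ∈ p.2

theorem HitsAll.mono {Z W : Set (ℝ≥0 → E)} {H : List (ℝ≥0 × Set E)} (h : HitsAll Z H)
    (hZW : Z ⊆ W) : HitsAll W H := fun p hp =>
  let ⟨z, hz, hzp⟩ := h p hp
  ⟨z, hZW hz, hzp⟩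

/-- The coalescing paths made from the paths `w i`, `i ∈ l`. -/
abbrev coalPaths (l : List ι) (w : ι → CadlagPath E) : Set (ℝ≥0 → E) :=
  coalSet (l.map fun i => (w i : ℝ≥0 → E))

theorem isRC_of_mem_map {l : List ι} {w : ι → CadlagPath E} {x : ℝ≥0 → E}
    (hx : x ∈ l.map fun i => (w i : ℝ≥0 → E)) : IsRC x := by
  obtain ⟨i, -, rfl⟩ := List.mem_map.1 hx
  exact (w i).isRC

variable [MeasurableSpace E] [LocallyCompactSpace E] [SecondCountableTopology E] [T2Space E]
  [BorelSpace E]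

theorem isCoalescingFamily_coalPaths (l : List ι) (w : ι → CadlagPath E) :
    IsCoalescingFamily (coalPaths l w) :=
  isCoalescingFamily_coalSet fun _ hx => isRC_of_mem_map hx

theorem exists_measurable_hitsAll (X : FellerProcess E) {Ω : Type*} [MeasurableSpace Ω]
    {ξ : ι → Ω → CadlagPath E} (hξ : ∀ i, Measurable (ξ i)) (l : List ι)
    {H : List (ℝ≥0 × Set E)} (hH : IsOpenList H) :
    ∃ B : Set Ω, MeasurableSet B ∧ ∀ (μ : Measure Ω) [IsFiniteMeasure μ], IsMarkovSystem X μ ξ →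
      {ω | HitsAll (coalPaths l fun i => ξ i ω) H} =ᵐ[μ] B := by
  obtain ⟨k, hk, h⟩ := exists_version X hξ l
  refine ⟨⋂ p ∈ H, ⋃ Z ∈ k, {ω | Z ω p.1 ∈ p.2}, ?_, fun μ _ hμ => ?_⟩
  · refine MeasurableSet.biInter (List.finite_toSet H).countable fun p hp =>
      MeasurableSet.biUnion (List.finite_toSet k).countable fun Z hZ => ?_
    exact (CadlagPath.measurable_apply p.1).comp (hk Z hZ).measurable (hH p hp).measurableSet
  · filter_upwards [h μ hμ] with ω hω
    refine propext ?_
    change HitsAll (coalSet _) H ↔ ω ∈ ⋂ p ∈ H, ⋃ Z ∈ k, {ω | Z ω p.1 ∈ p.2}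
    rw [hω]
    simp [HitsAll]

namespace FellerProcess

variable (X : FellerProcess E)

/-- The probability that the coalescing paths with the indices in `l`, started from the points
`x i`, visit the sets in the list `H`. -/
def collProb (l : List ι) (H : List (ℝ≥0 × Set E)) (x : ι → E) : ℝ≥0∞ :=
  X.vecKernel ι x {w | HitsAll (coalPaths l w) H}

/-- The probability that coalescing paths started from the entries of `L` visit the sets in the
list `H`. -/
def hitProb (H : List (ℝ≥0 × Set E)) (L : List E) : ℝ≥0∞ :=
  X.collProb (List.finRange L.length) H L.get

variable {X}

theorem nullMeasurableSet_hitsAll {Ω : Type*} [MeasurableSpace Ω] {μ : Measure Ω}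
    [IsFiniteMeasure μ] {ξ : ι → Ω → CadlagPath E} (h : IsMarkovSystem X μ ξ) (l : List ι)
    {H : List (ℝ≥0 × Set E)} (hH : IsOpenList H) :
    NullMeasurableSet {ω | HitsAll (coalPaths l fun i => ξ i ω) H} μ := by
  obtain ⟨B, hB, hB'⟩ := exists_measurable_hitsAll X h.measurable l hH
  exact hB.nullMeasurableSet.congr (hB' μ h).symm

/-- Under every starting vector, the event agrees almost surely with one and the same measurable
set. -/
theorem measurable_collProb (l : List ι) {H : List (ℝ≥0 × Set E)} (hH : IsOpenList H) :
    Measurable (X.collProb l H) := by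
  obtain ⟨B, hB, hB'⟩ := exists_measurable_hitsAll X
    (ξ := fun i (w : ι → CadlagPath E) => w i) measurable_pi_apply l hH
  have e : X.collProb l H = fun x => X.vecKernel ι x B :=
    funext fun x => measure_congr (hB' _ (isMarkovSystem_vecKernel x))
  rw [e]
  exact (X.vecKernel ι).measurable_coe hB

theorem collProb_comp {e : κ → ι} (he : Function.Injective e) (l : List κ)
    {H : List (ℝ≥0 × Set E)} (hH : IsOpenList H) (x : ι → E) :
    X.collProb (l.map e) H x = X.collProb l H (x ∘ e) := by
  have hm : Measurable fun (w : ι → CadlagPath E) k => w (e k) :=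
    measurable_pi_lambda _ fun k => measurable_pi_apply (e k)
  have h := X.vecKernel_map_comp he x
  have hn := nullMeasurableSet_hitsAll (X := X) (isMarkovSystem_vecKernel (x ∘ e)) l hH
  rw [collProb, collProb, ← h, Measure.map_apply₀ hm.aemeasurable (h ▸ hn)]
  simp only [coalPaths, List.map_map]
  rfl

/-- Indices are only labels. They must be distinct, since a repeated label would be the same
particle again and not an independent copy from the same point. -/
theorem collProb_eq_hitProb {l : List ι} (hl : l.Nodup) {H : List (ℝ≥0 × Set E)}
    (hH : IsOpenList H) (x : ι → E) : X.collProb l H x = X.hitProb H (l.map x) := by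
  set e : Fin (l.map x).length → ι := fun i => l.get (i.cast (List.length_map x)) with he
  have hinj : Function.Injective e := fun i j hij => by
    have := List.nodup_iff_injective_get.1 hl hij
    exact Fin.cast_injective _ this
  have h1 : (List.finRange (l.map x).length).map e = l := by
    refine List.ext_getElem (by simp) fun n h1 h2 => ?_
    simp [he]
  have h2 : x ∘ e = (l.map x).get := by
    funext i
    simp [he]
  rw [hitProb, ← h2, ← collProb_comp hinj _ hH, h1]

/-- The head of a list is the last particle, which leaves the coalescing paths of the others
unchanged. -/
theorem hitProb_le_cons {H : List (ℝ≥0 × Set E)} (hH : IsOpenList H) (a : E) (L : List E) :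
    X.hitProb H L ≤ X.hitProb H (a :: L) := by
  have h1 : (List.finRange (a :: L).length).map (a :: L).get = a :: L := List.map_get_finRange _
  have hnd := List.nodup_finRange (a :: L).length
  generalize List.finRange (a :: L).length = l at h1 hnd
  obtain ⟨i, l', rfl, hi, hl'⟩ := List.map_eq_cons_iff.1 h1
  rw [← h1, ← collProb_eq_hitProb hnd hH]
  conv_lhs => rw [← hl']
  rw [← collProb_eq_hitProb (List.nodup_cons.1 hnd).2 hH]
  refine measure_mono fun w hw => ?_
  exact HitsAll.mono hw (Set.subset_insert _ _)

theorem hitProb_le_append {H : List (ℝ≥0 × Set E)} (hH : IsOpenList H) (L L' : List E) :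
    X.hitProb H L' ≤ X.hitProb H (L ++ L') := by
  induction L with
  | nil => exact le_rfl
  | cons a L ih => exact ih.trans (hitProb_le_cons hH a _)

theorem collProb_swap {pre rest : List ι} {a b : ι} (hnd : (pre ++ a :: b :: rest).Nodup)
    {H : List (ℝ≥0 × Set E)} (hH : IsOpenList H) (x : ι → E) :
    X.collProb (pre ++ b :: a :: rest) H x = X.collProb (pre ++ a :: b :: rest) H x := by
  classical
  set P := X.vecKernel ι x with hP
  set ξ : ι → (ι → CadlagPath E) → CadlagPath E := fun i w => w i with hξ
  have hsys : IsMarkovSystem X P ξ := isMarkovSystem_vecKernel x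
  obtain ⟨hpre, hab', hdisj⟩ := List.nodup_append.1 hnd
  have hapre : a ∉ pre := fun h => hdisj a h a (by simp) rfl
  have hbpre : b ∉ pre := fun h => hdisj b h b (by simp) rfl
  have hab : a ≠ b := fun h => (List.nodup_cons.1 hab').1 (h ▸ List.mem_cons_self)
  have harest : a ∉ rest := fun h => (List.nodup_cons.1 hab').1 (List.mem_cons_of_mem _ h)
  have hbrest : b ∉ rest := (List.nodup_cons.1 (List.nodup_cons.1 hab').2).1
  obtain ⟨T, hT, hT'⟩ := exists_stoppingTime X (ξ := ξ) measurable_pi_apply a [b]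
  obtain ⟨Ta, hTa, hTa'⟩ := exists_stoppingTime X (ξ := ξ) measurable_pi_apply a rest
  obtain ⟨Tb, hTb, hTb'⟩ := exists_stoppingTime X (ξ := ξ) measurable_pi_apply b rest
  -- On `D` the two paths meet strictly before either meets the earlier particles, so the exchange
  -- after `T` is used; off `D` the order is irrelevant path by path and nothing is exchanged.
  set D : Set (ι → CadlagPath E) := {w | Ta w ≤ T w}ᶜ ∩ {w | Tb w ≤ T w}ᶜ with hD
  have hDT : MeasurableSet[hT.measurableSpace] D :=
    MeasurableSet.inter (MeasurableSet.compl (hTa.measurableSet_stopping_time_le hT))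
      (MeasurableSet.compl (hTb.measurableSet_stopping_time_le hT))
  have hDlt : D ⊆ {w | T w < ⊤} := fun w hw => 
    (lt_of_not_ge (show ¬ Ta w ≤ T w from hw.1)).trans_le le_top
  have hfirst : ∀ w t, IsFirstMeeting (ξ a w) (coalSet ([b].map fun i => (ξ i w : ℝ≥0 → E))) (T w) →
      T w = (t : ℝ≥0) → w a t = w b t := by
    intro w t hw ht
    obtain ⟨z, hz, e⟩ := hw.2 t ht
    rw [List.map_singleton, coalSet_singleton, Set.mem_singleton_iff] at hz
    exact e.trans (congrFun hz t)
  have hmap : P.map (swapAfter T D a b) = P := by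
    refine X.map_swapAfter x hT hDT hDlt ?_
    filter_upwards [hT' P hsys] with w hw hwD
    exact hfirst w _ hw (coe_finVal (hDlt hwD)).symm
  have hmeas : Measurable (swapAfter T D a b) :=
    measurable_swapAfter (measurable_finVal hT) (hT.measurableSpace_le _ hDT) a b
  have hnull := nullMeasurableSet_hitsAll hsys (pre ++ a :: b :: rest) hH
  have key : ∀ᵐ w ∂P, coalPaths (pre ++ b :: a :: rest) w =
      coalPaths (pre ++ a :: b :: rest) (swapAfter T D a b w) := by
    filter_upwards [hT' P hsys, hTa' P hsys, hTb' P hsys] with w h0 ha hb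
    have hZ := isCoalescingFamily_coalPaths rest w
    by_cases hwD : w ∈ D
    · set s := finVal T w with hs
      have hsT : T w = s := (coe_finVal (hDlt hwD)).symm
      have e : swapAfter T D a b w = fun i =>
          (w i).graft s ((w (Equiv.swap a b i)).shift s) := by
        rw [swapAfter, if_pos hwD]
      have eo : ∀ i, i ≠ a → i ≠ b → swapAfter T D a b w i = w i := by
        intro i hia hib
        refine (congrFun e i).trans ?_
        rw [Equiv.swap_apply_of_ne_of_ne hia hib]
        exact CadlagPath.graft_shift _ _
      have ea : swapAfter T D a b w a = (w a).graft s ((w b).shift s) := by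
        refine (congrFun e a).trans ?_
        rw [Equiv.swap_apply_left]
      have eb : swapAfter T D a b w b = (w b).graft s ((w a).shift s) := by
        refine (congrFun e b).trans ?_
        rw [Equiv.swap_apply_right]
      have erest : rest.map (fun i => (swapAfter T D a b w i : ℝ≥0 → E)) =
          rest.map fun i => (w i : ℝ≥0 → E) := List.map_congr_left fun i hi =>
        congrArg Subtype.val (eo i (fun h => harest (h ▸ hi)) fun h => hbrest (h ▸ hi))
      have epre : pre.map (fun i => (swapAfter T D a b w i : ℝ≥0 → E)) =
          pre.map fun i => (w i : ℝ≥0 → E) := List.map_congr_left fun i hi =>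
        congrArg Subtype.val (eo i (fun h => hapre (h ▸ hi)) fun h => hbpre (h ▸ hi))
      have hgl : ∀ (v v' : CadlagPath E) t, t < s → v.graft s (v'.shift s) t = v t :=
        fun v v' t ht => CadlagPath.graft_of_lt ht
      have hgr : ∀ (v v' : CadlagPath E) t, s ≤ t → v.graft s (v'.shift s) t = v' t :=
        fun v v' t ht => (CadlagPath.graft_of_ge ht).trans
          (congrArg v' (add_tsub_cancel_of_le ht))
      have hle : ∀ {r : ℝ≥0} {T' : WithTop ℝ≥0}, r ≤ s → ¬ T' ≤ T w → (r : WithTop ℝ≥0) < T' :=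
        fun hr h' => ((WithTop.coe_le_coe.2 hr).trans_eq hsT.symm).trans_lt (not_le.1 h')
      have hsw := swap_of_early (a := w a) (b := w b) (a' := (w a).graft s ((w b).shift s))
        (b' := (w b).graft s ((w a).shift s)) (Z := coalPaths rest w) (T := s)
        (w a).isRC (CadlagPath.isRC _) hZ (hfirst w s h0 hsT)
        (fun r hr e => h0.1 r (hsT ▸ WithTop.coe_lt_coe.2 hr) ⟨w b, by simp [hξ], e⟩)
        (fun r hr => ha.1 r (hle hr hwD.1)) (fun r hr => hb.1 r (hle hr hwD.2))
        (hgl _ _) (hgr _ _) (hgl _ _) (hgr _ _)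
      simp only [coalPaths, List.map_append, List.map_cons]
      rw [epre, erest, ea, eb]
      exact coalSet_append_congr _ hsw
    · have e : swapAfter T D a b w = w := by rw [swapAfter, if_neg hwD]
      rw [e]
      have hsw := swap_of_late (a := w a) (b := w b) (Z := coalPaths rest w) (w a).isRC (w b).isRC hZ
        fun t ht => by
          have htT : T w ≤ t := by
            by_contra! hlt
            exact h0.1 t hlt ⟨w b, by simp [hξ], ht⟩
          rw [hD, Set.mem_inter_iff, Set.mem_compl_iff, Set.mem_compl_iff, not_and_or, not_not,
            not_not] at hwD
          rcases hwD with h' | h'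
          · have h' : Ta w ≤ t := le_trans h' htT
            obtain ⟨r, hr⟩ := WithTop.ne_top_iff_exists.1 (h'.trans_lt (WithTop.coe_lt_top t)).ne
            exact ⟨r, WithTop.coe_le_coe.1 (hr.trans_le h'), Or.inl (ha.2 r hr.symm)⟩
          · have h' : Tb w ≤ t := le_trans h' htT
            obtain ⟨r, hr⟩ := WithTop.ne_top_iff_exists.1 (h'.trans_lt (WithTop.coe_lt_top t)).ne
            exact ⟨r, WithTop.coe_le_coe.1 (hr.trans_le h'), Or.inr (hb.2 r hr.symm)⟩
      simp only [coalPaths, List.map_append, List.map_cons]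
      exact coalSet_append_congr _ hsw
  rw [collProb, collProb]
  change P _ = P _
  conv_rhs => rw [← hmap]
  rw [Measure.map_apply₀ hmeas.aemeasurable (hmap.symm ▸ hnull)]
  refine measure_congr ?_
  filter_upwards [key] with w hw
  exact congrArg (fun Z => HitsAll Z H) hw

theorem hitProb_swap (pre rest : List E) (a b : E) {H : List (ℝ≥0 × Set E)} (hH : IsOpenList H) :
    X.hitProb H (pre ++ b :: a :: rest) = X.hitProb H (pre ++ a :: b :: rest) := by
  have h1 : (List.finRange (pre ++ a :: b :: rest).length).map (pre ++ a :: b :: rest).get =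
    pre ++ a :: b :: rest := List.map_get_finRange _
  have hnd := List.nodup_finRange (pre ++ a :: b :: rest).length
  set x := (pre ++ a :: b :: rest).get with hx
  generalize List.finRange (pre ++ a :: b :: rest).length = l at h1 hnd
  obtain ⟨l₁, l', rfl, hl₁, hl'⟩ := List.map_eq_append_iff.1 h1
  obtain ⟨i, l'', rfl, hi, hl''⟩ := List.map_eq_cons_iff.1 hl'
  obtain ⟨j, l₃, rfl, hj, hl₃⟩ := List.map_eq_cons_iff.1 hl''
  have hnd' : (l₁ ++ j :: i :: l₃).Nodup :=
    (List.Perm.append_left l₁ (List.Perm.swap j i l₃)).nodup_iff.1 hnd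
  have e1 := collProb_eq_hitProb (X := X) hnd hH x
  have e2 := collProb_eq_hitProb (X := X) hnd' hH x
  rw [List.map_append, List.map_cons, List.map_cons, hl₁, hi, hj, hl₃] at e1 e2
  rw [← e1, ← e2]
  exact collProb_swap hnd hH x

theorem hitProb_perm {H : List (ℝ≥0 × Set E)} (hH : IsOpenList H) {L L' : List E}
    (h : L.Perm L') : X.hitProb H L = X.hitProb H L' := by
  -- The prefix absorbs the common head in the induction over permutations, so that exchanges are
  -- needed at arbitrary places only.
  suffices ∀ pre : List E, X.hitProb H (pre ++ L) = X.hitProb H (pre ++ L') from this []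
  induction h with
  | nil => exact fun _ => rfl
  | cons a _ ih =>
    intro pre
    have := ih (pre ++ [a])
    simpa using this
  | swap a b l => exact fun pre => hitProb_swap pre l a b hH
  | trans _ _ ih1 ih2 => exact fun pre => (ih1 pre).trans (ih2 pre)

end FellerProcess

end HitProb

/-! ### Continuity of hitting probabilities in the starting points -/

section Continuity

variable {E : Type*} [TopologicalSpace E] {ι : Type*} [MeasurableSpace E] [LocallyCompactSpace E]
  [SecondCountableTopology E] [T2Space E] [BorelSpace E]

namespace FellerProcess

variable {X : FellerProcess E}

variable (X) in
/-- The probability that two independent copies of `X` meet by the time `t₀`. -/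
def meetProb (t₀ : ℝ≥0) (a b : E) : ℝ≥0∞ :=
  ((X.law a).prod (X.law b)) {p : CadlagPath E × CadlagPath E | ∃ t ≤ t₀, p.1 t = p.2 t}

theorem isMarkovSystem_prod (a b : E) :
    IsMarkovSystem X ((X.law a).prod (X.law b))
      fun (i : Bool) (p : CadlagPath E × CadlagPath E) => cond i p.2 p.1 := by
  have hm : ∀ i : Bool, Measurable fun p : CadlagPath E × CadlagPath E => cond i p.2 p.1 := by
    intro i
    cases i
    exacts [measurable_fst, measurable_snd]
  have h1 := Measure.infinitePi_map_eval_prod (P := fun i : Bool => X.law (cond i b a))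
    (i := false) (j := true) (by decide)
  have hm' : Measurable fun w : Bool → CadlagPath E => (w false, w true) :=
    (measurable_pi_apply false).prodMk (measurable_pi_apply true)
  refine IsMarkovSystem.of_map hm ?_
  have h2 : ((X.law a).prod (X.law b)).map
      (fun (p : CadlagPath E × CadlagPath E) (i : Bool) => cond i p.2 p.1) =
      X.vecKernel Bool fun i => cond i b a := by
    refine (congrArg (Measure.map
      (fun (p : CadlagPath E × CadlagPath E) (i : Bool) => cond i p.2 p.1)) h1.symm).trans ?_
    rw [Measure.map_map (measurable_pi_lambda _ hm) hm']
    refine (congrArg (fun f => Measure.map f _) (?_ : _ = id)).trans Measure.map_id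
    funext w i
    cases i <;> rfl
  rw [h2]
  exact isMarkovSystem_vecKernel _

/-- The meeting event agrees almost surely with `T ≤ t₀` for a stopping time `T`. This justifies
passing to the complementary probability in `vecKernel_not_meet`. -/
theorem nullMeasurableSet_meet (t₀ : ℝ≥0) (a b : E) :
    NullMeasurableSet {p : CadlagPath E × CadlagPath E | ∃ t ≤ t₀, p.1 t = p.2 t}
      ((X.law a).prod (X.law b)) := by
  have hsys := isMarkovSystem_prod (X := X) a b
  obtain ⟨T, hT, h⟩ := exists_stoppingTime X hsys.measurable false [true]
  have hTm : MeasurableSet {p | T p ≤ t₀} := (pastFiltration _ hsys.measurable).le t₀ _ (hT t₀)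
  refine hTm.nullMeasurableSet.congr ?_
  filter_upwards [h _ hsys] with p hp
  refine propext (Iff.intro (fun hle => ?_) ?_)
  · obtain ⟨r, hr⟩ := WithTop.ne_top_iff_exists.1
      (lt_of_le_of_lt (show T p ≤ t₀ from hle) (WithTop.coe_lt_top t₀)).ne
    obtain ⟨z, hz, e⟩ := hp.2 r hr.symm
    simp only [List.map_singleton, coalSet_singleton, Set.mem_singleton_iff] at hz
    exact ⟨r, WithTop.coe_le_coe.1 (hr.trans_le hle), e.trans (congrFun hz r)⟩
  · rintro ⟨t, ht, e⟩
    change T p ≤ t₀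
    refine le_trans ?_ (WithTop.coe_le_coe.2 ht)
    by_contra! hlt
    exact hp.1 t hlt ⟨p.2, by simp, e⟩

theorem vecKernel_not_meet (t₀ : ℝ≥0) (x : ι → E) {i j : ι} (hij : i ≠ j) :
    X.vecKernel ι x {w | ¬ ∃ t ≤ t₀, w i t = w j t} = 1 - X.meetProb t₀ (x i) (x j) := by
  have h1 := Measure.infinitePi_map_eval_prod (P := fun i : ι => X.law (x i)) hij
  have hm : Measurable fun w : ι → CadlagPath E => (w i, w j) :=
    (measurable_pi_apply i).prodMk (measurable_pi_apply j)
  have hn := nullMeasurableSet_meet (X := X) t₀ (x i) (x j)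
  rw [meetProb, ← prob_compl_eq_one_sub₀ hn, ← h1,
    Measure.map_apply₀ hm.aemeasurable (h1.symm ▸ hn.compl)]
  rfl

theorem hitProb_cons_append_le {t₀ : ℝ≥0} {H : List (ℝ≥0 × Set E)} (hH : IsOpenList H)
    (ht : ∀ p ∈ H, p.1 = 0 ∨ t₀ ≤ p.1) {a b : E} (hab : ∀ p ∈ H, p.1 = 0 → a ∈ p.2 → b ∈ p.2)
    (L : List E) :
    X.hitProb H (a :: (L ++ [b])) ≤ X.hitProb H (L ++ [b]) + (1 - X.meetProb t₀ a b) := by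
  have h1 : (List.finRange (a :: (L ++ [b])).length).map (a :: (L ++ [b])).get =
    a :: (L ++ [b]) := List.map_get_finRange _
  have hnd := List.nodup_finRange (a :: (L ++ [b])).length
  set x := (a :: (L ++ [b])).get with hx
  generalize List.finRange (a :: (L ++ [b])).length = l at h1 hnd
  obtain ⟨i, l', rfl, hi, hl'⟩ := List.map_eq_cons_iff.1 h1
  obtain ⟨l₁, l₂, rfl, hl₁, hl₂⟩ := List.map_eq_append_iff.1 hl'
  obtain ⟨j, l₃, rfl, hj, hl₃⟩ := List.map_eq_cons_iff.1 hl₂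
  obtain rfl := List.map_eq_nil_iff.1 hl₃
  have hij : i ≠ j := fun h => (List.nodup_cons.1 hnd).1 (by simp [h])
  have e1 := collProb_eq_hitProb (X := X) hnd hH x
  have e2 := collProb_eq_hitProb (X := X) (List.nodup_cons.1 hnd).2 hH x
  rw [h1] at e1
  rw [hl'] at e2
  have e3 := vecKernel_not_meet (X := X) t₀ x hij
  rw [hi, hj] at e3
  rw [← e1, ← e2, ← e3]
  refine le_trans (measure_mono_ae ?_) (measure_union_le _ _)
  filter_upwards [X.vecKernel_start x i, X.vecKernel_start x j] with w hwi hwj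
  intro hw
  by_cases hmeet : ∃ t ≤ t₀, w i t = w j t
  · left
    obtain ⟨t, htt, e⟩ := hmeet
    set Z := coalPaths (l₁ ++ [j]) w with hZdef
    have hZ := isCoalescingFamily_coalPaths (l₁ ++ [j]) w
    -- The end of the list is the first particle, so the coalescing path of `b` is its free path.
    -- Meeting it by `t₀` absorbs the particle from `a` by `t₀`; only hits at time `0` remain, and
    -- there `b` stands in for `a`.
    have hjZ : (w j : ℝ≥0 → E) ∈ Z := by
      rw [hZdef, coalPaths, List.map_append]
      exact coalSet_append_subset _ _ (by simp)
    obtain ⟨s, hst, ⟨z, hz, ez⟩, hs⟩ :=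
      (w i).isRC.exists_first (Z := Z) (t := t) hZ.finite hZ.rc ⟨_, hjZ, e⟩
    intro p hp
    have hw' : ∃ z ∈ insert (fol (w i) Z) Z, z p.1 ∈ p.2 := hw p hp
    obtain ⟨z', hz' | hz', hzp⟩ := hw'
    · rcases ht p hp with h0 | h0
      · refine ⟨w j, hjZ, ?_⟩
        have h2 : fol (w i) Z 0 ∈ p.2 := by
          rw [hz', h0] at hzp
          exact hzp
        rw [fol_zero] at h2
        have h3 : w j p.1 = b := (congrArg (w j) h0).trans (hwj.trans hj)
        exact Set.mem_of_eq_of_mem h3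
          (hab p hp h0 (Set.mem_of_eq_of_mem (hwi.trans hi).symm h2))
      · refine ⟨z, hz, ?_⟩
        have h2 := fol_of_meets hZ.coalescing hz ez hs ((hst.trans htt).trans h0)
        rw [hz', h2] at hzp
        exact hzp
    · exact ⟨z', hz', hzp⟩
  · right
    exact hmeet

theorem hitProb_cons_le {t₀ : ℝ≥0} {H : List (ℝ≥0 × Set E)} (hH : IsOpenList H)
    (ht : ∀ p ∈ H, p.1 = 0 ∨ t₀ ≤ p.1) {a b : E} (hab : ∀ p ∈ H, p.1 = 0 → a ∈ p.2 → b ∈ p.2)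
    {L : List E} (hb : b ∈ L) :
    X.hitProb H (a :: L) ≤ X.hitProb H L + (1 - X.meetProb t₀ a b) := by
  classical
  have hp : L.Perm (L.erase b ++ [b]) :=
    (List.perm_cons_erase hb).trans (List.perm_append_singleton b _).symm
  rw [hitProb_perm hH hp, hitProb_perm hH (hp.cons a)]
  exact hitProb_cons_append_le hH ht hab _

theorem hitProb_append_le {t₀ : ℝ≥0} {H : List (ℝ≥0 × Set E)} (hH : IsOpenList H)
    (ht : ∀ p ∈ H, p.1 = 0 ∨ t₀ ≤ p.1) {ε : ℝ≥0∞} {L M : List E}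
    (h : ∀ a ∈ L, ∃ b ∈ M, (∀ p ∈ H, p.1 = 0 → a ∈ p.2 → b ∈ p.2) ∧
      1 - X.meetProb t₀ a b ≤ ε) :
    X.hitProb H (L ++ M) ≤ X.hitProb H M + L.length * ε := by
  induction L with
  | nil => simp
  | cons a L ih =>
    obtain ⟨b, hb, hab, hε⟩ := h a List.mem_cons_self
    calc X.hitProb H (a :: (L ++ M))
        ≤ X.hitProb H (L ++ M) + (1 - X.meetProb t₀ a b) :=
          hitProb_cons_le hH ht hab (List.mem_append_right L hb)
      _ ≤ (X.hitProb H M + L.length * ε) + ε :=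
          add_le_add (ih fun c hc => h c (List.mem_cons_of_mem _ hc)) hε
      _ = X.hitProb H M + (a :: L).length * ε := by
          rw [List.length_cons]
          push_cast
          ring

theorem exists_pos_le_times (H : List (ℝ≥0 × Set E)) :
    ∃ t₀ : ℝ≥0, 0 < t₀ ∧ ∀ p ∈ H, p.1 = 0 ∨ t₀ ≤ p.1 := by
  induction H with
  | nil => exact ⟨1, one_pos, by simp⟩
  | cons p H ih =>
    obtain ⟨t, ht, h⟩ := ih
    rcases eq_or_ne p.1 0 with h0 | h0
    · refine ⟨t, ht, fun q hq => ?_⟩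
      rcases List.mem_cons.1 hq with rfl | hq
      exacts [Or.inl h0, h q hq]
    · refine ⟨min t p.1, lt_min ht (pos_iff_ne_zero.2 h0), fun q hq => ?_⟩
      rcases List.mem_cons.1 hq with rfl | hq
      exacts [Or.inr (min_le_right _ _), (h q hq).imp_right fun h => (min_le_left _ _).trans h]

theorem exists_index_of_forall {α : Type*} {M : ℕ → List α} (hM : ∀ n k, n ≤ k → M n ⊆ M k)
    {R : α → α → Prop} (L : List α) (h : ∀ a ∈ L, ∃ n, ∃ b ∈ M n, R a b) :
    ∃ n, ∀ a ∈ L, ∃ b ∈ M n, R a b := by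
  induction L with
  | nil => exact ⟨0, by simp⟩
  | cons a L ih =>
    obtain ⟨n, hn⟩ := ih fun c hc => h c (List.mem_cons_of_mem _ hc)
    obtain ⟨k, b, hb, hab⟩ := h a List.mem_cons_self
    refine ⟨max n k, fun c hc => ?_⟩
    rcases List.mem_cons.1 hc with rfl | hc
    · exact ⟨b, hM k _ (le_max_right _ _) hb, hab⟩
    · obtain ⟨d, hd, hcd⟩ := hn c hc
      exact ⟨d, hM n _ (le_max_left _ _) hd, hcd⟩

/-- For large `n` every point of `L` has a partner in `M n` so close that it lies in the same
time-zero sets and is met by `t₀` with high probability. Adding `L` to `M n` then gains little. -/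
theorem hitProb_le_iSup (hX : X.ImmediateCollision) {H : List (ℝ≥0 × Set E)} (hH : IsOpenList H)
    {M : ℕ → List E} (hM : ∀ n k, n ≤ k → M n ⊆ M k) {L : List E}
    (hL : ∀ a ∈ L, ∀ V ∈ 𝓝 a, ∃ n, ∃ b ∈ M n, b ∈ V) :
    X.hitProb H L ≤ ⨆ n, X.hitProb H (M n) := by
  obtain ⟨t₀, ht₀, ht⟩ := exists_pos_le_times H
  refine ENNReal.le_of_forall_pos_le_add fun ε hε _ => ?_
  -- Each point of `L` may cost `δ`; the added one avoids division by zero for empty `L`.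
  set δ : ℝ≥0∞ := (ε : ℝ≥0∞) / (L.length + 1) with hδ
  have hδ0 : δ ≠ 0 := (ENNReal.div_pos (by simpa using hε.ne') (by finiteness)).ne'
  have hLδ : L.length * δ ≤ ε := by
    calc (L.length : ℝ≥0∞) * δ ≤ (L.length + 1) * δ := by gcongr; exact le_self_add
      _ = ε := ENNReal.mul_div_cancel (by simp) (by finiteness)
  obtain ⟨n, hn⟩ := exists_index_of_forall hM (R := fun a b =>
    (∀ p ∈ H, p.1 = 0 → a ∈ p.2 → b ∈ p.2) ∧ 1 - X.meetProb t₀ a b ≤ δ) L fun a ha => by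
      have h1 : ∀ᶠ b in 𝓝 a, ∀ p ∈ H, p.1 = 0 → a ∈ p.2 → b ∈ p.2 := by
        refine (eventually_all_finite (List.finite_toSet H)).2 fun p hp => ?_
        by_cases hap : a ∈ p.2
        · exact ((hH p hp).mem_nhds hap |> Filter.eventually_of_mem <| fun b hb _ _ => hb)
        · exact Eventually.of_forall fun b _ h => absurd h hap
      have h2 : ∀ᶠ b in 𝓝 a, 1 - X.meetProb t₀ a b ≤ δ := by
        have := (hX t₀ ht₀ a).eventually
          (Ioi_mem_nhds (ENNReal.sub_lt_self ENNReal.one_ne_top one_ne_zero hδ0))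
        filter_upwards [this] with b hb
        exact tsub_le_iff_left.2 (tsub_le_iff_right.1 (le_of_lt hb))
      obtain ⟨n, b, hb, hbV⟩ := hL a ha _ (h1.and h2)
      exact ⟨n, b, hb, hbV⟩
  calc X.hitProb H L ≤ X.hitProb H (M n ++ L) := hitProb_le_append hH _ _
    _ = X.hitProb H (L ++ M n) := hitProb_perm hH List.perm_append_comm
    _ ≤ X.hitProb H (M n) + L.length * δ := hitProb_append_le hH ht hn
    _ ≤ (⨆ n, X.hitProb H (M n)) + ε := add_le_add (le_iSup (fun n => X.hitProb H (M n)) n) hLδ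

variable (X) in
/-- The supremum of the probabilities with which finitely many coalescing paths started from
points of `A` visit the sets in the list `H`. -/
def hitSup (H : List (ℝ≥0 × Set E)) (A : Set E) : ℝ≥0∞ :=
  ⨆ (L : List E) (_ : ∀ a ∈ L, a ∈ A), X.hitProb H L

theorem hitSup_eq_iSup (hX : X.ImmediateCollision) {H : List (ℝ≥0 × Set E)} (hH : IsOpenList H)
    {M : ℕ → List E} (hM : ∀ n k, n ≤ k → M n ⊆ M k) {A : Set E} (hMA : ∀ n, ∀ b ∈ M n, b ∈ A)
    (hA : A ⊆ closure {b | ∃ n, b ∈ M n}) : X.hitSup H A = ⨆ n, X.hitProb H (M n) := by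
  refine le_antisymm (iSup₂_le fun L hL => ?_) (iSup_le fun n => ?_)
  · refine hitProb_le_iSup hX hH hM fun a ha V hV => ?_
    obtain ⟨b, hbV, n, hbn⟩ := mem_closure_iff_nhds.1 (hA (hL a ha)) V hV
    exact ⟨n, b, hbn, hbV⟩
  · exact le_iSup₂ (f := fun (L : List E) (_ : ∀ a ∈ L, a ∈ A) => X.hitProb H L) (M n) (hMA n)

end FellerProcess

end Continuity

/-! ### The set-valued process and its kernel -/

section SetValued

variable {E : Type*} [TopologicalSpace E] [MeasurableSpace E] [LocallyCompactSpace E]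
  [SecondCountableTopology E] [T2Space E] [BorelSpace E] {N : ℕ∞}

theorem exists_coalesce_version (X : FellerProcess E) {Ω : Type*} [MeasurableSpace Ω]
    {ξ : Idx N → Ω → CadlagPath E} (hξ : ∀ i, Measurable (ξ i)) :
    ∃ Y : Idx N → Ω → CadlagPath E, (∀ i, AdaptedPath hξ (Y i)) ∧
      ∀ (μ : Measure Ω) [IsFiniteMeasure μ], IsMarkovSystem X μ ξ → ∀ᵐ ω ∂μ, ∀ i,
        coalesce (fun j => (ξ j ω : ℝ≥0 → E)) i = Y i ω := by
  have h : ∀ i : Idx N, ∃ Y : Ω → CadlagPath E, AdaptedPath hξ Y ∧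
      ∀ (μ : Measure Ω) [IsFiniteMeasure μ], IsMarkovSystem X μ ξ → ∀ᵐ ω ∂μ,
        coalesce (fun j => (ξ j ω : ℝ≥0 → E)) i = Y ω := by
    intro i
    obtain ⟨k, hk, hk'⟩ := exists_version X hξ (idxBelow N i.1)
    obtain ⟨Y, T, hY, -, h⟩ := exists_version_and_stoppingTime X hξ i hk hk'
    refine ⟨Y, hY, fun μ _ hμ => (h μ hμ).mono fun ω hω => ?_⟩
    exact (coalesce_eq_fol (fun j => (ξ j ω).isRC) i).trans hω.2
  choose Y hY h using h
  exact ⟨Y, hY, fun μ _ hμ => ae_all_iff.2 fun i => h i μ hμ⟩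

variable [NeZero N]

/-- Open sets do not see the closure, and finitely many hits are made by finitely many particles.
This reduces an infinite system to its finite initial segments. -/
theorem setValued_mem_hitEvent {w : Idx N → CadlagPath E} {s : ℝ≥0} {H : List (ℝ≥0 × Set E)}
    (hH : IsOpenList H) : (fun t => setValued w (s + t)) ∈ hitEvent H ↔
      ∃ n, HitsAll ((fun (z : ℝ≥0 → E) t => z (s + t)) '' coalPaths (idxBelow N n) w) H := by
  have h1 : ∀ n, coalPaths (idxBelow N n) w =
      {z | ∃ i : Idx N, i.1 < n ∧ z = coalesce (fun j => (w j : ℝ≥0 → E)) i} := fun n =>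
    coalSet_idxBelow (fun i => (w i).isRC) n
  have h2 : ∀ n, HitsAll ((fun (z : ℝ≥0 → E) t => z (s + t)) '' coalPaths (idxBelow N n) w) H ↔
      ∀ p ∈ H, ∃ i : Idx N, i.1 < n ∧ coalesce (fun j => (w j : ℝ≥0 → E)) i (s + p.1) ∈ p.2 := by
    intro n
    rw [h1]
    refine forall₂_congr fun p hp => ?_
    constructor
    · rintro ⟨-, ⟨-, ⟨i, hi, rfl⟩, rfl⟩, h⟩
      exact ⟨i, hi, h⟩
    · rintro ⟨i, hi, h⟩
      exact ⟨_, ⟨_, ⟨i, hi, rfl⟩, rfl⟩, h⟩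
  simp only [h2]
  have h3 : (fun t => setValued w (s + t)) ∈ hitEvent H ↔
      ∀ p ∈ H, ∃ i : Idx N, coalesce (fun j => (w j : ℝ≥0 → E)) i (s + p.1) ∈ p.2 :=
    forall₂_congr fun p hp => closureRange_mem_hitSet (hH p hp)
  rw [h3]
  constructor
  · intro h
    clear h3 h2 hH
    induction H with
    | nil => exact ⟨0, by simp⟩
    | cons p H ih =>
      obtain ⟨n, hn⟩ := ih fun q hq => h q (List.mem_cons_of_mem _ hq)
      obtain ⟨i, hi⟩ := h p List.mem_cons_self
      refine ⟨max n (i.1 + 1), fun q hq => ?_⟩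
      rcases List.mem_cons.1 hq with rfl | hq
      · exact ⟨i, lt_max_of_lt_right (Nat.lt_succ_self _), hi⟩
      · obtain ⟨j, hj, hq⟩ := hn q hq
        exact ⟨j, lt_max_of_lt_left hj, hq⟩
  · rintro ⟨n, h⟩ p hp
    obtain ⟨i, -, hi⟩ := h p hp
    exact ⟨i, hi⟩

theorem hitsAll_idxBelow_mono (w : Idx N → CadlagPath E) (s : ℝ≥0) (H : List (ℝ≥0 × Set E)) :
    Monotone fun n =>
      HitsAll ((fun (z : ℝ≥0 → E) t => z (s + t)) '' coalPaths (idxBelow N n) w) H := by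
  refine monotone_nat_of_le_succ fun n h => h.mono (Set.image_mono ?_)
  simp only [coalPaths, coalSet_idxBelow fun i => (w i).isRC]
  rintro z ⟨i, hi, rfl⟩
  exact ⟨i, hi.trans (Nat.lt_succ_self n), rfl⟩

theorem idxBelow_subset {n k : ℕ} (h : n ≤ k) : idxBelow N n ⊆ idxBelow N k := fun _ hi =>
  mem_idxBelow.2 ((mem_idxBelow.1 hi).trans_le h)

/-- The probability that the set-valued process visits the sets in a list depends only on the
initial set. -/
theorem FellerProcess.vecKernel_hitEvent {X : FellerProcess E} (hX : X.ImmediateCollision)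
    {H : List (ℝ≥0 × Set E)} (hH : IsOpenList H) (x : Idx N → E) :
    X.vecKernel (Idx N) x {w | (fun t => setValued w t) ∈ hitEvent H} =
      X.hitSup H (closureRange x).1 := by
  have e : {w : Idx N → CadlagPath E | (fun t => setValued w t) ∈ hitEvent H} =
      ⋃ n, {w | HitsAll (coalPaths (idxBelow N n) w) H} := by
    ext w
    have h := setValued_mem_hitEvent (w := w) (s := 0) hH
    simp only [zero_add, Set.image_id'] at h
    rw [Set.mem_iUnion]
    exact h
  have hmono : Monotone fun n => {w : Idx N → CadlagPath E | HitsAll (coalPaths (idxBelow N n) w) H} :=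
    fun n k hnk w hw => by
      have h := hitsAll_idxBelow_mono w 0 H hnk
      simp only [zero_add, Set.image_id'] at h
      exact h hw
  rw [e, hmono.measure_iUnion, hitSup_eq_iSup hX hH (M := fun n => (idxBelow N n).map x)]
  · exact iSup_congr fun n => collProb_eq_hitProb (nodup_idxBelow N n) hH x
  · exact fun n k hnk => List.map_subset _ (idxBelow_subset hnk)
  · rintro n b hb
    obtain ⟨i, -, rfl⟩ := List.mem_map.1 hb
    exact subset_closure ⟨i, rfl⟩
  · refine closure_mono ?_
    rintro - ⟨i, rfl⟩
    exact ⟨i.1 + 1, List.mem_map.2 ⟨i, mem_idxBelow.2 (Nat.lt_succ_self _), rfl⟩⟩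

theorem measurable_setValued_version {Ω : Type*} [MeasurableSpace Ω]
    {Y : Idx N → Ω → CadlagPath E} (hY : ∀ i, Measurable (Y i)) {s : Ω → ℝ≥0} (hs : Measurable s) :
    Measurable fun ω t => closureRange fun i => Y i ω (s ω + t) := by
  have : PolishSpace E := polishSpace_of_locallyCompact
  exact measurable_pi_lambda _ fun t => measurable_closureRange fun i =>
    CadlagPath.measurable_apply_random (hY i) (hs.add_const t)

theorem IsMarkovSystem.aemeasurable_setValued {X : FellerProcess E} {Ω : Type*} [MeasurableSpace Ω]
    {μ : Measure Ω} [IsFiniteMeasure μ] {ξ : Idx N → Ω → CadlagPath E} (h : IsMarkovSystem X μ ξ)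
    {s : Ω → ℝ≥0} (hs : Measurable s) :
    AEMeasurable (fun ω t => setValued (fun i => ξ i ω) (s ω + t)) μ := by
  obtain ⟨Y, hY, h'⟩ := exists_coalesce_version X h.measurable
  refine ⟨_, measurable_setValued_version (fun i => (hY i).measurable) hs, ?_⟩
  filter_upwards [h' μ h] with ω hω
  funext t
  exact congrArg closureRange (funext fun i => congrFun (hω i) _)

instance : NeZero (⊤ : ℕ∞) := ⟨by simp⟩

theorem surjective_closureRange :
    Function.Surjective (closureRange : (Idx ⊤ → E) → ClosedSubset E) := by
  intro A
  have : Nonempty A.1 := A.2.2.to_subtype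
  obtain ⟨u, hu⟩ := exists_dense_seq A.1
  refine ⟨fun i => u i.1, Subtype.ext ?_⟩
  change closure (Set.range fun i : Idx ⊤ => (u i.1 : E)) = A.1
  have e : (Set.range fun i : Idx ⊤ => (u i.1 : E)) = Subtype.val '' Set.range u := by
    ext y
    simp only [Set.mem_range, Set.mem_image, exists_exists_eq_and]
    exact ⟨fun ⟨i, hi⟩ => ⟨i.1, hi⟩, fun ⟨n, hn⟩ => ⟨⟨n, ENat.natCast_lt_top n⟩, hn⟩⟩
  rw [e, ← image_closure_subtype_of_closed, hu.closure_range]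
  simp
where
  image_closure_subtype_of_closed {A : ClosedSubset E} {s : Set A.1} :
      Subtype.val '' closure s = closure (Subtype.val '' s : Set E) :=
    (A.2.1.isClosedEmbedding_subtypeVal.closure_image_eq s).symm

/-- The kernel that maps a closed set to the law of the set-valued process started from it. -/
theorem exists_setValued_kernel {X : FellerProcess E} (hX : X.ImmediateCollision) :
    ∃ Q : Kernel (ClosedSubset E) (ℝ≥0 → ClosedSubset E), IsMarkovKernel Q ∧
      ∀ A (H : List (ℝ≥0 × Set E)), IsOpenList H → Q A (hitEvent H) = X.hitSup H A.1 := by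
  have : PolishSpace E := polishSpace_of_locallyCompact
  have := countablySeparated_closedSubset (E := E)
  obtain ⟨Y, hY, h⟩ := exists_coalesce_version X
    (ξ := fun (i : Idx ⊤) (w : Idx ⊤ → CadlagPath E) => w i) measurable_pi_apply
  set V : (Idx ⊤ → CadlagPath E) → ℝ≥0 → ClosedSubset E :=
    fun w t => closureRange fun i => Y i w t with hV
  have hVm : Measurable V := by
    have := measurable_setValued_version (fun i => (hY i).measurable)
      (measurable_const (a := (0 : ℝ≥0)))
    simpa only [zero_add] using this
  have hVe : ∀ x, ∀ᵐ w ∂(X.vecKernel (Idx ⊤) x), (fun t => setValued w t) = V w := by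
    intro x
    filter_upwards [h _ (isMarkovSystem_vecKernel x)] with w hw
    funext t
    exact congrArg closureRange (funext fun i => congrFun (hw i) t)
  set K : Kernel (Idx ⊤ → E) (ℝ≥0 → ClosedSubset E) := (X.vecKernel (Idx ⊤)).map V with hK
  have hKM : IsMarkovKernel K := Kernel.IsMarkovKernel.map _ hVm
  have hKH : ∀ x (H : List (ℝ≥0 × Set E)), IsOpenList H →
      K x (hitEvent H) = X.hitSup H (closureRange x).1 := by
    intro x H hH
    rw [hK, Kernel.map_apply' _ hVm _ (measurableSet_hitEvent hH), ← X.vecKernel_hitEvent hX hH x]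
    refine measure_congr ?_
    filter_upwards [hVe x] with w hw
    exact congrArg (fun v => v ∈ hitEvent H) hw.symm
  have hKeq : ∀ x y, closureRange x = closureRange y → K x = K y := fun x y hxy =>
    measure_ext_of_hitEvent fun H hH => by rw [hKH x H hH, hKH y H hH, hxy]
  set g := Function.surjInv (surjective_closureRange (E := E)) with hg
  have hgr : ∀ A, closureRange (g A) = A := Function.surjInv_eq _
  refine ⟨⟨fun A => K (g A), ?_⟩, ⟨fun A => hKM.isProbabilityMeasure _⟩, fun A H hH => ?_⟩
  · have hc : Measurable (closureRange : (Idx ⊤ → E) → ClosedSubset E) :=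
      measurable_closureRange fun i => measurable_pi_apply i
    -- No measurable choice of a dense sequence is needed: for a measurable surjection from a
    -- standard Borel space onto a countably separated one, a map on the target is measurable as
    -- soon as its composition with the surjection is. Infinitely many particles are used so that
    -- every closed set is reached.
    refine (hc.measurable_comp_iff_of_surjective surjective_closureRange).1 ?_
    have e : (fun A => K (g A)) ∘ closureRange = K := funext fun x => hKeq _ _ (hgr _)
    rw [e]
    exact K.measurable
  · change K (g A) (hitEvent H) = _
    rw [hKH _ H hH, hgr]

end SetValued

/-! ### The strong Markov property of the set-valued process -/

section StrongMarkovSetValued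

variable {E : Type*} [TopologicalSpace E] [MeasurableSpace E] [LocallyCompactSpace E]
  [SecondCountableTopology E] [T2Space E] [BorelSpace E]

namespace IsMarkovSystem

variable {ι : Type*} {X : FellerProcess E} {Ω : Type*} [m : MeasurableSpace Ω] {μ : Measure Ω}
  [IsFiniteMeasure μ] {ξ : ι → Ω → CadlagPath E} (h : IsMarkovSystem X μ ξ)
  {S : Ω → WithTop ℝ≥0} (hS : IsStoppingTime (pastFiltration ξ h.measurable) S)

include hS in
/-- The list of the particles that are alive at a stopping time is known at this time. -/
theorem exists_alive_version (l : List ι) :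
    ∃ J : Ω → List ι, (∀ I, MeasurableSet[hS.measurableSpace] (J ⁻¹' {I})) ∧
      ∀ᵐ ω ∂μ, S ω < ⊤ → alive (fun i => (ξ i ω : ℝ≥0 → E)) (finVal S ω) l = J ω := by
  classical
  induction l with
  | nil =>
    refine ⟨fun _ => [], fun I => ?_, Eventually.of_forall fun ω _ => rfl⟩
    by_cases hI : I = []
    · subst hI
      convert MeasurableSet.univ
      ext
      simp
    · convert MeasurableSet.empty
      ext
      simpa [eq_comm] using hI
  | cons a l ih =>
    obtain ⟨J, hJ, hJ'⟩ := ih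
    obtain ⟨T, hT, hT'⟩ := exists_stoppingTime X h.measurable a l
    set D : Set Ω := {ω | T ω ≤ S ω} with hD
    have hDm : MeasurableSet[hS.measurableSpace] D := hT.measurableSet_stopping_time_le hS
    refine ⟨fun ω => if ω ∈ D then J ω else a :: J ω, fun I => ?_, ?_⟩
    · have e : (fun ω => if ω ∈ D then J ω else a :: J ω) ⁻¹' {I} =
          (D ∩ J ⁻¹' {I}) ∪ (Dᶜ ∩ {ω | a :: J ω = I}) := by
        ext ω
        by_cases hω : ω ∈ D <;> simp [hω]
      rw [e]
      refine MeasurableSet.union (MeasurableSet.inter hDm (hJ I))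
        (MeasurableSet.inter (MeasurableSet.compl hDm) ?_)
      rcases I with _ | ⟨b, I⟩
      · convert MeasurableSet.empty
        ext
        simp
      · by_cases hab : a = b
        · subst hab
          convert hJ I using 1
          ext
          simp
        · convert MeasurableSet.empty
          ext
          simp [hab]
    · filter_upwards [hJ', hT' μ h] with ω h1 h2 hfin
      have hiff : (∃ s ≤ finVal S ω, Meets (ξ a ω) (coalPaths l fun i => ξ i ω) s) ↔ ω ∈ D := by
        constructor
        · rintro ⟨s, hs, hm⟩
          change T ω ≤ S ω
          rw [← coe_finVal hfin]
          refine le_trans ?_ (WithTop.coe_le_coe.2 hs)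
          by_contra! hlt
          exact h2.1 s hlt hm
        · intro hle
          have hle : T ω ≤ S ω := hle
          obtain ⟨r, hr⟩ := WithTop.ne_top_iff_exists.1 (hle.trans_lt hfin).ne
          refine ⟨r, ?_, h2.2 r hr.symm⟩
          rw [← coe_finVal hfin, ← hr] at hle
          exact WithTop.coe_le_coe.1 hle
      rw [alive, h1 hfin]
      exact if_congr hiff rfl rfl

include hS in
theorem measure_inter_hitsAll_shiftAll {A : Set Ω} (hA : MeasurableSet[hS.measurableSpace] A)
    (hAS : A ⊆ {ω | S ω < ⊤}) (I : List ι) {H : List (ℝ≥0 × Set E)} (hH : IsOpenList H) :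
    μ (A ∩ {ω | HitsAll (coalPaths I (shiftAll (finVal S ω) fun i => ξ i ω)) H}) =
      ∫⁻ ω in A, X.collProb I H (fun i => ξ i ω (finVal S ω)) ∂μ := by
  have : PolishSpace E := polishSpace_of_locallyCompact
  have hAm : MeasurableSet A := hS.measurableSpace_le _ hA
  have hs : Measurable (finVal S) := measurable_finVal hS
  have hθ := measurable_shiftAll_random h.measurable hs
  have hp := measurable_apply_all_random h.measurable hs
  have hstrong := h.strong hS hA hAS
  set ν : Measure (ι → E) := (μ.restrict A).map fun ω i => ξ i ω (finVal S ω) with hν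
  have hpm : Measurable fun ω => X.vecKernel ι fun i => ξ i ω (finVal S ω) :=
    (X.vecKernel ι).measurable.comp hp
  have hbind : ((μ.restrict A).bind fun ω => X.vecKernel ι fun i => ξ i ω (finVal S ω)) =
      ν.bind (X.vecKernel ι) := by
    ext B hB
    rw [Measure.bind_apply hB hpm.aemeasurable,
      Measure.bind_apply hB (X.vecKernel ι).aemeasurable, hν,
      lintegral_map ((X.vecKernel ι).measurable_coe hB) hp]
  rw [hbind] at hstrong
  have hsys : IsMarkovSystem X (ν.bind (X.vecKernel ι)) fun i (w : ι → CadlagPath E) => w i :=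
    isMarkovSystem_bind ν
  have hfinite : IsFiniteMeasure (ν.bind (X.vecKernel ι)) := by
    rw [← hstrong]
    infer_instance
  -- The restarted system is a Markov system with random starting points, so the same measurable
  -- version `B` of the event is valid for its law and for every deterministic start.
  obtain ⟨B, hB, hB'⟩ := exists_measurable_hitsAll X
    (ξ := fun i (w : ι → CadlagPath E) => w i) measurable_pi_apply I hH
  have e1 : μ (A ∩ {ω | HitsAll (coalPaths I (shiftAll (finVal S ω) fun i => ξ i ω)) H}) =
      μ (A ∩ {ω | (shiftAll (finVal S ω) fun i => ξ i ω) ∈ B}) := by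
    have h1 := hB' _ hsys
    rw [← hstrong] at h1
    have h2 := ae_of_ae_map hθ.aemeasurable h1
    refine measure_congr ?_
    have h3 := (ae_restrict_iff' hAm).1 h2
    filter_upwards [h3] with ω hω
    refine propext ⟨fun hx => ⟨hx.1, ?_⟩, fun hx => ⟨hx.1, ?_⟩⟩
    · exact (hω hx.1).mp hx.2
    · exact (hω hx.1).mpr hx.2
  have e2 : ∀ x, X.collProb I H x = X.vecKernel ι x B := fun x =>
    measure_congr (hB' _ (isMarkovSystem_vecKernel x))
  have e3 := DFunLike.congr_fun hstrong B
  rw [Measure.map_apply hθ hB, Measure.restrict_apply (hθ hB), Set.inter_comm,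
    Measure.bind_apply hB (X.vecKernel ι).aemeasurable, hν,
    lintegral_map ((X.vecKernel ι).measurable_coe hB) hp] at e3
  rw [e1]
  simp only [e2]
  exact e3

end IsMarkovSystem

variable {N : ℕ∞} [NeZero N] {X : FellerProcess E} {Ω : Type*} [m : MeasurableSpace Ω]
  {μ : Measure Ω} [IsFiniteMeasure μ] {ξ : Idx N → Ω → CadlagPath E} (h : IsMarkovSystem X μ ξ)
  {S : Ω → WithTop ℝ≥0} (hS : IsStoppingTime (pastFiltration ξ h.measurable) S)

theorem image_coalPaths (w : Idx N → CadlagPath E) (s : ℝ≥0) (l : List (Idx N)) :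
    (fun (z : ℝ≥0 → E) t => z (s + t)) '' coalPaths l w =
      coalPaths (alive (fun i => (w i : ℝ≥0 → E)) s l) (shiftAll s w) :=
  shift_image_coalSet (fun i => (w i).isRC) s l

/-- The positions of the particles that are alive at the time `s`. -/
theorem mem_alive_positions {w : Idx N → CadlagPath E} {s : ℝ≥0} {n : ℕ} {y : E} :
    y ∈ (alive (fun i => (w i : ℝ≥0 → E)) s (idxBelow N n)).map (fun i => w i s) ↔
      ∃ i : Idx N, i.1 < n ∧ y = coalesce (fun j => (w j : ℝ≥0 → E)) i s := by
  have h1 := coalSet_image_zero ((alive (fun i => (w i : ℝ≥0 → E)) s (idxBelow N n)).map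
    fun i => (shiftAll s w i : ℝ≥0 → E))
  have h2 := image_coalPaths w s (idxBelow N n)
  rw [coalPaths, coalPaths, coalSet_idxBelow fun i => (w i).isRC] at h2
  rw [← h2, List.map_map] at h1
  have h3 : ((fun x : ℝ≥0 → E => x 0) ∘ fun i => (shiftAll s w i : ℝ≥0 → E)) = fun i => w i s := by
    funext i
    exact congrArg (w i) (add_zero s)
  rw [h3] at h1
  refine (Set.ext_iff.1 h1 y).symm.trans ?_
  constructor
  · rintro ⟨-, ⟨-, ⟨i, hi, rfl⟩, rfl⟩, rfl⟩
    exact ⟨i, hi, congrArg _ (add_zero s)⟩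
  · rintro ⟨i, hi, rfl⟩
    exact ⟨_, ⟨_, ⟨i, hi, rfl⟩, rfl⟩, congrArg _ (add_zero s)⟩

theorem hitProb_alive_mono {H : List (ℝ≥0 × Set E)} (hH : IsOpenList H)
    (w : Idx N → CadlagPath E) (s : ℝ≥0) :
    Monotone fun n => X.hitProb H
      ((alive (fun i => (w i : ℝ≥0 → E)) s (idxBelow N n)).map fun i => w i s) := by
  refine monotone_nat_of_le_succ fun n => ?_
  rw [idxBelow]
  split_ifs with hn
  · rw [alive]
    split_ifs
    · exact le_rfl
    · exact FellerProcess.hitProb_le_cons hH _ _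
  · exact le_rfl

/-- The surviving particles among the first `n` occupy exactly the positions of the first `n`
coalescing paths, and the union of these over `n` is dense in the state at time `s`. -/
theorem iSup_hitProb_alive (hX : X.ImmediateCollision) {H : List (ℝ≥0 × Set E)}
    (hH : IsOpenList H) (w : Idx N → CadlagPath E) (s : ℝ≥0) :
    ⨆ n, X.hitProb H
      ((alive (fun i => (w i : ℝ≥0 → E)) s (idxBelow N n)).map fun i => w i s) =
      X.hitSup H (setValued w s).1 := by
  refine (FellerProcess.hitSup_eq_iSup hX hH (fun n k hnk y hy => ?_) (fun n y hy => ?_) ?_).symm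
  · obtain ⟨i, hi, e⟩ := mem_alive_positions.1 hy
    exact mem_alive_positions.2 ⟨i, hi.trans_le hnk, e⟩
  · obtain ⟨i, hi, rfl⟩ := mem_alive_positions.1 hy
    exact subset_closure ⟨i, rfl⟩
  · refine closure_mono ?_
    rintro - ⟨i, rfl⟩
    exact ⟨i.1 + 1, mem_alive_positions.2 ⟨i, Nat.lt_succ_self _, rfl⟩⟩

include hS in
theorem IsMarkovSystem.measure_inter_hitsAll_idxBelow {A : Set Ω}
    (hA : MeasurableSet[hS.measurableSpace] A) (hAS : A ⊆ {ω | S ω < ⊤}) (n : ℕ)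
    {H : List (ℝ≥0 × Set E)} (hH : IsOpenList H) :
    AEMeasurable (fun ω => X.hitProb H ((alive (fun i => (ξ i ω : ℝ≥0 → E)) (finVal S ω)
      (idxBelow N n)).map fun i => ξ i ω (finVal S ω))) (μ.restrict A) ∧
    μ (A ∩ {ω | HitsAll ((fun (z : ℝ≥0 → E) t => z (finVal S ω + t)) ''
        coalPaths (idxBelow N n) fun i => ξ i ω) H}) =
      ∫⁻ ω in A, X.hitProb H ((alive (fun i => (ξ i ω : ℝ≥0 → E)) (finVal S ω)
        (idxBelow N n)).map fun i => ξ i ω (finVal S ω)) ∂μ := by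
  have : PolishSpace E := polishSpace_of_locallyCompact
  have hAm : MeasurableSet A := hS.measurableSpace_le _ hA
  obtain ⟨J, hJ, hJ'⟩ := h.exists_alive_version hS (idxBelow N n)
  have hJm : ∀ I, MeasurableSet (J ⁻¹' {I}) := fun I => hS.measurableSpace_le _ (hJ I)
  -- The list of survivors takes countably many values and is known at `S`; on each piece a fixed
  -- list of free particles restarts.
  have hU : A = ⋃ I, A ∩ J ⁻¹' {I} := by
    ext ω
    simp
  have hdisj : Pairwise (Function.onFun Disjoint fun I => A ∩ J ⁻¹' {I}) := by
    intro I I' hI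
    refine Set.disjoint_left.2 fun ω h1 h2 => hI ?_
    exact h1.2.symm.trans h2.2
  have hAI : ∀ I, MeasurableSet (A ∩ J ⁻¹' {I}) := fun I => hAm.inter (hJm I)
  have hp := measurable_apply_all_random h.measurable (measurable_finVal hS)
  have hJA : ∀ᵐ ω ∂(μ.restrict A),
      alive (fun i => (ξ i ω : ℝ≥0 → E)) (finVal S ω) (idxBelow N n) = J ω := by
    refine (ae_restrict_iff' hAm).2 (hJ'.mono fun ω hω hωA => hω (hAS hωA))
  have hg : ∀ᵐ ω ∂(μ.restrict A), X.hitProb H ((alive (fun i => (ξ i ω : ℝ≥0 → E)) (finVal S ω)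
      (idxBelow N n)).map fun i => ξ i ω (finVal S ω)) =
      X.collProb (J ω) H fun i => ξ i ω (finVal S ω) := by
    filter_upwards [hJA] with ω hω
    have hnd := (alive_sublist (fun i => (ξ i ω : ℝ≥0 → E)) (finVal S ω) (idxBelow N n)).nodup
      (nodup_idxBelow N n)
    rw [hω] at hnd ⊢
    exact (FellerProcess.collProb_eq_hitProb hnd hH _).symm
  have hcm : Measurable fun ω => X.collProb (J ω) H fun i => ξ i ω (finVal S ω) := by
    intro C hC
    have e : (fun ω => X.collProb (J ω) H fun i => ξ i ω (finVal S ω)) ⁻¹' C =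
        ⋃ I, J ⁻¹' {I} ∩ (fun ω => X.collProb I H fun i => ξ i ω (finVal S ω)) ⁻¹' C := by
      ext ω
      simp
    rw [e]
    exact MeasurableSet.iUnion fun I => (hJm I).inter
      ((FellerProcess.measurable_collProb I hH).comp hp hC)
  refine ⟨⟨_, hcm, hg⟩, ?_⟩
  rw [lintegral_congr_ae hg]
  set G := {ω | HitsAll ((fun (z : ℝ≥0 → E) t => z (finVal S ω + t)) ''
    coalPaths (idxBelow N n) fun i => ξ i ω) H} with hG
  conv_rhs => rw [hU]
  rw [lintegral_iUnion hAI hdisj]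
  have h1 : μ (A ∩ G) = ∑' I, μ (A ∩ J ⁻¹' {I} ∩ G) := by
    have h2 := measure_iUnion (μ := μ.restrict G) hdisj hAI
    rw [← hU, Measure.restrict_apply hAm] at h2
    rw [h2]
    exact tsum_congr fun I => Measure.restrict_apply (hAI I)
  rw [h1]
  refine tsum_congr fun I => ?_
  rw [setLIntegral_congr_fun (g := fun ω => X.collProb I H fun i => ξ i ω (finVal S ω)) (hAI I)
    fun ω hω => by
      have : J ω = I := hω.2
      simp only [this],
    ← h.measure_inter_hitsAll_shiftAll hS (MeasurableSet.inter hA (hJ I))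
      (Set.inter_subset_left.trans hAS) I hH]
  refine measure_congr ?_
  filter_upwards [hJ'] with ω hω
  refine propext (and_congr_right fun hx => ?_)
  have e : alive (fun i => (ξ i ω : ℝ≥0 → E)) (finVal S ω) (idxBelow N n) = I :=
    (hω (hAS hx.1)).trans hx.2
  change HitsAll _ H ↔ HitsAll _ H
  rw [image_coalPaths (fun i => ξ i ω) (finVal S ω), e]

include hS in
/-- The strong Markov property of the set-valued process, for the events that it visits the sets
in a list. -/
theorem IsMarkovSystem.measure_inter_hitEvent (hX : X.ImmediateCollision) {A : Set Ω}
    (hA : MeasurableSet[hS.measurableSpace] A) (hAS : A ⊆ {ω | S ω < ⊤})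
    {H : List (ℝ≥0 × Set E)} (hH : IsOpenList H) :
    μ (A ∩ {ω | (fun t => setValued (fun i => ξ i ω) (finVal S ω + t)) ∈ hitEvent H}) =
      ∫⁻ ω in A, X.hitSup H (setValued (fun i => ξ i ω) (finVal S ω)).1 ∂μ := by
  have e : A ∩ {ω | (fun t => setValued (fun i => ξ i ω) (finVal S ω + t)) ∈ hitEvent H} =
      ⋃ n, A ∩ {ω | HitsAll ((fun (z : ℝ≥0 → E) t => z (finVal S ω + t)) ''
        coalPaths (idxBelow N n) fun i => ξ i ω) H} := by
    rw [← Set.inter_iUnion]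
    congr 1
    ext ω
    rw [Set.mem_iUnion]
    exact setValued_mem_hitEvent hH
  rw [e, Monotone.measure_iUnion]
  · simp only [(h.measure_inter_hitsAll_idxBelow hS hA hAS _ hH).2]
    rw [← lintegral_iSup']
    · exact lintegral_congr fun ω => iSup_hitProb_alive hX hH _ _
    · exact fun n => (h.measure_inter_hitsAll_idxBelow hS hA hAS n hH).1
    · exact Eventually.of_forall fun ω => hitProb_alive_mono hH (fun i => ξ i ω) (finVal S ω)
  · exact fun n k hnk ω hω =>
      ⟨hω.1, hitsAll_idxBelow_mono (fun i => ξ i ω) (finVal S ω) H hnk hω.2⟩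

include hS in
theorem IsMarkovSystem.exists_setValued_version :
    ∃ Z : Ω → ClosedSubset E, Measurable Z ∧
      (∀ C, MeasurableSet C → MeasurableSet[hS.measurableSpace] ({ω | S ω < ⊤} ∩ Z ⁻¹' C)) ∧
      ∀ᵐ ω ∂μ, setValued (fun i => ξ i ω) (finVal S ω) = Z ω := by
  have : PolishSpace E := polishSpace_of_locallyCompact
  obtain ⟨Y, hY, h'⟩ := exists_coalesce_version X h.measurable
  refine ⟨fun ω => closureRange fun i => Y i ω (finVal S ω), ?_, fun C hC => ?_, ?_⟩
  · exact measurable_closureRange fun i =>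
      CadlagPath.measurable_apply_random (hY i).measurable (measurable_finVal hS)
  · refine measurableSet_of_inter_le hS Set.inter_subset_left fun t => ?_
    have hm : Measurable[pastFiltration ξ h.measurable t] fun ω =>
        closureRange fun i => Y i ω (truncVal S t ω) :=
      measurable_closureRange fun i =>
        (hY i).measurable_truncVal_apply hS t measurable_id fun _ => le_rfl
    have e : {ω | S ω < ⊤} ∩ (fun ω => closureRange fun i => Y i ω (finVal S ω)) ⁻¹' C ∩
        {ω | S ω ≤ t} = {ω | S ω ≤ t} ∩
          (fun ω => closureRange fun i => Y i ω (truncVal S t ω)) ⁻¹' C := by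
      ext ω
      constructor
      · rintro ⟨⟨-, h1⟩, h2⟩
        refine ⟨h2, ?_⟩
        have e1 := truncVal_of_le (S := S) (t := t) (ω := ω) h2
        change closureRange (fun i => Y i ω (truncVal S t ω)) ∈ C
        rw [e1]
        exact h1
      · rintro ⟨h2, h1⟩
        have e1 := truncVal_of_le (S := S) (t := t) (ω := ω) h2
        change closureRange (fun i => Y i ω (truncVal S t ω)) ∈ C at h1
        rw [e1] at h1
        exact ⟨⟨lt_of_le_of_lt (show S ω ≤ t from h2) (WithTop.coe_lt_top t), h1⟩, h2⟩
    rw [e]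
    exact MeasurableSet.inter (hS t) (hm hC)
  · filter_upwards [h' μ h] with ω hω
    exact congrArg closureRange (funext fun i => congrFun (hω i) _)

include hS in
theorem IsMarkovSystem.map_setValued (hX : X.ImmediateCollision)
    {Q : Kernel (ClosedSubset E) (ℝ≥0 → ClosedSubset E)}
    (hQ : ∀ A (H : List (ℝ≥0 × Set E)), IsOpenList H → Q A (hitEvent H) = X.hitSup H A.1)
    {A : Set Ω} (hA : MeasurableSet[hS.measurableSpace] A) (hAS : A ⊆ {ω | S ω < ⊤})
    {Z : Ω → ClosedSubset E} (hZ : Measurable Z)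
    (hZ' : ∀ᵐ ω ∂μ, setValued (fun i => ξ i ω) (finVal S ω) = Z ω) :
    (μ.restrict A).map (fun ω t => setValued (fun i => ξ i ω) (finVal S ω + t)) =
      (μ.restrict A).bind fun ω => Q (Z ω) := by
  have hAm : MeasurableSet A := hS.measurableSpace_le _ hA
  have hm := h.aemeasurable_setValued (measurable_finVal hS)
  refine measure_ext_of_hitEvent fun H hH => ?_
  have hHm := measurableSet_hitEvent hH
  have hQZ : Measurable fun ω => Q (Z ω) := Q.measurable.comp hZ
  rw [Measure.map_apply_of_aemeasurable hm.restrict hHm,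
    Measure.bind_apply hHm hQZ.aemeasurable, Measure.restrict_apply' hAm,
    Set.inter_comm]
  refine (h.measure_inter_hitEvent hS hX hA hAS hH).trans (lintegral_congr_ae ?_)
  filter_upwards [ae_restrict_of_ae hZ'] with ω hω
  rw [hω]
  exact (hQ _ H hH).symm

theorem IsMarkovSystem.isStrongMarkov (hX : X.ImmediateCollision)
    {Q : Kernel (ClosedSubset E) (ℝ≥0 → ClosedSubset E)} [IsMarkovKernel Q]
    (hQ : ∀ A (H : List (ℝ≥0 × Set E)), IsOpenList H → Q A (hitEvent H) = X.hitSup H A.1) :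
    IsStrongMarkov μ (pastFiltration ξ h.measurable) Q
      fun t ω => setValued (fun i => ξ i ω) t where
  adapted t := by
    obtain ⟨Y, hY, h'⟩ := exists_coalesce_version X h.measurable
    refine ⟨fun ω => closureRange fun i => Y i ω t, measurable_closureRange fun i => hY i t, ?_⟩
    filter_upwards [h' μ h] with ω hω
    exact congrArg closureRange (funext fun i => congrFun (hω i) t)
  aemeasurable_shiftedPath τ hτ := h.aemeasurable_setValued (measurable_finVal hτ)
  condExp_shiftedPath τ hτ f hf hfb := by
    obtain ⟨C, hC⟩ := hfb
    have hm : AEMeasurable (fun ω t => setValued (fun i => ξ i ω) (finVal τ ω + t)) μ :=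
      h.aemeasurable_setValued (measurable_finVal hτ)
    obtain ⟨Z, hZ, hZτ, hZ'⟩ := h.exists_setValued_version hτ
    set D : Set Ω := {ω | τ ω < ⊤} with hD
    have hDτ : MeasurableSet[hτ.measurableSpace] D := by
      have := hZτ Set.univ MeasurableSet.univ
      simpa using this
    have hDm : MeasurableSet D := hτ.measurableSpace_le _ hDτ
    set F : ClosedSubset E → ℝ := fun A => ∫ w, f w ∂(Q A) with hF
    have hFm : Measurable F := (hf.stronglyMeasurable.integral_kernel (κ := Q)).measurable
    have hFb : ∀ A, ‖F A‖ ≤ C := fun A => by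
      refine (norm_integral_le_of_norm_le_const (C := C) (Eventually.of_forall hC)).trans ?_
      simp
    have hfm : AEMeasurable
        (fun ω => f fun t => setValued (fun i => ξ i ω) (finVal τ ω + t)) μ := hf.comp_aemeasurable hm
    -- The state at `τ` is measurable only up to null sets, so the conditional expectation is
    -- identified through its version `Z`, which on `D` is known at `τ`.
    have hgZ : Measurable[hτ.measurableSpace] (D.indicator fun ω => F (Z ω)) := by
      intro B hB
      have e : (D.indicator fun ω => F (Z ω)) ⁻¹' B =
          (D ∩ Z ⁻¹' (F ⁻¹' B)) ∪ (Dᶜ ∩ {_ω : Ω | (0 : ℝ) ∈ B}) := by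
        ext ω
        by_cases hω : ω ∈ D <;> simp [hω]
      rw [e]
      exact MeasurableSet.union (hZτ _ (hFm hB))
        (MeasurableSet.inter (MeasurableSet.compl hDτ) (MeasurableSet.const _))
    have hae : D.indicator (fun ω => ∫ w, f w ∂(Q (shiftedPath
        (fun t ω => setValued (fun i => ξ i ω) t) τ ω 0))) =ᵐ[μ]
        D.indicator fun ω => F (Z ω) := by
      filter_upwards [hZ'] with ω hω
      have e : shiftedPath (fun t ω => setValued (fun i => ξ i ω) t) τ ω 0 = Z ω :=
        (congrArg (setValued fun i => ξ i ω) (add_zero _)).trans hω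
      by_cases hωD : ω ∈ D
      · rw [Set.indicator_of_mem hωD, Set.indicator_of_mem hωD, e]
      · rw [Set.indicator_of_notMem hωD, Set.indicator_of_notMem hωD]
    refine EventuallyEq.trans ?_ hae.symm
    refine (ae_eq_condExp_of_forall_setIntegral_eq hτ.measurableSpace_le ?_ ?_ ?_ ?_).symm
    · refine Integrable.indicator ?_ hDm
      exact Integrable.of_bound hfm.aestronglyMeasurable C (Eventually.of_forall fun ω => hC _)
    · intro s _ _
      refine Integrable.integrableOn (Integrable.indicator ?_ hDm)
      exact Integrable.of_bound (hFm.comp hZ).aestronglyMeasurable C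
        (Eventually.of_forall fun ω => hFb _)
    · intro s hs _
      have hsm : MeasurableSet s := hτ.measurableSpace_le _ hs
      have hmap := h.map_setValued hτ hX hQ (A := s ∩ D) (MeasurableSet.inter hs hDτ)
        Set.inter_subset_right hZ hZ'
      rw [setIntegral_indicator hDm, setIntegral_indicator hDm]
      have e1 : ∫ ω in s ∩ D, f (fun t => setValued (fun i => ξ i ω) (finVal τ ω + t)) ∂μ =
          ∫ w, f w ∂((μ.restrict (s ∩ D)).map
            fun ω t => setValued (fun i => ξ i ω) (finVal τ ω + t)) :=
        (integral_map hm.restrict hf.aestronglyMeasurable).symm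
      have e2 : ∫ w, f w ∂((μ.restrict (s ∩ D)).bind fun ω => Q (Z ω)) =
          ∫ ω in s ∩ D, F (Z ω) ∂μ := by
        have hb : ((μ.restrict (s ∩ D)).bind fun ω => Q (Z ω)) =
            (μ.restrict (s ∩ D)).bind (Q.comap Z hZ) := rfl
        rw [hb, ← Measure.snd_compProd, Measure.snd, integral_map measurable_snd.aemeasurable
          hf.aestronglyMeasurable, Measure.integral_compProd]
        · rfl
        · exact Integrable.of_bound (hf.comp measurable_snd).aestronglyMeasurable C
            (Eventually.of_forall fun p => hC _)
      exact e2.symm.trans ((congrArg (fun ν => ∫ w, f w ∂ν) hmap).symm.trans e1.symm)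
    · exact hgZ.stronglyMeasurable.aestronglyMeasurable

end StrongMarkovSetValued

end Coalescing

end

/-! ### The main theorem -/

theorem mainTheorem10 {E : Type*} [TopologicalSpace E] [LocallyCompactSpace E]
    [SecondCountableTopology E] [T2Space E] [MeasurableSpace E] [BorelSpace E]
    (X : Coalescing.FellerProcess E) (hX : X.ImmediateCollision) (N : ℕ∞) [NeZero N] :
    ∃ Q : Kernel (Coalescing.ClosedSubset E) (ℝ≥0 → Coalescing.ClosedSubset E),
      IsMarkovKernel Q ∧
      (∀ x : Coalescing.Idx N → E,
        HasLaw (fun ξ t => Coalescing.setValued ξ t) (Q (Coalescing.closureRange x))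
          (X.vectorLaw x)) ∧
      ∀ (x : Coalescing.Idx N → E) {Ω : Type*} [MeasurableSpace Ω] (μ : Measure Ω)
        (ξ : Coalescing.Idx N → Ω → Coalescing.CadlagPath E) (h : Coalescing.IsFreeSystem X x μ ξ),
        Coalescing.IsStrongMarkov μ (Coalescing.freeFiltration ξ h.measurable) Q
          (fun t ω => Coalescing.setValued (fun i => ξ i ω) t) := by
  obtain ⟨Q, hQM, hQ⟩ := Coalescing.exists_setValued_kernel hX
  refine ⟨Q, hQM, fun x => ⟨?_, ?_⟩, fun x Ω _ μ ξ h => ?_⟩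
  · have h := Coalescing.isMarkovSystem_vecKernel (X := X) x
    have := h.aemeasurable_setValued (s := fun _ => 0) measurable_const
    simp only [zero_add] at this
    exact this
  · have h := Coalescing.isMarkovSystem_vecKernel (X := X) x
    have hm := h.aemeasurable_setValued (s := fun _ => 0) measurable_const
    simp only [zero_add] at hm
    change (X.vecKernel (Coalescing.Idx N) x).map _ = _
    refine Coalescing.measure_ext_of_hitEvent fun H hH => ?_
    rw [hQ _ H hH, ← X.vecKernel_hitEvent hX hH x]
    exact Measure.map_apply_of_aemeasurable hm (Coalescing.measurableSet_hitEvent hH)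
  · have := h.indep.isProbabilityMeasure
    -- `freeFiltration` and `pastFiltration` agree by definition.
    exact h.isMarkovSystem.isStrongMarkov hX hQ
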